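/- Conventions. A tensor product on a bicategory $\mathbf C$ is a pseudofunctor $\otimes:\mathbf C\times\mathbf C\to\mathbf C$; for 1-morphisms $f:X\to Y$ and $g:Z\to W$ it gives an invertible interchange 2-cell $s_{f,g}$ from "$1\otimes g$ followed by $f\otimes 1$" to "$f\otimes 1$ followed by $1\otimes g$". A weak b-bicategory structure on $(\mathbf C,\otimes)$ consists of a pseudo-natural family of 1-morphisms $\beta_{X,Y,Z}:X\otimes(Y\otimes Z)\to Y\otimes(X\otimes Z)$ (not required to be equivalences) and a natural (modification) family of invertible 2-cells $\gamma_{X,Y,Z,W}$ from the path $$X(Y(ZW))\xrightarrow{\beta_{X,Y,ZW}}Y(X(ZW))\xrightarrow{1\otimes\beta_{X,Z,W}}Y(Z(XW))\xrightarrow{\beta_{Y,Z,XW}}Z(Y(XW))$$ to the path $$X(Y(ZW))\xrightarrow{1\otimes\beta_{Y,Z,W}}X(Z(YW))\xrightarrow{\beta_{X,Z,YW}}Z(X(YW))\xrightarrow{1\otimes\beta_{X,Y,W}}Z(Y(XW)),$$ such that for all $X,Y,Z,U,V$ the two pastings on the boundary of the three-dimensional permutohedron agree. Both go from the path $X(Y(Z(UV)))\to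 Y(X(Z(UV)))\to Y(Z(X(UV)))\to Y(Z(U(XV)))\to Z(Y(U(XV)))\to Z(U(Y(XV)))\to U(Z(Y(XV)))$ to the path $X(Y(Z(UV)))\to X(Y(U(ZV)))\to X(U(Y(ZV)))\to X(U(Z(YV)))\to U(X(Z(YV)))\to U(Z(X(YV)))\to U(Z(Y(XV)))$. The first is built from $\gamma_{Y,Z,U,XV}$, $1\otimes\gamma_{X,Z,U,V}$, $\gamma_{X,Y,U,ZV}$, $1\otimes\gamma_{X,Y,Z,V}$, the second from $\gamma_{X,Y,Z,UV}$, $1\otimes\gamma_{X,Y,U,V}$, $\gamma_{X,Z,U,YV}$, $1\otimes\gamma_{Y,Z,U,V}$, and each in addition from three squares, which are pseudo-naturality cells of $\beta$ at $(1,1,\beta)$. Setting. Let $\mathcal E$ be a monoidal category, let $\mathbf C$ be the bicategory with one object $I$ and $\mathbf C(I,I)=\mathcal E$, where the composite $I\xrightarrow{A}I\xrightarrow{C}I$ is $A\otimes C$, and let $\otimes$ be a tensor product on $\mathbf C$ for which $1_I\otimes f$ and $f\otimes 1_I$ are identified with $f$, naturally in $f$ and compatibly with units and composition. The interchange cells become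 isomorphisms $s_{X,Y}:Y\otimes X\to X\otimes Y$ in $\mathcal E$. For a weak b-bicategory structure on $(\mathbf C,\otimes)$ put $B=\beta_{I,I,I}\in\mathcal E$. Each of the pseudo-naturality cells of $\beta$ at $(X,1,1)$, $(1,X,1)$ and $(1,1,X)$ is an isomorphism $B\otimes X\to X\otimes B$. We consider structures for which these three coincide, and write $t_{B,X}$ for the common value. For a family $t_{B,X}$ and an automorphism $Z$ of $B^{\otimes3}$ let $t_i$ be $t_{B,B}$ acting on the factors $i,i+1$ of a tensor power of $B$. If $t_{B,B}^2=1$, then $Z_{ijk}$ denotes $Z$ acting on the factors $i<j<k$ of $B^{\otimes 6}$, that is, a copy of $Z$ on three adjacent factors conjugated by the $t_i$'s; for example $Z_{124}=t_3^{-1}(Z\otimes1)t_3$. Theorem 4.1. (1) The assignment sending a weak b-bicategory structure to $(B,t,Z)$, where $Z=(t_1t_2t_1)^{-1}\gamma_{I,I,I,I}$, is a bijection from the weak b-bicategory structures on $(\mathbf C,\otimes)$ which have a single half-braiding in the above sense and satisfy $t_{B,B}^2=1$, onto the triples consisting of an object $B\in\mathcal E$, a half-braiding $t_{B,X}:B\otimes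 X\to X\otimes B$ with $t_{B,B}^2=1$ which is compatible with $\otimes$, and an automorphism $Z$ of $B^{\otimes 3}$ satisfying Zamolodchikov's tetrahedron equation $$Z_{124}Z_{135}Z_{236}Z_{456}=Z_{456}Z_{236}Z_{135}Z_{124}.$$ Here $t$ is compatible with $\otimes$ if $(s_{Y,X}s_{X,Y})\otimes 1_B=1$ and $t_{B,X}\otimes 1_{B\otimes B}=s_{X,B}\otimes 1_{B\otimes B}$ for all $X,Y\in\mathcal E$. (2) If the interchange is symmetric, i.e. $s_{Y,X}s_{X,Y}=1$ for all $X,Y\in\mathcal E$, then the assignment of $(B,Z)$ is a bijection from the weak b-bicategory structures on $(\mathbf C,\otimes)$ which have a single half-braiding, given by $t_{B,X}=s_{X,B}$, onto all pairs $(B,Z)$ consisting of an object $B\in\mathcal E$ and an automorphism $Z$ of $B^{\otimes3}$ satisfying the tetrahedron equation with respect to $t_{B,B}=s_{B,B}$. -/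

import Mathlib

open CategoryTheory

namespace BBicat

universe w v u

/-! ### Tensor products on a bicategory -/

section General

open Bicategory

/-- A tensor product on a bicategory `C`: a (pseudo)functor `C × C ⟶ C`. -/
abbrev TensorProduct (C : Type u) [Bicategory.{w, v} C] := (C × C) ⥤ᵖ C

/-- The pseudofunctor `id × F : C × D ⟶ C × D'`. -/
@[simps]
def idProd (C : Type u) [Bicategory.{w, v} C] {D D' : Type u} [Bicategory.{w, v} D]
    [Bicategory.{w, v} D'] (F : D ⥤ᵖ D') : (C × D) ⥤ᵖ (C × D') where
  obj p := (p.1, F.obj p.2)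
  map f := (f.1, F.map f.2)
  map₂ η := (η.1, F.map₂ η.2)
  mapId p := Iso.prod (Iso.refl _) (F.mapId p.2)
  mapComp f g := Iso.prod (Iso.refl _) (F.mapComp f.2 g.2)

/-- The pseudofunctor `(X, Y, Z) ↦ (Y, X, Z)`. -/
@[simps]
def swapFirst (C : Type u) [Bicategory.{w, v} C] : (C × (C × C)) ⥤ᵖ (C × (C × C)) where
  obj p := (p.2.1, (p.1, p.2.2))
  map f := (f.2.1, (f.1, f.2.2))
  map₂ η := (η.2.1, (η.1, η.2.2))
  mapId _ := Iso.refl _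
  mapComp _ _ := Iso.refl _

variable {C : Type u} [Bicategory.{w, v} C]

/-- Vertical pasting of two squares of 1-morphisms filled with invertible 2-cells. -/
def pasteSq {a b c a' b' c' : C} {l : a ⟶ a'} {m : b ⟶ b'} {r : c ⟶ c'} {p : a ⟶ b} {q : b ⟶ c}
    {p' : a' ⟶ b'} {q' : b' ⟶ c'} (σ : l ≫ p' ≅ p ≫ m) (τ : m ≫ q' ≅ q ≫ r) :
    l ≫ (p' ≫ q') ≅ (p ≫ q) ≫ r :=
  (α_ l p' q').symm ≪≫ whiskerRightIso σ q' ≪≫ α_ p m q' ≪≫ whiskerLeftIso p τ ≪≫ (α_ p q r).symm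

/-- Apply a 2-cell to the first two 1-morphisms of a (right bracketed) path. -/
def onFirst2 {a b b' c d : C} {p : a ⟶ b} {q : b ⟶ c} {p' : a ⟶ b'} {q' : b' ⟶ c}
    (η : p ≫ q ⟶ p' ≫ q') (s : c ⟶ d) : p ≫ (q ≫ s) ⟶ p' ≫ (q' ≫ s) :=
  (α_ p q s).inv ≫ η ▷ s ≫ (α_ p' q' s).hom

/-- Apply a 2-cell to the first three 1-morphisms of a (right bracketed) path. -/
def onFirst3 {a b c b' c' d e : C} {p : a ⟶ b} {q : b ⟶ c} {r : c ⟶ d}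
    {p' : a ⟶ b'} {q' : b' ⟶ c'} {r' : c' ⟶ d}
    (η : p ≫ (q ≫ r) ⟶ p' ≫ (q' ≫ r')) (s : d ⟶ e) :
    p ≫ (q ≫ (r ≫ s)) ⟶ p' ≫ (q' ≫ (r' ≫ s)) :=
  p ◁ (α_ q r s).inv ≫ (α_ p (q ≫ r) s).inv ≫ η ▷ s ≫
    (α_ p' (q' ≫ r') s).hom ≫ p' ◁ (α_ q' r' s).hom

variable (T : TensorProduct C)

/-- The pseudofunctor `X ⊗ -`; on 1-morphisms it is `f ↦ 1_X ⊗ f`. -/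
abbrev leftTensor (X : C) : C ⥤ᵖ C := (Bicategory.Prod.sectR X C).toPseudofunctor.comp T

/-- The pseudofunctor `- ⊗ Y`; on 1-morphisms it is `f ↦ f ⊗ 1_Y`. -/
abbrev rightTensor (Y : C) : C ⥤ᵖ C := (Bicategory.Prod.sectL C Y).toPseudofunctor.comp T

/-- The pseudofunctor `(X, Y, Z) ↦ X ⊗ (Y ⊗ Z)`. -/
abbrev tensor3 : (C × (C × C)) ⥤ᵖ C := (idProd C T).comp T

/-- The pseudofunctor `(X, Y, Z) ↦ Y ⊗ (X ⊗ Z)`. -/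
abbrev tensor3Swap : (C × (C × C)) ⥤ᵖ C := (swapFirst C).comp (tensor3 T)

/-- Tensor a square (with sides `l`, `p'`, `p`, `r`) with a 1-morphism `f : X ⟶ X'`:
the 2-cell `(f ⊗ l) ≫ (1 ⊗ p') ≅ (1 ⊗ p) ≫ (f ⊗ r)`. -/
def tensorSq {X X' a b a' b' : C} (f : X ⟶ X') {l : a ⟶ a'} {r : b ⟶ b'} {p : a ⟶ b}
    {p' : a' ⟶ b'} (σ : l ≫ p' ≅ p ≫ r) :
    T.map ((f, l) : (X, a) ⟶ (X', a')) ≫ (leftTensor T X').map p' ≅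
      (leftTensor T X).map p ≫ T.map ((f, r) : (X, b) ⟶ (X', b')) :=
  (T.mapComp ((f, l) : (X, a) ⟶ (X', a')) ((𝟙 X', p') : (X', a') ⟶ (X', b'))).symm ≪≫
    T.map₂Iso (Iso.prod (ρ_ f ≪≫ (λ_ f).symm) σ) ≪≫
      T.mapComp ((𝟙 X, p) : (X, a) ⟶ (X, b)) ((f, r) : (X, b) ⟶ (X', b'))

/-- The interchange 2-cell
`s_{f, g} : (1 ⊗ g) ≫ (f ⊗ 1) ≅ (f ⊗ 1) ≫ (1 ⊗ g)` of a tensor product. -/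
def interchange {X Y Z W : C} (f : X ⟶ Y) (g : Z ⟶ W) :
    (leftTensor T X).map g ≫ (rightTensor T W).map f ≅
      (rightTensor T Z).map f ≫ (leftTensor T Y).map g :=
  (tensorSq T f (λ_ g ≪≫ (ρ_ g).symm)).symm

/-- The 2-cell `1_X ⊗ η` for a 2-cell `η` between composites of three 1-morphisms, regarded as a
2-cell between the composites of the tensored 1-morphisms. -/
def tensorPath3 (X : C) {a b c b' c' d : C} {p : a ⟶ b} {q : b ⟶ c} {r : c ⟶ d}
    {p' : a ⟶ b'} {q' : b' ⟶ c'} {r' : c' ⟶ d} (η : p ≫ (q ≫ r) ⟶ p' ≫ (q' ≫ r')) :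
    (leftTensor T X).map p ≫ ((leftTensor T X).map q ≫ (leftTensor T X).map r) ⟶
      (leftTensor T X).map p' ≫ ((leftTensor T X).map q' ≫ (leftTensor T X).map r') :=
  (leftTensor T X).map p ◁ ((leftTensor T X).mapComp q r).inv ≫
    ((leftTensor T X).mapComp p (q ≫ r)).inv ≫ (leftTensor T X).map₂ η ≫
      ((leftTensor T X).mapComp p' (q' ≫ r')).hom ≫
        (leftTensor T X).map p' ◁ ((leftTensor T X).mapComp q' r').hom

/-! ### Weak b-bicategories -/

section Beta

variable {T} (β : Pseudofunctor.StrongTrans (tensor3 T) (tensor3Swap T))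

/-- The 1-morphism `β_{X,Y,Z} : X ⊗ (Y ⊗ Z) ⟶ Y ⊗ (X ⊗ Z)`. -/
def bApp (X Y Z : C) : T.obj (X, T.obj (Y, Z)) ⟶ T.obj (Y, T.obj (X, Z)) := β.app (X, (Y, Z))

/-- The pseudo-naturality 2-cell of `β` at `(f, g, h)`. -/
def bNat {X X' Y Y' Z Z' : C} (f : X ⟶ X') (g : Y ⟶ Y') (h : Z ⟶ Z') :
    T.map ((f, T.map ((g, h) : (Y, Z) ⟶ (Y', Z'))) :
        (X, T.obj (Y, Z)) ⟶ (X', T.obj (Y', Z'))) ≫ bApp β X' Y' Z' ≅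
      bApp β X Y Z ≫ T.map ((g, T.map ((f, h) : (X, Z) ⟶ (X', Z'))) :
        (Y, T.obj (X, Z)) ⟶ (Y', T.obj (X', Z'))) :=
  β.naturality ((f, (g, h)) : (X, (Y, Z)) ⟶ (X', (Y', Z')))

/-- The upper path `X(Y(ZW)) ⟶ Y(X(ZW)) ⟶ Y(Z(XW)) ⟶ Z(Y(XW))` of the hexagon. -/
def hexSrc (X Y Z W : C) :
    T.obj (X, T.obj (Y, T.obj (Z, W))) ⟶ T.obj (Z, T.obj (Y, T.obj (X, W))) :=
  bApp β X Y (T.obj (Z, W)) ≫ ((leftTensor T Y).map (bApp β X Z W) ≫ bApp β Y Z (T.obj (X, W)))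

/-- The lower path `X(Y(ZW)) ⟶ X(Z(YW)) ⟶ Z(X(YW)) ⟶ Z(Y(XW))` of the hexagon. -/
def hexTgt (X Y Z W : C) :
    T.obj (X, T.obj (Y, T.obj (Z, W))) ⟶ T.obj (Z, T.obj (Y, T.obj (X, W))) :=
  (leftTensor T X).map (bApp β Y Z W) ≫
    (bApp β X Z (T.obj (Y, W)) ≫ (leftTensor T Z).map (bApp β X Y W))

section

variable {X X' Y Y' Z Z' W W' : C} (f : X ⟶ X') (g : Y ⟶ Y') (h : Z ⟶ Z') (k : W ⟶ W')

/-- The 1-morphism `f ⊗ (g ⊗ (h ⊗ k))`. -/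
def map4 : T.obj (X, T.obj (Y, T.obj (Z, W))) ⟶ T.obj (X', T.obj (Y', T.obj (Z', W'))) :=
  T.map ((f, T.map ((g, T.map ((h, k) : (Z, W) ⟶ (Z', W'))) :
    (Y, T.obj (Z, W)) ⟶ (Y', T.obj (Z', W')))) :
    (X, T.obj (Y, T.obj (Z, W))) ⟶ (X', T.obj (Y', T.obj (Z', W'))))

/-- The pseudo-naturality 2-cell of the upper path of the hexagon. -/
def hexSrcNat : map4 (T := T) f g h k ≫ hexSrc β X' Y' Z' W' ≅
    hexSrc β X Y Z W ≫ map4 (T := T) h g f k :=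
  pasteSq (bNat β f g (T.map ((h, k) : (Z, W) ⟶ (Z', W'))))
    (pasteSq (tensorSq T g (bNat β f h k)) (bNat β g h (T.map ((f, k) : (X, W) ⟶ (X', W')))))

/-- The pseudo-naturality 2-cell of the lower path of the hexagon. -/
def hexTgtNat : map4 (T := T) f g h k ≫ hexTgt β X' Y' Z' W' ≅
    hexTgt β X Y Z W ≫ map4 (T := T) h g f k :=
  pasteSq (tensorSq T f (bNat β g h k))
    (pasteSq (bNat β f h (T.map ((g, k) : (Y, W) ⟶ (Y', W')))) (tensorSq T h (bNat β f g k)))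

end

variable (γ : ∀ X Y Z W : C, hexSrc β X Y Z W ≅ hexTgt β X Y Z W) (X Y Z U V : C)

/-- The square `β_{X,Y,Q} ≫ (1_Y ⊗ (1_X ⊗ p)) ⟶ (1_X ⊗ (1_Y ⊗ p)) ≫ β_{X,Y,Q'}`, that is, the
pseudo-naturality 2-cell of `β` at `(1, 1, p)` in one direction. -/
def sqInv {Q Q' : C} (p : Q ⟶ Q') :
    bApp β X Y Q ≫ (leftTensor T Y).map ((leftTensor T X).map p) ⟶
      (leftTensor T X).map ((leftTensor T Y).map p) ≫ bApp β X Y Q' :=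
  (bNat β (𝟙 X) (𝟙 Y) p).inv

/-- The pseudo-naturality 2-cell of `β` at `(1, 1, p)` in the other direction. -/
def sqHom {Q Q' : C} (p : Q ⟶ Q') :
    (leftTensor T X).map ((leftTensor T Y).map p) ≫ bApp β X Y Q' ⟶
      bApp β X Y Q ≫ (leftTensor T Y).map ((leftTensor T X).map p) :=
  (bNat β (𝟙 X) (𝟙 Y) p).hom

/-- The path of length six
`X(Y(Z(UV))) ⟶ Y(X(Z(UV))) ⟶ Y(Z(X(UV))) ⟶ Y(Z(U(XV))) ⟶ Z(Y(U(XV))) ⟶ Z(U(Y(XV))) ⟶ U(Z(Y(XV)))`,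
the common source of the two pastings. -/
def permSrc : T.obj (X, T.obj (Y, T.obj (Z, T.obj (U, V)))) ⟶
    T.obj (U, T.obj (Z, T.obj (Y, T.obj (X, V)))) :=
  bApp β X Y (T.obj (Z, T.obj (U, V))) ≫
    (leftTensor T Y).map (bApp β X Z (T.obj (U, V))) ≫
    (leftTensor T Y).map ((leftTensor T Z).map (bApp β X U V)) ≫
    bApp β Y Z (T.obj (U, T.obj (X, V))) ≫
    (leftTensor T Z).map (bApp β Y U (T.obj (X, V))) ≫
    bApp β Z U (T.obj (Y, T.obj (X, V)))

/-- The path of length six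
`X(Y(Z(UV))) ⟶ X(Y(U(ZV))) ⟶ X(U(Y(ZV))) ⟶ X(U(Z(YV))) ⟶ U(X(Z(YV))) ⟶ U(Z(X(YV))) ⟶ U(Z(Y(XV)))`,
the common target of the two pastings. -/
def permTgt : T.obj (X, T.obj (Y, T.obj (Z, T.obj (U, V)))) ⟶
    T.obj (U, T.obj (Z, T.obj (Y, T.obj (X, V)))) :=
  (leftTensor T X).map ((leftTensor T Y).map (bApp β Z U V)) ≫
    (leftTensor T X).map (bApp β Y U (T.obj (Z, V))) ≫
    (leftTensor T X).map ((leftTensor T U).map (bApp β Y Z V)) ≫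
    bApp β X U (T.obj (Z, T.obj (Y, V))) ≫
    (leftTensor T U).map (bApp β X Z (T.obj (Y, V))) ≫
    (leftTensor T U).map ((leftTensor T Z).map (bApp β X Y V))

/-- The first pasting of the coherence condition on `γ`; it uses the cells `γ_{Y,Z,U,XV}`,
`1 ⊗ γ_{X,Z,U,V}`, `γ_{X,Y,U,ZV}` and `1 ⊗ γ_{X,Y,Z,V}` and three squares. -/
def pasting1 : permSrc β X Y Z U V ⟶ permTgt β X Y Z U V :=
  bApp β X Y (T.obj (Z, T.obj (U, V))) ◁
    (leftTensor T Y).map (bApp β X Z (T.obj (U, V))) ◁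
      (leftTensor T Y).map ((leftTensor T Z).map (bApp β X U V)) ◁
        (γ Y Z U (T.obj (X, V))).hom ≫
  bApp β X Y (T.obj (Z, T.obj (U, V))) ◁
    onFirst3 (tensorPath3 T Y (γ X Z U V).hom)
      (bApp β Y U (T.obj (Z, T.obj (X, V))) ≫ (leftTensor T U).map (bApp β Y Z (T.obj (X, V)))) ≫
  onFirst2 (sqInv β X Y (bApp β Z U V))
    ((leftTensor T Y).map (bApp β X U (T.obj (Z, V))) ≫
      (leftTensor T Y).map ((leftTensor T U).map (bApp β X Z V)) ≫
      bApp β Y U (T.obj (Z, T.obj (X, V))) ≫ (leftTensor T U).map (bApp β Y Z (T.obj (X, V)))) ≫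
  (leftTensor T X).map ((leftTensor T Y).map (bApp β Z U V)) ◁
    bApp β X Y (T.obj (U, T.obj (Z, V))) ◁
      (leftTensor T Y).map (bApp β X U (T.obj (Z, V))) ◁
        onFirst2 (sqHom β Y U (bApp β X Z V)) ((leftTensor T U).map (bApp β Y Z (T.obj (X, V)))) ≫
  (leftTensor T X).map ((leftTensor T Y).map (bApp β Z U V)) ◁
    onFirst3 (γ X Y U (T.obj (Z, V))).hom
      ((leftTensor T U).map ((leftTensor T Y).map (bApp β X Z V)) ≫
        (leftTensor T U).map (bApp β Y Z (T.obj (X, V)))) ≫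
  (leftTensor T X).map ((leftTensor T Y).map (bApp β Z U V)) ◁
    (leftTensor T X).map (bApp β Y U (T.obj (Z, V))) ◁
      bApp β X U (T.obj (Y, T.obj (Z, V))) ◁
        tensorPath3 T U (γ X Y Z V).hom ≫
  (leftTensor T X).map ((leftTensor T Y).map (bApp β Z U V)) ◁
    (leftTensor T X).map (bApp β Y U (T.obj (Z, V))) ◁
      onFirst2 (sqInv β X U (bApp β Y Z V))
        ((leftTensor T U).map (bApp β X Z (T.obj (Y, V))) ≫
          (leftTensor T U).map ((leftTensor T Z).map (bApp β X Y V)))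

/-- The second pasting of the coherence condition on `γ`; it uses the cells `γ_{X,Y,Z,UV}`,
`1 ⊗ γ_{X,Y,U,V}`, `γ_{X,Z,U,YV}` and `1 ⊗ γ_{Y,Z,U,V}` and three squares. -/
def pasting2 : permSrc β X Y Z U V ⟶ permTgt β X Y Z U V :=
  bApp β X Y (T.obj (Z, T.obj (U, V))) ◁
    (leftTensor T Y).map (bApp β X Z (T.obj (U, V))) ◁
      onFirst2 (sqHom β Y Z (bApp β X U V))
        ((leftTensor T Z).map (bApp β Y U (T.obj (X, V))) ≫
          bApp β Z U (T.obj (Y, T.obj (X, V)))) ≫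
  onFirst3 (γ X Y Z (T.obj (U, V))).hom
    ((leftTensor T Z).map ((leftTensor T Y).map (bApp β X U V)) ≫
      (leftTensor T Z).map (bApp β Y U (T.obj (X, V))) ≫
      bApp β Z U (T.obj (Y, T.obj (X, V)))) ≫
  (leftTensor T X).map (bApp β Y Z (T.obj (U, V))) ◁
    bApp β X Z (T.obj (Y, T.obj (U, V))) ◁
      onFirst3 (tensorPath3 T Z (γ X Y U V).hom) (bApp β Z U (T.obj (Y, T.obj (X, V)))) ≫
  (leftTensor T X).map (bApp β Y Z (T.obj (U, V))) ◁
    onFirst2 (sqInv β X Z (bApp β Y U V))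
      ((leftTensor T Z).map (bApp β X U (T.obj (Y, V))) ≫
        (leftTensor T Z).map ((leftTensor T U).map (bApp β X Y V)) ≫
        bApp β Z U (T.obj (Y, T.obj (X, V)))) ≫
  (leftTensor T X).map (bApp β Y Z (T.obj (U, V))) ◁
    (leftTensor T X).map ((leftTensor T Z).map (bApp β Y U V)) ◁
      bApp β X Z (T.obj (U, T.obj (Y, V))) ◁
        (leftTensor T Z).map (bApp β X U (T.obj (Y, V))) ◁
          sqHom β Z U (bApp β X Y V) ≫
  (leftTensor T X).map (bApp β Y Z (T.obj (U, V))) ◁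
    (leftTensor T X).map ((leftTensor T Z).map (bApp β Y U V)) ◁
      onFirst3 (γ X Z U (T.obj (Y, V))).hom
        ((leftTensor T U).map ((leftTensor T Z).map (bApp β X Y V))) ≫
  onFirst3 (tensorPath3 T X (γ Y Z U V).hom)
    (bApp β X U (T.obj (Z, T.obj (Y, V))) ≫
      (leftTensor T U).map (bApp β X Z (T.obj (Y, V))) ≫
      (leftTensor T U).map ((leftTensor T Z).map (bApp β X Y V)))

end Beta

/-- The structure of a weak b-bicategory on a bicategory with tensor product: a pseudo-natural
family of 1-morphisms `β_{X,Y,Z} : X ⊗ (Y ⊗ Z) ⟶ Y ⊗ (X ⊗ Z)` (not necessarily equivalences) and a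
natural family of invertible 2-cells `γ_{X,Y,Z,W}` filling the hexagon, such that the two pastings
around the three-dimensional permutohedron agree. -/
structure WeakBStructure where
  β : Pseudofunctor.StrongTrans (tensor3 T) (tensor3Swap T)
  γ : ∀ X Y Z W : C, hexSrc β X Y Z W ≅ hexTgt β X Y Z W
  γ_naturality : ∀ {X X' Y Y' Z Z' W W' : C} (f : X ⟶ X') (g : Y ⟶ Y') (h : Z ⟶ Z') (k : W ⟶ W'),
    map4 (T := T) f g h k ◁ (γ X' Y' Z' W').hom ≫ (hexTgtNat β f g h k).hom =
      (hexSrcNat β f g h k).hom ≫ (γ X Y Z W).hom ▷ map4 (T := T) h g f k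
  coherence : ∀ X Y Z U V : C, pasting1 β γ X Y Z U V = pasting2 β γ X Y Z U V

end General

/-! ### The case of a single object -/

section OneObject

open MonoidalCategory

variable {E : Type u} [Category.{v} E] [MonoidalCategory E]

/-- The action of a pseudofunctor on the objects of `E`. -/
def onObj (P : Pseudofunctor (MonoidalSingleObj E) (MonoidalSingleObj E)) (X : E) : E :=
  P.map (X := .star E) (Y := .star E) X

/-- The action of a pseudofunctor on the morphisms of `E`. -/
def onHom (P : Pseudofunctor (MonoidalSingleObj E) (MonoidalSingleObj E)) {X Y : E} (f : X ⟶ Y) :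
    onObj P X ⟶ onObj P Y :=
  P.map₂ (a := .star E) (b := .star E) f

/-- The unit constraint of a pseudofunctor, in `E`. -/
def onUnit (P : Pseudofunctor (MonoidalSingleObj E) (MonoidalSingleObj E)) : onObj P (𝟙_ E) ≅ 𝟙_ E :=
  P.mapId (.star E)

/-- The composition constraint of a pseudofunctor, in `E`. -/
def onTensor (P : Pseudofunctor (MonoidalSingleObj E) (MonoidalSingleObj E)) (X Y : E) :
    onObj P (X ⊗ Y) ≅ onObj P X ⊗ onObj P Y :=
  P.mapComp (a := .star E) (b := .star E) (c := .star E) X Y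

/-- An identification of a pseudofunctor `P` from a one-object bicategory to itself with the
identity: natural isomorphisms `P(X) ≅ X`, compatible with units and composition. -/
structure IdentityIdent (P : Pseudofunctor (MonoidalSingleObj E) (MonoidalSingleObj E)) where
  iso : ∀ X : E, onObj P X ≅ X
  naturality : ∀ {X Y : E} (f : X ⟶ Y), onHom P f ≫ (iso Y).hom = (iso X).hom ≫ f
  map_unit : (iso (𝟙_ E)).hom = (onUnit P).hom
  map_tensor : ∀ X Y : E,
    (iso (X ⊗ Y)).hom = (onTensor P X Y).hom ≫ ((iso X).hom ⊗ₘ (iso Y).hom)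

variable (T : TensorProduct (MonoidalSingleObj E))

/-- Identifications of `1 ⊗ -` and of `- ⊗ 1` with the identity, for a tensor product on a bicategory
with a single object. -/
structure UnitIdent where
  left : IdentityIdent (leftTensor T (.star E))
  right : IdentityIdent (rightTensor T (.star E))

variable {T} (u : UnitIdent T)

/-- The interchange cells `s_{X,Y} : Y ⊗ X ≅ X ⊗ Y` of the tensor product, as isomorphisms in `E`;
here `1 ⊗ Y` and `X ⊗ 1` are identified with `Y` and `X`. -/
def swapIso (X Y : E) : Y ⊗ X ≅ X ⊗ Y :=
  ((u.left.iso Y).symm ⊗ᵢ (u.right.iso X).symm) ≪≫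
    (show onObj (leftTensor T (.star E)) Y ⊗ onObj (rightTensor T (.star E)) X ≅
        onObj (rightTensor T (.star E)) X ⊗ onObj (leftTensor T (.star E)) Y from
      interchange T (X := .star E) (Y := .star E) (Z := .star E) (W := .star E) X Y) ≪≫
    (u.right.iso X ⊗ᵢ u.left.iso Y)

section HalfBraiding

/-- The tensor product of two 1-morphisms of a one-object bicategory, as an object of `E`. -/
def tens (T : TensorProduct (MonoidalSingleObj E)) (X Y : E) : E :=
  T.map (X := (.star E, .star E)) (Y := (.star E, .star E)) (X, Y)

/-- The tensor product of isomorphisms of `E`. -/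
def tensIso {X X' Y Y' : E} (e : X ≅ X') (e' : Y ≅ Y') : tens T X Y ≅ tens T X' Y' :=
  T.map₂Iso (a := (.star E, .star E)) (b := (.star E, .star E)) (Iso.prod e e')

/-- The identification of `1 ⊗ X` with `X`. -/
def UnitIdent.lIso (X : E) : tens T (𝟙_ E) X ≅ X := u.left.iso X

/-- The identification of `X ⊗ 1` with `X`. -/
def UnitIdent.rIso (X : E) : tens T X (𝟙_ E) ≅ X := u.right.iso X

/-- The identification of `X ⊗ (1 ⊗ 1)` with `X`. -/
def UnitIdent.iso1 (X : E) : tens T X (tens T (𝟙_ E) (𝟙_ E)) ≅ X :=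
  tensIso (Iso.refl X) (u.lIso (𝟙_ E)) ≪≫ u.rIso X

/-- The identification of `1 ⊗ (X ⊗ 1)` with `X`. -/
def UnitIdent.iso2 (X : E) : tens T (𝟙_ E) (tens T X (𝟙_ E)) ≅ X :=
  u.lIso (tens T X (𝟙_ E)) ≪≫ u.rIso X

/-- The identification of `1 ⊗ (1 ⊗ X)` with `X`. -/
def UnitIdent.iso3 (X : E) : tens T (𝟙_ E) (tens T (𝟙_ E) X) ≅ X :=
  u.lIso (tens T (𝟙_ E) X) ≪≫ u.lIso X

variable (β : Pseudofunctor.StrongTrans (tensor3 T) (tensor3Swap T))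

/-- The object `B` of `E` given by the 1-morphism `β_{I,I,I}`. -/
def bObj : E := bApp β (.star E) (.star E) (.star E)

/-- The pseudo-naturality 2-cell `β ≫ (g ⊗ (f ⊗ h)) ≅ (f ⊗ (g ⊗ h)) ≫ β`, as an isomorphism
in `E`. -/
def bCell (f g h : E) : bObj β ⊗ tens T g (tens T f h) ≅ tens T f (tens T g h) ⊗ bObj β :=
  (bNat β (X := .star E) (X' := .star E) (Y := .star E) (Y' := .star E) (Z := .star E)
    (Z' := .star E) f g h).symm

/-- The isomorphism `B ⊗ X ≅ X ⊗ B` given by the pseudo-naturality 2-cell at `(X, 1, 1)`. -/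
def halfBraiding1 (X : E) : bObj β ⊗ X ≅ X ⊗ bObj β :=
  whiskerLeftIso (bObj β) (u.iso2 X).symm ≪≫ bCell β X (𝟙_ E) (𝟙_ E) ≪≫
    whiskerRightIso (u.iso1 X) (bObj β)

/-- The isomorphism `B ⊗ X ≅ X ⊗ B` given by the pseudo-naturality 2-cell at `(1, X, 1)`. -/
def halfBraiding2 (X : E) : bObj β ⊗ X ≅ X ⊗ bObj β :=
  whiskerLeftIso (bObj β) (u.iso1 X).symm ≪≫ bCell β (𝟙_ E) X (𝟙_ E) ≪≫
    whiskerRightIso (u.iso2 X) (bObj β)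

/-- The isomorphism `B ⊗ X ≅ X ⊗ B` given by the pseudo-naturality 2-cell at `(1, 1, X)`. -/
def halfBraiding3 (X : E) : bObj β ⊗ X ≅ X ⊗ bObj β :=
  whiskerLeftIso (bObj β) (u.iso3 X).symm ≪≫ bCell β (𝟙_ E) (𝟙_ E) X ≪≫
    whiskerRightIso (u.iso3 X) (bObj β)

end HalfBraiding

/-! ### The tetrahedron equation -/

section Tetrahedron

variable {B : E} (τ : B ⊗ B ⟶ B ⊗ B) (Z : B ⊗ (B ⊗ B) ⟶ B ⊗ (B ⊗ B))

/-- `τ` on the first two factors of `B ⊗ (B ⊗ P)`. -/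
def first2 (P : E) : B ⊗ (B ⊗ P) ⟶ B ⊗ (B ⊗ P) :=
  (α_ B B P).inv ≫ τ ▷ P ≫ (α_ B B P).hom

/-- `Z` on the first three factors of `B ⊗ (B ⊗ (B ⊗ P))`. -/
def first3 (P : E) : B ⊗ (B ⊗ (B ⊗ P)) ⟶ B ⊗ (B ⊗ (B ⊗ P)) :=
  B ◁ (α_ B B P).inv ≫ (α_ B (B ⊗ B) P).inv ≫ Z ▷ P ≫ (α_ B (B ⊗ B) P).hom ≫ B ◁ (α_ B B P).hom

/-- The sixth tensor power `B ⊗ (B ⊗ (B ⊗ (B ⊗ (B ⊗ B))))`. -/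
abbrev pow6 (B : E) : E := B ⊗ (B ⊗ (B ⊗ (B ⊗ (B ⊗ B))))

/-- `τ` on the factors 2, 3 of the sixth tensor power. -/
def t2 : pow6 B ⟶ pow6 B := B ◁ first2 τ (B ⊗ (B ⊗ B))

/-- `τ` on the factors 3, 4 of the sixth tensor power. -/
def t3 : pow6 B ⟶ pow6 B := B ◁ B ◁ first2 τ (B ⊗ B)

/-- `τ` on the factors 4, 5 of the sixth tensor power. -/
def t4 : pow6 B ⟶ pow6 B := B ◁ B ◁ B ◁ first2 τ B

/-- `τ` on the factors 5, 6 of the sixth tensor power. -/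
def t5 : pow6 B ⟶ pow6 B := B ◁ B ◁ B ◁ B ◁ τ

/-- `Z` on the factors 1, 2, 4: conjugate `Z ⊗ 1` by the permutation moving factor 4 to place 3. -/
def Z124 : pow6 B ⟶ pow6 B := t3 τ ≫ first3 Z (B ⊗ (B ⊗ B)) ≫ t3 τ

/-- `Z` on the factors 1, 3, 5: conjugate `Z ⊗ 1` by the permutation moving the factors 3, 5 to the
places 2, 3. -/
def Z135 : pow6 B ⟶ pow6 B :=
  (t2 τ ≫ t4 τ ≫ t3 τ) ≫ first3 Z (B ⊗ (B ⊗ B)) ≫ (t3 τ ≫ t4 τ ≫ t2 τ)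

/-- `Z` on the factors 2, 3, 6: conjugate `1 ⊗ Z ⊗ 1` by the permutation moving factor 6 to
place 4. -/
def Z236 : pow6 B ⟶ pow6 B :=
  (t5 τ ≫ t4 τ) ≫ B ◁ first3 Z (B ⊗ B) ≫ (t4 τ ≫ t5 τ)

/-- `Z` on the factors 4, 5, 6. -/
def Z456 : pow6 B ⟶ pow6 B := B ◁ B ◁ B ◁ Z

/-- Zamolodchikov's tetrahedron equation `Z₁₂₄ Z₁₃₅ Z₂₃₆ Z₄₅₆ = Z₄₅₆ Z₂₃₆ Z₁₃₅ Z₁₂₄` for `Z`, with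
respect to a symmetric `τ : B ⊗ B ⟶ B ⊗ B` (that is, `τ ≫ τ = 𝟙`). -/
def TetrahedronEq : Prop :=
  Z456 Z ≫ Z236 τ Z ≫ Z135 τ Z ≫ Z124 τ Z = Z124 τ Z ≫ Z135 τ Z ≫ Z236 τ Z ≫ Z456 Z

end Tetrahedron

/-! ### The data extracted from a weak b-bicategory with a single object -/

variable (E) in
/-- An object `B`, isomorphisms `t_X : B ⊗ X ≅ X ⊗ B`, and an automorphism `Z` of `B ⊗ (B ⊗ B)`. -/
structure ZData where
  B : E
  t : ∀ X : E, B ⊗ X ≅ X ⊗ B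
  Z : B ⊗ (B ⊗ B) ≅ B ⊗ (B ⊗ B)

/-- The family `t` is a half-braiding on `B`. -/
def ZData.IsHalfBraiding (d : ZData E) : Prop := ∃ h : HalfBraiding d.B, h.β = d.t

/-- `t_{B,B}` squares to the identity. -/
def ZData.IsSymmetric (d : ZData E) : Prop := (d.t d.B).hom ≫ (d.t d.B).hom = 𝟙 (d.B ⊗ d.B)

/-- `Z` satisfies the tetrahedron equation with respect to `t_{B,B}`. -/
def ZData.Tetrahedron (d : ZData E) : Prop := TetrahedronEq (d.t d.B).hom d.Z.hom

/-- Compatibility of `(B, t)` with the interchange `s` of the tensor product: the double interchange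
becomes trivial after tensoring with `B`, and `t_X` agrees with `s_{X,B}` after tensoring with
`B ⊗ B`. -/
def ZData.Compatible (d : ZData E) : Prop :=
  (∀ X Y : E, ((swapIso u X Y).hom ≫ (swapIso u Y X).hom) ▷ d.B = 𝟙 ((Y ⊗ X) ⊗ d.B)) ∧
    ∀ X : E, (d.t X).hom ▷ (d.B ⊗ d.B) = (swapIso u X d.B).hom ▷ (d.B ⊗ d.B)

namespace WeakBStructure

variable (b : WeakBStructure T)

/-- The pseudo-naturality 2-cells at `(X, 1, 1)`, `(1, X, 1)` and `(1, 1, X)` are one and the same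
family of isomorphisms `B ⊗ X ≅ X ⊗ B`. -/
def HasOneHalfBraiding : Prop :=
  halfBraiding1 u b.β = halfBraiding3 u b.β ∧ halfBraiding2 u b.β = halfBraiding3 u b.β

/-- The cell `γ_{I,I,I,I}` as an automorphism `S` of `B ⊗ (B ⊗ B)`; here `1 ⊗ β` is identified
with `B`. -/
def S : bObj b.β ⊗ (bObj b.β ⊗ bObj b.β) ≅ bObj b.β ⊗ (bObj b.β ⊗ bObj b.β) :=
  whiskerLeftIso (bObj b.β) (whiskerRightIso (u.left.iso (bObj b.β)).symm (bObj b.β)) ≪≫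
    (show bObj b.β ⊗ (onObj (leftTensor T (.star E)) (bObj b.β) ⊗ bObj b.β) ≅
        onObj (leftTensor T (.star E)) (bObj b.β) ⊗
          (bObj b.β ⊗ onObj (leftTensor T (.star E)) (bObj b.β)) from
      b.γ (.star E) (.star E) (.star E) (.star E)) ≪≫
    (u.left.iso (bObj b.β) ⊗ᵢ whiskerLeftIso (bObj b.β) (u.left.iso (bObj b.β)))

/-- The automorphism `t₁ t₂ t₁` of `B ⊗ (B ⊗ B)`, where `t₁` and `t₂` are `τ` on the factors 1, 2 and
on the factors 2, 3. -/
def reversal {B : E} (τ : B ⊗ B ≅ B ⊗ B) : B ⊗ (B ⊗ B) ≅ B ⊗ (B ⊗ B) :=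
  ((α_ B B B).symm ≪≫ whiskerRightIso τ B ≪≫ α_ B B B) ≪≫ whiskerLeftIso B τ ≪≫
    ((α_ B B B).symm ≪≫ whiskerRightIso τ B ≪≫ α_ B B B)

/-- The data extracted from a weak b-bicategory structure: `B = β_{I,I,I}`, the isomorphisms `t`
given by pseudo-naturality of `β`, and the automorphism `Z` with `γ_{I,I,I,I} = t₁ t₂ t₁ Z`. -/
def zData : ZData E where
  B := bObj b.β
  t := halfBraiding3 u b.β
  Z := S u b ≪≫ (reversal (halfBraiding3 u b.β (bObj b.β))).symm

end WeakBStructure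

end OneObject

end BBicat

open CategoryTheory

namespace BBicat

universe v u

/-! With a single object, `⊗` is a monoidal functor from `E × E` to `E`, and `(X, Y)` is the product
of `(X, 1)` and `(1, Y)` in either order. The interchange cell compares the two orders, so by an
Eckmann–Hilton argument its inverse is a braiding on `E` (`braidedOfTens`), and `pair` identifies
the tensor product of the bicategory with that of `E` (`pair_tensMul`). All data can therefore be
moved into a braided monoidal category.

There `β` becomes a family of cells `(X(YZ))B ≅ B(Y(XZ))`. Since `(X,Y,Z)` is the product
`(1,Y,1)(X,1,1)(1,1,Z)`, the common value `t` determines all cells: pass `B` by `t`, then braid `X`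
past `Y` (`Cells.IsGeneratedBy.eq_stdCell`). The cells at `(1,1,X)` make `t` a half-braiding.
Multiplying `(X,1,1)` and `(1,Y,1)` in the other order produces a double braiding, which `B` must
absorb; conversely absorption makes the cells respect composition (`stdCell_comp_iff`). This is the
first half of compatibility.

Naturality of `γ` compares two ways of moving objects past three copies of `B`. In `1 ⊗ β` the outer
object passes `B` by the braiding, in `β` by `t`. Evaluation at `(X,1,1,1)` forces `t` and the
braiding to agree after tensoring with `B ⊗ B` (`Cells.HexNatural.agreesWithBraiding`). If they
agree, both paths are the braiding with the cube of `B` followed by the same permutation, and every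
endomorphism is natural (`AgreesWithBraiding.hexNatural`). This is the second half.

In the permutohedron the squares become `t_{B,B}` or its inverse. Substituting `γ = Z ≫ t₁t₂t₁` and
moving all transpositions to the right leaves the two sides of the tetrahedron equation, followed by
the same permutation (`permutohedron_iff_tetrahedron`). Cells and `γ` are thus determined by, and
constructible from, `(B, t, Z)`. If `s` is symmetric and `t = s`, every condition except the
tetrahedron equation is automatic, which gives the second part. -/

open MonoidalCategory

/-! ### Constraints of the tensor product and of the unit identifications, read in `E`. -/

section Constraints

variable {E : Type u} [Category.{v} E] [MonoidalCategory E]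

section Tens

variable (T : TensorProduct (MonoidalSingleObj E))

/-- The tensor product of morphisms of `E`. -/
def tensHom {X X' Y Y' : E} (f : X ⟶ X') (g : Y ⟶ Y') : tens T X Y ⟶ tens T X' Y' :=
  T.map₂ (a := (.star E, .star E)) (b := (.star E, .star E)) (f := (X, Y)) (g := (X', Y')) (f, g)

/-- The composition constraint of a tensor product. -/
def tensMul (X Y X' Y' : E) : tens T X Y ⊗ tens T X' Y' ≅ tens T (X ⊗ X') (Y ⊗ Y') :=
  (T.mapComp (a := (.star E, .star E)) (b := (.star E, .star E)) (c := (.star E, .star E))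
    (X, Y) (X', Y')).symm

/-- The unit constraint of a tensor product. -/
def tensUnit : tens T (𝟙_ E) (𝟙_ E) ≅ 𝟙_ E :=
  T.mapId (.star E, .star E)

@[simp]
lemma tensHom_id (X Y : E) : tensHom T (𝟙 X) (𝟙 Y) = 𝟙 _ :=
  T.map₂_id (a := (.star E, .star E)) (b := (.star E, .star E)) (X, Y)

lemma tensHom_comp {X X' X'' Y Y' Y'' : E} (f : X ⟶ X') (f' : X' ⟶ X'') (g : Y ⟶ Y')
    (g' : Y' ⟶ Y'') : tensHom T f g ≫ tensHom T f' g' = tensHom T (f ≫ f') (g ≫ g') :=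
  (T.map₂_comp (a := (.star E, .star E)) (b := (.star E, .star E))
    (f := (X, Y)) (g := (X', Y')) (h := (X'', Y'')) (f, g) (f', g')).symm

lemma tensHom_comp_assoc {X X' X'' Y Y' Y'' W : E} (f : X ⟶ X') (f' : X' ⟶ X'') (g : Y ⟶ Y')
    (g' : Y' ⟶ Y'') (k : tens T X'' Y'' ⟶ W) :
    tensHom T f g ≫ tensHom T f' g' ≫ k = tensHom T (f ≫ f') (g ≫ g') ≫ k := by
  rw [← Category.assoc, tensHom_comp]

@[simp]
lemma tensIso_hom {X X' Y Y' : E} (e : X ≅ X') (e' : Y ≅ Y') :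
    (tensIso (T := T) e e').hom = tensHom T e.hom e'.hom := rfl

@[simp]
lemma tensIso_inv {X X' Y Y' : E} (e : X ≅ X') (e' : Y ≅ Y') :
    (tensIso (T := T) e e').inv = tensHom T e.inv e'.inv := rfl

lemma tensMul_whiskerLeft {X Y X' Y' X'' Y'' : E} (f : X' ⟶ X'') (g : Y' ⟶ Y'') :
    tens T X Y ◁ tensHom T f g ≫ (tensMul T X Y X'' Y'').hom =
      (tensMul T X Y X' Y').hom ≫ tensHom T (X ◁ f) (Y ◁ g) := by
  have h := T.map₂_whisker_left (a := (.star E, .star E)) (b := (.star E, .star E))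
    (c := (.star E, .star E)) (X, Y) (g := (X', Y')) (h := (X'', Y'')) (f, g)
  -- In the one-object bicategory composition of 1-morphisms is `⊗` by definition, so the
  -- bicategorical law `h` is already an equation in `E`; restating it makes the monoidal simp
  -- lemmas applicable. The same device is used for the other laws.
  have h' : tensHom T (X ◁ f) (Y ◁ g) = (tensMul T X Y X' Y').inv ≫
    tens T X Y ◁ tensHom T f g ≫ (tensMul T X Y X'' Y'').hom := h
  simp [h']

lemma tensMul_whiskerRight {X Y X' Y' X'' Y'' : E} (f : X' ⟶ X'') (g : Y' ⟶ Y'') :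
    tensHom T f g ▷ tens T X Y ≫ (tensMul T X'' Y'' X Y).hom =
      (tensMul T X' Y' X Y).hom ≫ tensHom T (f ▷ X) (g ▷ Y) := by
  have h := T.map₂_whisker_right (a := (.star E, .star E)) (b := (.star E, .star E))
    (c := (.star E, .star E)) (f := (X', Y')) (g := (X'', Y'')) (f, g) (X, Y)
  have h' : tensHom T (f ▷ X) (g ▷ Y) = (tensMul T X' Y' X Y).inv ≫
    tensHom T f g ▷ tens T X Y ≫ (tensMul T X'' Y'' X Y).hom := h
  simp [h']

lemma tensMul_assoc (X Y X' Y' X'' Y'' : E) :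
    tens T X Y ◁ (tensMul T X' Y' X'' Y'').hom ≫ (tensMul T X Y (X' ⊗ X'') (Y' ⊗ Y'')).hom =
      (α_ _ _ _).inv ≫ (tensMul T X Y X' Y').hom ▷ tens T X'' Y'' ≫
        (tensMul T (X ⊗ X') (Y ⊗ Y') X'' Y'').hom ≫ tensHom T (α_ _ _ _).hom (α_ _ _ _).hom := by
  have h := T.map₂_associator (a := (.star E, .star E)) (b := (.star E, .star E))
    (c := (.star E, .star E)) (d := (.star E, .star E)) (X, Y) (X', Y') (X'', Y'')
  have h' : tensHom T (α_ X X' X'').hom (α_ Y Y' Y'').hom =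
    (tensMul T (X ⊗ X') (Y ⊗ Y') X'' Y'').inv ≫ (tensMul T X Y X' Y').inv ▷ tens T X'' Y'' ≫
      (α_ _ _ _).hom ≫ tens T X Y ◁ (tensMul T X' Y' X'' Y'').hom ≫
        (tensMul T X Y (X' ⊗ X'') (Y' ⊗ Y'')).hom := h
  simp [h']

/-- Associativity of the composition constraint, combined with morphisms between the arguments. -/
lemma tensMul_assoc_comp {X₁ Y₁ X₂ Y₂ X₃ Y₃ X Y X' Y' X'' Y'' : E}
    (f : X₂ ⊗ X₃ ⟶ X) (g : Y₂ ⊗ Y₃ ⟶ Y) (p : X₁ ⊗ X ⟶ X'') (q : Y₁ ⊗ Y ⟶ Y'')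
    (f' : X₁ ⊗ X₂ ⟶ X') (g' : Y₁ ⊗ Y₂ ⟶ Y') (p' : X' ⊗ X₃ ⟶ X'') (q' : Y' ⊗ Y₃ ⟶ Y'')
    (hX : (α_ _ _ _).hom ≫ X₁ ◁ f ≫ p = f' ▷ X₃ ≫ p')
    (hY : (α_ _ _ _).hom ≫ Y₁ ◁ g ≫ q = g' ▷ Y₃ ≫ q') :
    tens T X₁ Y₁ ◁ ((tensMul T X₂ Y₂ X₃ Y₃).hom ≫ tensHom T f g) ≫
        (tensMul T X₁ Y₁ X Y).hom ≫ tensHom T p q =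
      (α_ _ _ _).inv ≫ ((tensMul T X₁ Y₁ X₂ Y₂).hom ≫ tensHom T f' g') ▷ tens T X₃ Y₃ ≫
        (tensMul T X' Y' X₃ Y₃).hom ≫ tensHom T p' q' := by
  have h1 := tensMul_whiskerLeft T (X := X₁) (Y := Y₁) f g
  have h2 := tensMul_whiskerRight T (X := X₃) (Y := Y₃) f' g'
  rw [MonoidalCategory.whiskerLeft_comp, Category.assoc, reassoc_of% h1, tensHom_comp,
    reassoc_of% (tensMul_assoc T), tensHom_comp, hX, hY, comp_whiskerRight, Category.assoc,
    reassoc_of% h2, tensHom_comp]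

lemma tensMul_unit_left (X Y : E) :
    (tensUnit T).inv ▷ tens T X Y ≫ (tensMul T (𝟙_ E) (𝟙_ E) X Y).hom ≫
      tensHom T (λ_ X).hom (λ_ Y).hom = (λ_ _).hom := by
  have h := T.map₂_left_unitor (a := (.star E, .star E)) (b := (.star E, .star E)) (X, Y)
  have h' : tensHom T (λ_ X).hom (λ_ Y).hom = (tensMul T (𝟙_ E) (𝟙_ E) X Y).inv ≫
    (tensUnit T).hom ▷ tens T X Y ≫ (λ_ _).hom := h
  simp [h']

lemma tensMul_unit_right (X Y : E) :
    tens T X Y ◁ (tensUnit T).inv ≫ (tensMul T X Y (𝟙_ E) (𝟙_ E)).hom ≫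
      tensHom T (ρ_ X).hom (ρ_ Y).hom = (ρ_ _).hom := by
  have h := T.map₂_right_unitor (a := (.star E, .star E)) (b := (.star E, .star E)) (X, Y)
  have h' : tensHom T (ρ_ X).hom (ρ_ Y).hom = (tensMul T X Y (𝟙_ E) (𝟙_ E)).inv ≫
    tens T X Y ◁ (tensUnit T).hom ≫ (ρ_ _).hom := h
  simp [h']

end Tens

section Unit

variable {T : TensorProduct (MonoidalSingleObj E)} (u : UnitIdent T)

lemma lIso_naturality {X Y : E} (f : X ⟶ Y) :
    tensHom T (𝟙 _) f ≫ (u.lIso Y).hom = (u.lIso X).hom ≫ f :=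
  u.left.naturality f

lemma rIso_naturality {X Y : E} (f : X ⟶ Y) :
    tensHom T f (𝟙 _) ≫ (u.rIso Y).hom = (u.rIso X).hom ≫ f :=
  u.right.naturality f

lemma lIso_unit : u.lIso (𝟙_ E) = tensUnit T := by
  ext
  have h : (u.lIso (𝟙_ E)).hom = tensHom T (𝟙 _) (𝟙 _) ≫ (tensUnit T).hom := u.left.map_unit
  simpa using h

lemma rIso_unit : u.rIso (𝟙_ E) = tensUnit T := by
  ext
  have h : (u.rIso (𝟙_ E)).hom = tensHom T (𝟙 _) (𝟙 _) ≫ (tensUnit T).hom := u.right.map_unit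
  simpa using h

lemma lIso_tensor (X Y : E) :
    (tensMul T (𝟙_ E) X (𝟙_ E) Y).hom ≫ tensHom T (λ_ _).hom (𝟙 _) ≫ (u.lIso (X ⊗ Y)).hom =
      ((u.lIso X).hom ⊗ₘ (u.lIso Y).hom) := by
  have h : (u.lIso (X ⊗ Y)).hom = (tensHom T (ρ_ _).inv (𝟙 _) ≫ (tensMul T (𝟙_ E) X (𝟙_ E) Y).inv) ≫
    ((u.lIso X).hom ⊗ₘ (u.lIso Y).hom) := u.left.map_tensor X Y
  -- The constraint of `1 ⊗ -` involves `ρ_ 1`, the statement `λ_ 1`; the two coincide.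
  rw [h, Category.assoc, tensHom_comp_assoc, unitors_equal]
  simp

lemma rIso_tensor (X Y : E) :
    (tensMul T X (𝟙_ E) Y (𝟙_ E)).hom ≫ tensHom T (𝟙 _) (λ_ _).hom ≫ (u.rIso (X ⊗ Y)).hom =
      ((u.rIso X).hom ⊗ₘ (u.rIso Y).hom) := by
  have h : (u.rIso (X ⊗ Y)).hom = (tensHom T (𝟙 _) (λ_ _).inv ≫ (tensMul T X (𝟙_ E) Y (𝟙_ E)).inv) ≫
    ((u.rIso X).hom ⊗ₘ (u.rIso Y).hom) := u.right.map_tensor X Y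
  rw [h, Category.assoc, tensHom_comp_assoc]
  simp

end Unit

end Constraints

/-! ### The two decompositions of `(X, Y)` into `(X, 1)` and `(1, Y)`. -/

section InterchangePairs

variable {E : Type u} [Category.{v} E] [MonoidalCategory E]

section Pair

variable {T : TensorProduct (MonoidalSingleObj E)} (u : UnitIdent T)

/-- The isomorphism `X ⊗ Y ≅ tens T X Y` that decomposes `(X, Y)` as `(X, 1)` followed by
`(1, Y)`. -/
def pair (X Y : E) : X ⊗ Y ≅ tens T X Y :=
  ((u.rIso X).symm ⊗ᵢ (u.lIso Y).symm) ≪≫ tensMul T X (𝟙_ E) (𝟙_ E) Y ≪≫ tensIso (ρ_ X) (λ_ Y)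

/-- The isomorphism `Y ⊗ X ≅ tens T X Y` that decomposes `(X, Y)` as `(1, Y)` followed by
`(X, 1)`. -/
def pairSwap (X Y : E) : Y ⊗ X ≅ tens T X Y :=
  ((u.lIso Y).symm ⊗ᵢ (u.rIso X).symm) ≪≫ tensMul T (𝟙_ E) Y X (𝟙_ E) ≪≫ tensIso (λ_ X) (ρ_ Y)

lemma pair_hom (X Y : E) : (pair u X Y).hom = ((u.rIso X).inv ⊗ₘ (u.lIso Y).inv) ≫
    (tensMul T X (𝟙_ E) (𝟙_ E) Y).hom ≫ tensHom T (ρ_ X).hom (λ_ Y).hom := rfl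

lemma pairSwap_hom (X Y : E) : (pairSwap u X Y).hom = ((u.lIso Y).inv ⊗ₘ (u.rIso X).inv) ≫
    (tensMul T (𝟙_ E) Y X (𝟙_ E)).hom ≫ tensHom T (λ_ X).hom (ρ_ Y).hom := rfl

/-- Both composites of `(X, 1)` and `(1, Y)` are isomorphic to `(X, Y)`, and the interchange passes
from one to the other through it. All properties of the interchange are derived from this
description. -/
lemma swapIso_hom_pair (X Y : E) :
    (swapIso u X Y).hom ≫ (pair u X Y).hom = (pairSwap u X Y).hom := by
  have h : (swapIso u X Y).hom = ((u.lIso Y).inv ⊗ₘ (u.rIso X).inv) ≫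
      (((tensMul T (𝟙_ E) Y X (𝟙_ E)).hom ≫
        tensHom T ((λ_ X).hom ≫ (ρ_ X).inv) ((ρ_ Y).hom ≫ (λ_ Y).inv)) ≫
          (tensMul T X (𝟙_ E) (𝟙_ E) Y).inv) ≫
        ((u.rIso X).hom ⊗ₘ (u.lIso Y).hom) := by
    rfl
  rw [h]
  simp [pair_hom, pairSwap_hom, tensHom_comp]

lemma tensMul_naturality {X₁ Y₁ X₂ Y₂ X₁' Y₁' X₂' Y₂' : E} (f₁ : X₁ ⟶ X₁') (g₁ : Y₁ ⟶ Y₁')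
    (f₂ : X₂ ⟶ X₂') (g₂ : Y₂ ⟶ Y₂') :
    (tensHom T f₁ g₁ ⊗ₘ tensHom T f₂ g₂) ≫ (tensMul T X₁' Y₁' X₂' Y₂').hom =
      (tensMul T X₁ Y₁ X₂ Y₂).hom ≫ tensHom T (f₁ ⊗ₘ f₂) (g₁ ⊗ₘ g₂) := by
  have h1 := tensMul_whiskerLeft T (X := X₁') (Y := Y₁') f₂ g₂
  have h2 := tensMul_whiskerRight T (X := X₂) (Y := Y₂) f₁ g₁
  rw [MonoidalCategory.tensorHom_def, Category.assoc, h1, reassoc_of% h2, tensHom_comp,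
    ← MonoidalCategory.tensorHom_def, ← MonoidalCategory.tensorHom_def]

lemma lIso_inv_naturality {X Y : E} (f : X ⟶ Y) :
    f ≫ (u.lIso Y).inv = (u.lIso X).inv ≫ tensHom T (𝟙 _) f := by
  rw [Iso.comp_inv_eq, Category.assoc, lIso_naturality, Iso.inv_hom_id_assoc]

lemma rIso_inv_naturality {X Y : E} (f : X ⟶ Y) :
    f ≫ (u.rIso Y).inv = (u.rIso X).inv ≫ tensHom T f (𝟙 _) := by
  rw [Iso.comp_inv_eq, Category.assoc, rIso_naturality, Iso.inv_hom_id_assoc]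

lemma pair_naturality {X X' Y Y' : E} (f : X ⟶ X') (g : Y ⟶ Y') :
    (f ⊗ₘ g) ≫ (pair u X' Y').hom = (pair u X Y).hom ≫ tensHom T f g := by
  rw [pair_hom, tensorHom_comp_tensorHom_assoc, rIso_inv_naturality, lIso_inv_naturality,
    ← tensorHom_comp_tensorHom_assoc, reassoc_of% (tensMul_naturality (T := T))]
  simp [pair_hom, tensHom_comp]

lemma pairSwap_naturality {X X' Y Y' : E} (f : X ⟶ X') (g : Y ⟶ Y') :
    (g ⊗ₘ f) ≫ (pairSwap u X' Y').hom = (pairSwap u X Y).hom ≫ tensHom T f g := by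
  rw [pairSwap_hom, tensorHom_comp_tensorHom_assoc, rIso_inv_naturality, lIso_inv_naturality,
    ← tensorHom_comp_tensorHom_assoc, reassoc_of% (tensMul_naturality (T := T))]
  simp [pairSwap_hom, tensHom_comp]

/-- The action of `(X, 1)` on `tens T X' Y` from the left. -/
def leftAct₁ (X X' Y : E) : X ⊗ tens T X' Y ⟶ tens T (X ⊗ X') Y :=
  ((u.rIso X).inv ⊗ₘ 𝟙 _) ≫ (tensMul T X (𝟙_ E) X' Y).hom ≫ tensHom T (𝟙 _) (λ_ Y).hom

/-- The action of `(1, Y)` on `tens T X Y'` from the left. -/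
def leftAct₂ (X Y Y' : E) : Y ⊗ tens T X Y' ⟶ tens T X (Y ⊗ Y') :=
  ((u.lIso Y).inv ⊗ₘ 𝟙 _) ≫ (tensMul T (𝟙_ E) Y X Y').hom ≫ tensHom T (λ_ X).hom (𝟙 _)

/-- The action of `(X', 1)` on `tens T X Y` from the right. -/
def rightAct₁ (X X' Y : E) : tens T X Y ⊗ X' ⟶ tens T (X ⊗ X') Y :=
  (𝟙 _ ⊗ₘ (u.rIso X').inv) ≫ (tensMul T X Y X' (𝟙_ E)).hom ≫ tensHom T (𝟙 _) (ρ_ Y).hom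

/-- The action of `(1, Y')` on `tens T X Y` from the right. -/
def rightAct₂ (X Y Y' : E) : tens T X Y ⊗ Y' ⟶ tens T X (Y ⊗ Y') :=
  (𝟙 _ ⊗ₘ (u.lIso Y').inv) ≫ (tensMul T X Y (𝟙_ E) Y').hom ≫ tensHom T (ρ_ X).hom (𝟙 _)

lemma rIso_inv_tensor (X X' : E) : (u.rIso (X ⊗ X')).inv = ((u.rIso X).inv ⊗ₘ (u.rIso X').inv) ≫
    (tensMul T X (𝟙_ E) X' (𝟙_ E)).hom ≫ tensHom T (𝟙 _) (λ_ _).hom := by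
  rw [← cancel_mono (u.rIso (X ⊗ X')).hom]
  simp [rIso_tensor]

lemma lIso_inv_tensor (X X' : E) : (u.lIso (X ⊗ X')).inv = ((u.lIso X).inv ⊗ₘ (u.lIso X').inv) ≫
    (tensMul T (𝟙_ E) X (𝟙_ E) X').hom ≫ tensHom T (λ_ _).hom (𝟙 _) := by
  rw [← cancel_mono (u.lIso (X ⊗ X')).hom]
  simp [lIso_tensor]

/-- Associativity of the composition constraint, with isomorphisms on the three outer factors. -/
lemma tensMul_assoc_comp' {X₁ Y₁ X₂ Y₂ X₃ Y₃ X Y X' Y' X'' Y'' P Q R : E}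
    (a : P ⟶ tens T X₁ Y₁) (b : Q ⟶ tens T X₂ Y₂) (c : R ⟶ tens T X₃ Y₃)
    (f : X₂ ⊗ X₃ ⟶ X) (g : Y₂ ⊗ Y₃ ⟶ Y) (p : X₁ ⊗ X ⟶ X'') (q : Y₁ ⊗ Y ⟶ Y'')
    (f' : X₁ ⊗ X₂ ⟶ X') (g' : Y₁ ⊗ Y₂ ⟶ Y') (p' : X' ⊗ X₃ ⟶ X'') (q' : Y' ⊗ Y₃ ⟶ Y'')
    (hX : (α_ _ _ _).hom ≫ X₁ ◁ f ≫ p = f' ▷ X₃ ≫ p')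
    (hY : (α_ _ _ _).hom ≫ Y₁ ◁ g ≫ q = g' ▷ Y₃ ≫ q') :
    (a ⊗ₘ ((b ⊗ₘ c) ≫ (tensMul T X₂ Y₂ X₃ Y₃).hom ≫ tensHom T f g)) ≫
        (tensMul T X₁ Y₁ X Y).hom ≫ tensHom T p q =
      (α_ _ _ _).inv ≫ (((a ⊗ₘ b) ≫ (tensMul T X₁ Y₁ X₂ Y₂).hom ≫ tensHom T f' g') ⊗ₘ c) ≫
        (tensMul T X' Y' X₃ Y₃).hom ≫ tensHom T p' q' := by
  have h := tensMul_assoc_comp T f g p q f' g' p' q' hX hY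
  have h1 : (a ⊗ₘ ((b ⊗ₘ c) ≫ (tensMul T X₂ Y₂ X₃ Y₃).hom ≫ tensHom T f g)) =
    (a ⊗ₘ (b ⊗ₘ c)) ≫ (tens T X₁ Y₁ ◁ ((tensMul T X₂ Y₂ X₃ Y₃).hom ≫ tensHom T f g)) := by
    rw [← id_tensorHom, tensorHom_comp_tensorHom, Category.comp_id]
  have h2 : (((a ⊗ₘ b) ≫ (tensMul T X₁ Y₁ X₂ Y₂).hom ≫ tensHom T f' g') ⊗ₘ c) =
    ((a ⊗ₘ b) ⊗ₘ c) ≫ (((tensMul T X₁ Y₁ X₂ Y₂).hom ≫ tensHom T f' g') ▷ tens T X₃ Y₃) := by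
    rw [← tensorHom_id, tensorHom_comp_tensorHom, Category.comp_id]
  rw [h1, Category.assoc, h, h2, Category.assoc, associator_inv_naturality_assoc]

section

variable (X X' Y Y' : E)

/-- This and the next lemmas are associativity of the composition constraint for three factors of
the form `(X, 1)` or `(1, Y)`; the `monoidal` goals are coherence in the two slots. Together they
allow a factor to be moved past a product one piece at a time, which is the content of the hexagon
axioms. -/
lemma whiskerLeft_pair_leftAct₁ :
    X ◁ (pair u X' Y).hom ≫ leftAct₁ u X X' Y =
      (α_ _ _ _).inv ≫ (pair u (X ⊗ X') Y).hom := by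
  have h := tensMul_assoc_comp' (u.rIso X).inv (u.rIso X').inv (u.lIso Y).inv (ρ_ X').hom (λ_ Y).hom (𝟙 _) (λ_ Y).hom
    (𝟙 _) (λ_ _).hom (ρ_ (X ⊗ X')).hom (λ_ Y).hom (by monoidal) (by monoidal)
  simpa [leftAct₁, pair_hom, rIso_inv_tensor, ← id_tensorHom, ← tensorHom_id] using h

lemma whiskerLeft_pairSwap_leftAct₁ :
    X ◁ (pairSwap u X' Y).hom ≫ leftAct₁ u X X' Y =
      (α_ _ _ _).inv ≫ (pair u X Y).hom ▷ X' ≫ rightAct₁ u X X' Y := by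
  have h := tensMul_assoc_comp' (u.rIso X).inv (u.lIso Y).inv (u.rIso X').inv (λ_ X').hom (ρ_ Y).hom (𝟙 _) (λ_ Y).hom
    (ρ_ X).hom (λ_ Y).hom (𝟙 _) (ρ_ Y).hom (by monoidal) (by monoidal)
  simpa [leftAct₁, rightAct₁, pair_hom, pairSwap_hom, ← id_tensorHom, ← tensorHom_id] using h

lemma whiskerRight_pairSwap_rightAct₁ :
    (α_ _ _ _).inv ≫ (pairSwap u X Y).hom ▷ X' ≫ rightAct₁ u X X' Y =
      (pairSwap u (X ⊗ X') Y).hom := by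
  have h := tensMul_assoc_comp' (u.lIso Y).inv (u.rIso X).inv (u.rIso X').inv (𝟙 _) (λ_ _).hom (λ_ _).hom (ρ_ Y).hom
    (λ_ X).hom (ρ_ Y).hom (𝟙 _) (ρ_ Y).hom (by monoidal) (by monoidal)
  simpa [rightAct₁, pairSwap_hom, rIso_inv_tensor, ← id_tensorHom, ← tensorHom_id] using h.symm

lemma whiskerRight_pair_rightAct₂ :
    (α_ _ _ _).inv ≫ (pair u X Y).hom ▷ Y' ≫ rightAct₂ u X Y Y' =
      (pair u X (Y ⊗ Y')).hom := by
  have h := tensMul_assoc_comp' (u.rIso X).inv (u.lIso Y).inv (u.lIso Y').inv (λ_ _).hom (𝟙 _) (ρ_ X).hom (λ_ _).hom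
    (ρ_ X).hom (λ_ Y).hom (ρ_ X).hom (𝟙 _) (by monoidal) (by monoidal)
  simpa [rightAct₂, pair_hom, lIso_inv_tensor, ← id_tensorHom, ← tensorHom_id] using h.symm

lemma whiskerLeft_pair_leftAct₂ :
    Y ◁ (pair u X Y').hom ≫ leftAct₂ u X Y Y' =
      (α_ _ _ _).inv ≫ (pairSwap u X Y).hom ▷ Y' ≫ rightAct₂ u X Y Y' := by
  have h := tensMul_assoc_comp' (u.lIso Y).inv (u.rIso X).inv (u.lIso Y').inv (ρ_ X).hom (λ_ Y').hom (λ_ X).hom (𝟙 _)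
    (λ_ X).hom (ρ_ Y).hom (ρ_ X).hom (𝟙 _) (by monoidal) (by monoidal)
  simpa [leftAct₂, rightAct₂, pair_hom, pairSwap_hom, ← id_tensorHom, ← tensorHom_id] using h

lemma whiskerLeft_pairSwap_leftAct₂ :
    Y ◁ (pairSwap u X Y').hom ≫ leftAct₂ u X Y Y' =
      (α_ _ _ _).inv ≫ (pairSwap u X (Y ⊗ Y')).hom := by
  have h := tensMul_assoc_comp' (u.lIso Y).inv (u.lIso Y').inv (u.rIso X).inv (λ_ X).hom (ρ_ Y').hom (λ_ X).hom (𝟙 _)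
    (λ_ _).hom (𝟙 _) (λ_ X).hom (ρ_ _).hom (by monoidal) (by monoidal)
  simpa [leftAct₂, pairSwap_hom, lIso_inv_tensor, ← id_tensorHom, ← tensorHom_id] using h

/-- Since `(X, Y)` is `(X, 1)` times `(1, Y)`, multiplication by it splits into the action of `Y`
followed by that of `X`. -/
lemma whiskerRight_pair_tensMul :
    (α_ _ _ _).inv ≫ (pair u X Y).hom ▷ tens T X' Y' ≫ (tensMul T X Y X' Y').hom =
      X ◁ leftAct₂ u X' Y Y' ≫ leftAct₁ u X X' (Y ⊗ Y') := by
  have h := tensMul_assoc_comp' (u.rIso X).inv (u.lIso Y).inv (𝟙 (tens T X' Y')) (λ_ X').hom (𝟙 _) (𝟙 _) (λ_ _).hom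
    (ρ_ X).hom (λ_ Y).hom (𝟙 _) (𝟙 _) (by monoidal) (by monoidal)
  simpa [leftAct₁, leftAct₂, pair_hom, ← id_tensorHom, ← tensorHom_id] using h.symm

end

end Pair

end InterchangePairs

/-! ### The inverse interchange as a braiding on `E`. -/

section InterchangeBraiding

variable {E : Type u} [Category.{v} E] [MonoidalCategory E]

section Braiding

variable {T : TensorProduct (MonoidalSingleObj E)} (u : UnitIdent T)

lemma swapIso_inv_pairSwap (X Y : E) :
    (swapIso u X Y).inv ≫ (pairSwap u X Y).hom = (pair u X Y).hom := by
  rw [Iso.inv_comp_eq, swapIso_hom_pair]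

lemma swapIso_inv_naturality {X X' Y Y' : E} (f : X ⟶ X') (g : Y ⟶ Y') :
    (f ⊗ₘ g) ≫ (swapIso u X' Y').inv = (swapIso u X Y).inv ≫ (g ⊗ₘ f) := by
  rw [← cancel_mono (pairSwap u X' Y').hom, Category.assoc, Category.assoc, swapIso_inv_pairSwap,
    pair_naturality, pairSwap_naturality, reassoc_of% (swapIso_inv_pairSwap u X Y)]

/-- After composition with `pairSwap`, moving `X'` and then `X` past `Y` turns into moving `X ⊗ X'`
at once. This is one hexagon axiom; the next lemma is the other. -/
lemma swapIso_inv_tensor_left (X X' Y : E) :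
    (swapIso u (X ⊗ X') Y).inv = (α_ X X' Y).hom ≫ X ◁ (swapIso u X' Y).inv ≫
      (α_ _ _ _).inv ≫ (swapIso u X Y).inv ▷ X' ≫ (α_ _ _ _).hom := by
  rw [← cancel_mono (pairSwap u (X ⊗ X') Y).hom, swapIso_inv_pairSwap,
    ← whiskerRight_pairSwap_rightAct₁]
  simp only [Category.assoc, Iso.hom_inv_id_assoc]
  rw [← comp_whiskerRight_assoc, swapIso_inv_pairSwap, ← whiskerLeft_pairSwap_leftAct₁,
    ← MonoidalCategory.whiskerLeft_comp_assoc, swapIso_inv_pairSwap, whiskerLeft_pair_leftAct₁,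
    Iso.hom_inv_id_assoc]

lemma swapIso_inv_tensor_right (X Y Y' : E) :
    (swapIso u X (Y ⊗ Y')).inv = (α_ X Y Y').inv ≫ (swapIso u X Y).inv ▷ Y' ≫
      (α_ _ _ _).hom ≫ Y ◁ (swapIso u X Y').inv ≫ (α_ _ _ _).inv := by
  rw [← cancel_mono (pairSwap u X (Y ⊗ Y')).hom, swapIso_inv_pairSwap]
  simp only [Category.assoc]
  rw [← whiskerLeft_pairSwap_leftAct₂, ← MonoidalCategory.whiskerLeft_comp_assoc,
    swapIso_inv_pairSwap, whiskerLeft_pair_leftAct₂, Iso.hom_inv_id_assoc, ← comp_whiskerRight_assoc,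
    swapIso_inv_pairSwap, whiskerRight_pair_rightAct₂]

/-- The braiding of `E` given by the inverse interchange cells of a tensor product on the one-object
bicategory of `E`. -/
@[reducible]
def braidedOfTens : BraidedCategory E where
  braiding X Y := (swapIso u X Y).symm
  braiding_naturality_right X Y Z f := by
    simpa using swapIso_inv_naturality u (𝟙 X) f
  braiding_naturality_left f Z := by
    simpa using swapIso_inv_naturality u f (𝟙 Z)
  hexagon_forward X Y Z := by
    simp [swapIso_inv_tensor_right]
  hexagon_reverse X Y Z := by
    simp [swapIso_inv_tensor_left]

variable [BraidedCategory E]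

/-- The tensor product of the bicategory is thereby isomorphic, as a monoidal functor, to the tensor
product of the braided category `E`: only the inner factors `Y` and `X'` have to be exchanged. -/
lemma pair_tensMul (hu : ∀ X Y : E, β_ X Y = (swapIso u X Y).symm) (X Y X' Y' : E) :
    ((pair u X Y).hom ⊗ₘ (pair u X' Y').hom) ≫ (tensMul T X Y X' Y').hom =
      tensorδ X X' Y Y' ≫ (pair u (X ⊗ X') (Y ⊗ Y')).hom := by
  have hs : (β_ X' Y).inv ≫ (pair u X' Y).hom = (pairSwap u X' Y).hom := by
    rw [hu]
    exact swapIso_hom_pair u X' Y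
  have h := whiskerRight_pair_tensMul u X X' Y Y'
  rw [Iso.inv_comp_eq] at h
  rw [tensorHom_def', Category.assoc, h, associator_naturality_right_assoc,
    ← MonoidalCategory.whiskerLeft_comp_assoc, whiskerLeft_pair_leftAct₂, ← hs]
  have h' := whiskerRight_pair_rightAct₂ u X' Y Y'
  rw [Iso.inv_comp_eq] at h'
  simp only [comp_whiskerRight, Category.assoc]
  rw [h']
  simp only [MonoidalCategory.whiskerLeft_comp, Category.assoc, whiskerLeft_pair_leftAct₁]
  simp [tensorδ]

end Braiding

end InterchangeBraiding

/-! ### Morphisms absorbed by `B`, and the standard cells of a half-braiding. -/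

section Absorption

variable {E : Type u} [Category.{v} E] [MonoidalCategory E]

section Absorb

variable {B : E}

/-- Naturality of the half-braiding carries `B` across a morphism. An equation that holds in the
presence of `B` therefore holds wherever `B` stands in a tensor product. -/
lemma whiskerLeft_eq_of_whiskerRight_eq (t : HalfBraiding B) {X Y : E} {f g : X ⟶ Y} (h : f ▷ B = g ▷ B) :
    B ◁ f = B ◁ g := by
  rw [← cancel_mono (t.β Y).hom, t.naturality, t.naturality, h]

lemma whiskerRight_eq_of_whiskerLeft_eq (t : HalfBraiding B) {X Y : E} {f g : X ⟶ Y} (h : B ◁ f = B ◁ g) :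
    f ▷ B = g ▷ B := by
  rw [← cancel_epi (t.β X).hom, ← t.naturality, ← t.naturality, h]

lemma whiskerLeft_whiskerLeft_eq_of_eq (t : HalfBraiding B) (X : E) {Y Y' : E} {f g : Y ⟶ Y'}
    (h : B ◁ f = B ◁ g) : B ◁ X ◁ f = B ◁ X ◁ g := by
  apply whiskerLeft_eq_of_whiskerRight_eq t
  rw [whisker_assoc, whisker_assoc, whiskerRight_eq_of_whiskerLeft_eq t h]

lemma whiskerLeft_whiskerRight_eq_of_eq (X : E) {Y Y' : E} {f g : Y ⟶ Y'}
    (h : B ◁ f = B ◁ g) : B ◁ f ▷ X = B ◁ g ▷ X := by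
  rw [← cancel_epi (α_ _ _ _).hom]
  rw [← associator_naturality_middle, ← associator_naturality_middle, h]

lemma HalfBraiding_inv_naturality (t : HalfBraiding B) {X Y : E} (f : X ⟶ Y) :
    f ▷ B ≫ (t.β Y).inv = (t.β X).inv ≫ B ◁ f := by
  rw [Iso.comp_inv_eq, Category.assoc, t.naturality, Iso.inv_hom_id_assoc]

lemma HalfBraiding_inv_tensor (t : HalfBraiding B) (X Y : E) : (t.β (X ⊗ Y)).inv =
    (α_ _ _ _).hom ≫ X ◁ (t.β Y).inv ≫ (α_ _ _ _).inv ≫ (t.β X).inv ▷ Y ≫ (α_ _ _ _).hom := by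
  rw [← cancel_epi (t.β (X ⊗ Y)).hom, Iso.hom_inv_id, t.monoidal]
  simp

lemma whiskerLeft_cancel_iff (B : E) {P U V Q Z : E} (p : P ⟶ U ⊗ Z) (a : U ⟶ V) (d : V ⟶ V)
    (q : V ⊗ Z ⟶ Q) [IsIso p] [IsIso a] [IsIso q] :
    B ◁ (p ≫ (a ≫ d) ▷ Z ≫ q) = B ◁ (p ≫ a ▷ Z ≫ q) ↔ B ◁ d ▷ Z = 𝟙 _ := by
  have h1 : B ◁ (p ≫ (a ≫ d) ▷ Z ≫ q) = B ◁ (p ≫ a ▷ Z) ≫ B ◁ d ▷ Z ≫ B ◁ q := by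
    simp only [comp_whiskerRight, Category.assoc, MonoidalCategory.whiskerLeft_comp]
  have h2 : B ◁ (p ≫ a ▷ Z ≫ q) = B ◁ (p ≫ a ▷ Z) ≫ 𝟙 _ ≫ B ◁ q := by
    simp only [Category.assoc, MonoidalCategory.whiskerLeft_comp, Category.id_comp]
  rw [h1, h2, cancel_epi, cancel_mono]

end Absorb

section Cells

variable [BraidedCategory E]

/-- The permutation of the first two of three factors. -/
def swapFst (X Y Z : E) : X ⊗ (Y ⊗ Z) ≅ Y ⊗ (X ⊗ Z) :=
  (α_ X Y Z).symm ≪≫ whiskerRightIso (β_ X Y) Z ≪≫ α_ Y X Z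

/-- Separate the factors of a threefold tensor product of binary tensor products. -/
def tensorμ₃ (X X' Y Y' Z Z' : E) :
    (X ⊗ X') ⊗ ((Y ⊗ Y') ⊗ (Z ⊗ Z')) ⟶ (X ⊗ (Y ⊗ Z)) ⊗ (X' ⊗ (Y' ⊗ Z')) :=
  (X ⊗ X') ◁ tensorμ Y Y' Z Z' ≫ tensorμ X X' (Y ⊗ Z) (Y' ⊗ Z')

instance (X X' Y Y' Z Z' : E) : IsIso (tensorμ₃ X X' Y Y' Z Z') := by
  have h : ∀ X Y Z W : E, IsIso (tensorμ X Y Z W) := fun X Y Z W =>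
    ⟨tensorδ X Y Z W, by simp, by simp⟩
  unfold tensorμ₃
  infer_instance

lemma tensorμ₃_eq (X X' Y Y' Z Z' : E) : tensorμ₃ X X' Y Y' Z Z' =
    (α_ _ _ _).inv ≫ tensorμ X X' Y Y' ▷ (Z ⊗ Z') ≫ tensorμ (X ⊗ Y) (X' ⊗ Y') Z Z' ≫
      ((α_ X Y Z).hom ⊗ₘ (α_ X' Y' Z').hom) := by
  rw [tensor_associativity, Iso.inv_hom_id_assoc, tensorμ₃]

/-- The double braiding of the two inner factors. -/
def innerTwist (X Y Z W : E) : (X ⊗ Y) ⊗ (Z ⊗ W) ⟶ (X ⊗ Y) ⊗ (Z ⊗ W) :=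
  (α_ _ _ _).hom ≫ X ◁ ((α_ _ _ _).inv ≫ ((β_ Y Z).hom ≫ (β_ Z Y).hom) ▷ W ≫ (α_ _ _ _).hom) ≫
    (α_ _ _ _).inv

/-- On the left `X` and `Y'` cross twice, once in the large braiding and once in `tensorμ`. On the
right they do not cross before the last factor, which supplies exactly this double crossing. -/
lemma braiding_tensorμ (X X' Y Y' : E) :
    (β_ (X ⊗ X') (Y ⊗ Y')).hom ≫ tensorμ Y Y' X X' =
      (tensorμ X X' Y Y' ≫ ((β_ X Y).hom ⊗ₘ (β_ X' Y').hom)) ≫ innerTwist Y X Y' X' := by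
  dsimp only [tensorμ, innerTwist]
  simp only [BraidedCategory.braiding_tensor_left_hom, BraidedCategory.braiding_tensor_right_hom]
  rw [MonoidalCategory.tensorHom_def]
  monoidal

lemma swapFst_tensorμ₃ (X X' Y Y' Z Z' : E) :
    (swapFst (X ⊗ X') (Y ⊗ Y') (Z ⊗ Z')).hom ≫ tensorμ₃ Y Y' X X' Z Z' =
      (α_ _ _ _).inv ≫ ((tensorμ X X' Y Y' ≫ ((β_ X Y).hom ⊗ₘ (β_ X' Y').hom)) ≫
        innerTwist Y X Y' X') ▷ (Z ⊗ Z') ≫ tensorμ (Y ⊗ X) (Y' ⊗ X') Z Z' ≫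
          ((α_ Y X Z).hom ⊗ₘ (α_ Y' X' Z').hom) := by
  rw [tensorμ₃_eq, ← braiding_tensorμ]
  simp [swapFst]

lemma tensorμ₃_swapFst (X X' Y Y' Z Z' : E) :
    tensorμ₃ X X' Y Y' Z Z' ≫ ((swapFst X Y Z).hom ⊗ₘ (swapFst X' Y' Z').hom) =
      (α_ _ _ _).inv ≫ (tensorμ X X' Y Y' ≫ ((β_ X Y).hom ⊗ₘ (β_ X' Y').hom)) ▷ (Z ⊗ Z') ≫
        tensorμ (Y ⊗ X) (Y' ⊗ X') Z Z' ≫ ((α_ Y X Z).hom ⊗ₘ (α_ Y' X' Z').hom) := by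
  have h := tensorμ_natural_left (β_ X Y).hom (β_ X' Y').hom Z Z'
  simp only [tensorμ₃_eq, comp_whiskerRight, Category.assoc]
  rw [reassoc_of% h]
  simp [swapFst]

variable {B : E} (t : HalfBraiding B)

/-- The cells `(X ⊗ (Y ⊗ Z)) ⊗ B ≅ B ⊗ (Y ⊗ (X ⊗ Z))` determined by a half-braiding. -/
def stdCell (X Y Z : E) : (X ⊗ (Y ⊗ Z)) ⊗ B ≅ B ⊗ (Y ⊗ (X ⊗ Z)) :=
  (t.β _).symm ≪≫ whiskerLeftIso B (swapFst X Y Z)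

lemma swapFst_naturality {X X' Y Y' Z Z' : E} (f : X ⟶ X') (g : Y ⟶ Y') (h : Z ⟶ Z') :
    (f ⊗ₘ (g ⊗ₘ h)) ≫ (swapFst X' Y' Z').hom = (swapFst X Y Z).hom ≫ (g ⊗ₘ (f ⊗ₘ h)) := by
  simp only [swapFst, Iso.trans_hom, Iso.symm_hom, whiskerRightIso_hom, Category.assoc]
  rw [associator_inv_naturality_assoc, ← associator_naturality, ← tensorHom_id, ← tensorHom_id,
    tensorHom_comp_tensorHom_assoc, tensorHom_comp_tensorHom_assoc,
    BraidedCategory.braiding_naturality, Category.comp_id, Category.id_comp]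

lemma stdCell_naturality {X X' Y Y' Z Z' : E} (f : X ⟶ X') (g : Y ⟶ Y') (h : Z ⟶ Z') :
    (f ⊗ₘ (g ⊗ₘ h)) ▷ B ≫ (stdCell t X' Y' Z').hom =
      (stdCell t X Y Z).hom ≫ B ◁ (g ⊗ₘ (f ⊗ₘ h)) := by
  simp only [stdCell, Iso.trans_hom, Iso.symm_hom, whiskerLeftIso_hom, Category.assoc]
  rw [reassoc_of% (HalfBraiding_inv_naturality t), ← MonoidalCategory.whiskerLeft_comp,
    ← MonoidalCategory.whiskerLeft_comp, swapFst_naturality]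

/-- The cells determined by a half-braiding preserve composition if and only if the double braiding
of the two arguments which are not in order is absorbed by `B`. -/
lemma stdCell_comp_iff (X X' Y Y' Z Z' : E) :
    (stdCell t (X ⊗ X') (Y ⊗ Y') (Z ⊗ Z')).hom ≫ B ◁ tensorμ₃ Y Y' X X' Z Z' =
      tensorμ₃ X X' Y Y' Z Z' ▷ B ≫ (α_ _ _ _).hom ≫ (X ⊗ (Y ⊗ Z)) ◁ (stdCell t X' Y' Z').hom ≫
        (α_ _ _ _).inv ≫ (stdCell t X Y Z).hom ▷ (Y' ⊗ (X' ⊗ Z')) ≫ (α_ _ _ _).hom ↔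
    B ◁ innerTwist Y X Y' X' ▷ (Z ⊗ Z') = 𝟙 _ := by
  -- Multiplicativity and naturality of `t` collect the two half-braidings into one in front of
  -- everything, so the comparison takes place to the right of `B` and involves only the braiding.
  have h1 : tensorμ₃ X X' Y Y' Z Z' ▷ B ≫ (α_ _ _ _).hom ≫
      (X ⊗ (Y ⊗ Z)) ◁ (stdCell t X' Y' Z').hom ≫
        (α_ _ _ _).inv ≫ (stdCell t X Y Z).hom ▷ (Y' ⊗ (X' ⊗ Z')) ≫ (α_ _ _ _).hom =
      (t.β _).inv ≫ B ◁ (tensorμ₃ X X' Y Y' Z Z' ≫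
        ((swapFst X Y Z).hom ⊗ₘ (swapFst X' Y' Z').hom)) := by
    rw [MonoidalCategory.whiskerLeft_comp, ← reassoc_of% (HalfBraiding_inv_naturality t),
      HalfBraiding_inv_tensor, tensorHom_def']
    simp only [stdCell, Iso.trans_hom, Iso.symm_hom, whiskerLeftIso_hom, Category.assoc,
      MonoidalCategory.whiskerLeft_comp, comp_whiskerRight, whisker_assoc,
      Iso.inv_hom_id, Category.comp_id]
    rw [associator_inv_naturality_right_assoc, whisker_exchange_assoc]
    simp
  have h2 : (stdCell t (X ⊗ X') (Y ⊗ Y') (Z ⊗ Z')).hom ≫ B ◁ tensorμ₃ Y Y' X X' Z Z' =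
      (t.β _).inv ≫ B ◁ ((swapFst (X ⊗ X') (Y ⊗ Y') (Z ⊗ Z')).hom ≫ tensorμ₃ Y Y' X X' Z Z') := by
    simp [stdCell]
  rw [h1, h2, cancel_epi, swapFst_tensorμ₃, tensorμ₃_swapFst]
  have i1 : IsIso (tensorμ X X' Y Y') := ⟨tensorδ _ _ _ _, by simp, by simp⟩
  have i2 : IsIso (tensorμ (Y ⊗ X) (Y' ⊗ X') Z Z') := ⟨tensorδ _ _ _ _, by simp, by simp⟩
  exact whiskerLeft_cancel_iff B _ _ _ _

end Cells

end Absorption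

/-! ### Cells in a braided category and their reduction to a half-braiding. -/

section BraidedCells

variable {E : Type u} [Category.{v} E] [MonoidalCategory E]

/-- The identification of `X ⊗ (1 ⊗ 1)` with `X`. -/
def unit₁ (X : E) : X ⊗ (𝟙_ E ⊗ 𝟙_ E) ≅ X := whiskerLeftIso X (λ_ _) ≪≫ ρ_ X

/-- The identification of `1 ⊗ (X ⊗ 1)` with `X`. -/
def unit₂ (X : E) : 𝟙_ E ⊗ (X ⊗ 𝟙_ E) ≅ X := λ_ _ ≪≫ ρ_ X

/-- The identification of `1 ⊗ (1 ⊗ X)` with `X`. -/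
def unit₃ (X : E) : 𝟙_ E ⊗ (𝟙_ E ⊗ X) ≅ X := λ_ _ ≪≫ λ_ X

lemma unit₁_hom (X : E) : (unit₁ X).hom = X ◁ (λ_ (𝟙_ E)).hom ≫ (ρ_ X).hom := rfl

lemma unit₁_inv (X : E) : (unit₁ X).inv = (ρ_ X).inv ≫ X ◁ (λ_ (𝟙_ E)).inv := rfl

lemma unit₂_hom (X : E) : (unit₂ X).hom = (λ_ _).hom ≫ (ρ_ X).hom := rfl

lemma unit₂_inv (X : E) : (unit₂ X).inv = (ρ_ X).inv ≫ (λ_ _).inv := rfl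

lemma unit₃_hom (X : E) : (unit₃ X).hom = (λ_ _).hom ≫ (λ_ X).hom := rfl

lemma unit₃_inv (X : E) : (unit₃ X).inv = (λ_ X).inv ≫ (λ_ _).inv := rfl

variable [BraidedCategory E]

lemma swapFst_unit₁ (X : E) : (swapFst X (𝟙_ E) (𝟙_ E)).hom = (unit₁ X).hom ≫ (unit₂ X).inv := by
  simp only [swapFst, unit₁_hom, unit₂_inv, Iso.trans_hom, Iso.symm_hom, whiskerRightIso_hom,
    braiding_tensorUnit_right]
  monoidal

lemma swapFst_unit₂ (X : E) : (swapFst (𝟙_ E) X (𝟙_ E)).hom = (unit₂ X).hom ≫ (unit₁ X).inv := by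
  simp only [swapFst, unit₁_inv, unit₂_hom, Iso.trans_hom, Iso.symm_hom, whiskerRightIso_hom,
    braiding_tensorUnit_left]
  monoidal

lemma swapFst_unit₃ (X : E) : (swapFst (𝟙_ E) (𝟙_ E) X).hom = 𝟙 _ := by
  simp only [swapFst, Iso.trans_hom, Iso.symm_hom, whiskerRightIso_hom, braiding_tensorUnit_left]
  monoidal

/-- A pseudo-natural family of cells on the object `B` of a braided monoidal category, going from
the functor `X ⊗ (Y ⊗ Z)` to the functor `Y ⊗ (X ⊗ Z)`. -/
structure Cells (B : E) where
  σ : ∀ X Y Z : E, (X ⊗ (Y ⊗ Z)) ⊗ B ≅ B ⊗ (Y ⊗ (X ⊗ Z))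
  naturality : ∀ {X X' Y Y' Z Z' : E} (f : X ⟶ X') (g : Y ⟶ Y') (h : Z ⟶ Z'),
    (f ⊗ₘ (g ⊗ₘ h)) ▷ B ≫ (σ X' Y' Z').hom = (σ X Y Z).hom ≫ B ◁ (g ⊗ₘ (f ⊗ₘ h))
  comp : ∀ X X' Y Y' Z Z' : E,
    (σ (X ⊗ X') (Y ⊗ Y') (Z ⊗ Z')).hom ≫ B ◁ tensorμ₃ Y Y' X X' Z Z' =
      tensorμ₃ X X' Y Y' Z Z' ▷ B ≫ (α_ _ _ _).hom ≫ (X ⊗ (Y ⊗ Z)) ◁ (σ X' Y' Z').hom ≫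
        (α_ _ _ _).inv ≫ (σ X Y Z).hom ▷ (Y' ⊗ (X' ⊗ Z')) ≫ (α_ _ _ _).hom

lemma tensorμ_unit_left (X Y : E) : tensorμ (𝟙_ E) (𝟙_ E) X Y = ⊗𝟙.hom := by
  simp only [tensorμ, braiding_tensorUnit_left]
  monoidal

lemma tensorμ₃_unit (X Y : E) : tensorμ₃ (𝟙_ E) (𝟙_ E) (𝟙_ E) (𝟙_ E) X Y = ⊗𝟙.hom := by
  simp only [tensorμ₃, tensorμ_unit_left]
  monoidal

namespace Cells

variable {B : E} (c : Cells B) (t : ∀ X : E, B ⊗ X ≅ X ⊗ B)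

/-- The cells at `(X, 1, 1)`, `(1, X, 1)` and `(1, 1, X)` are all given by `t`. -/
structure IsGeneratedBy : Prop where
  cell₁ : ∀ X, (c.σ X (𝟙_ E) (𝟙_ E)).hom = (unit₁ X).hom ▷ B ≫ (t X).inv ≫ B ◁ (unit₂ X).inv
  cell₂ : ∀ X, (c.σ (𝟙_ E) X (𝟙_ E)).hom = (unit₂ X).hom ▷ B ≫ (t X).inv ≫ B ◁ (unit₁ X).inv
  cell₃ : ∀ X, (c.σ (𝟙_ E) (𝟙_ E) X).hom = (unit₃ X).hom ▷ B ≫ (t X).inv ≫ B ◁ (unit₃ X).inv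

variable {c t}

lemma IsGeneratedBy.inv_eq (h : c.IsGeneratedBy t) (X : E) :
    (t X).inv = (unit₃ X).inv ▷ B ≫ (c.σ (𝟙_ E) (𝟙_ E) X).hom ≫ B ◁ (unit₃ X).hom := by
  simp [h.cell₃]

lemma IsGeneratedBy.inv_naturality (h : c.IsGeneratedBy t) {X Y : E} (f : X ⟶ Y) :
    f ▷ B ≫ (t Y).inv = (t X).inv ≫ B ◁ f := by
  have h1 := c.naturality (𝟙 (𝟙_ E)) (𝟙 (𝟙_ E)) f
  have h2 : f ≫ (unit₃ Y).inv = (unit₃ X).inv ≫ (𝟙 (𝟙_ E) ⊗ₘ (𝟙 (𝟙_ E) ⊗ₘ f)) := by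
    simp [unit₃_inv]
  have h3 : (𝟙 (𝟙_ E) ⊗ₘ (𝟙 (𝟙_ E) ⊗ₘ f)) ≫ (unit₃ Y).hom = (unit₃ X).hom ≫ f := by
    simp [unit₃_hom]
  rw [h.inv_eq, h.inv_eq, ← comp_whiskerRight_assoc, h2, comp_whiskerRight_assoc, reassoc_of% h1,
    ← MonoidalCategory.whiskerLeft_comp, h3]
  simp

/-- In the composition law for `(1,1,X)` and `(1,1,Y)` all exchanges involve a unit, so only
coherence isomorphisms remain; naturality along `1 ⊗ 1 ≅ 1` then brings the result back to the cell
at `(1,1,X ⊗ Y)`. -/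
lemma IsGeneratedBy.inv_tensor (h : c.IsGeneratedBy t) (X Y : E) : (t (X ⊗ Y)).inv =
    (α_ _ _ _).hom ≫ X ◁ (t Y).inv ≫ (α_ _ _ _).inv ≫ (t X).inv ▷ Y ≫ (α_ _ _ _).hom := by
  have h1 := c.comp (𝟙_ E) (𝟙_ E) (𝟙_ E) (𝟙_ E) X Y
  have h2 := c.naturality (λ_ (𝟙_ E)).hom (λ_ (𝟙_ E)).hom (𝟙 (X ⊗ Y))
  rw [h.cell₃, h.cell₃, tensorμ₃_unit] at h1
  -- The composition law is solved for the cell of the product by composing with the inverse of the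
  -- coherence isomorphism, which `⊗𝟙` finds.
  have h3 : (c.σ (𝟙_ E ⊗ 𝟙_ E) (𝟙_ E ⊗ 𝟙_ E) (X ⊗ Y)).hom = _ ≫ B ◁ (⊗𝟙).hom :=
    (by monoidal : _ = ((c.σ (𝟙_ E ⊗ 𝟙_ E) (𝟙_ E ⊗ 𝟙_ E) (X ⊗ Y)).hom ≫ B ◁ (⊗𝟙).hom) ≫ B ◁ (⊗𝟙).hom).trans
      (congrArg (· ≫ B ◁ (⊗𝟙).hom) h1)
  have h4 : (c.σ (𝟙_ E) (𝟙_ E) (X ⊗ Y)).hom =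
      ((λ_ (𝟙_ E)).inv ⊗ₘ ((λ_ (𝟙_ E)).inv ⊗ₘ 𝟙 (X ⊗ Y))) ▷ B ≫
        (c.σ (𝟙_ E ⊗ 𝟙_ E) (𝟙_ E ⊗ 𝟙_ E) (X ⊗ Y)).hom ≫
          B ◁ ((λ_ (𝟙_ E)).hom ⊗ₘ ((λ_ (𝟙_ E)).hom ⊗ₘ 𝟙 (X ⊗ Y))) := by
    rw [← h2, ← comp_whiskerRight_assoc]
    simp
  rw [h.inv_eq, h4, h3]
  simp only [unit₃_hom, unit₃_inv]
  monoidal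

/-- The half-braiding which generates a family of cells. -/
def IsGeneratedBy.halfBraiding (h : c.IsGeneratedBy t) : HalfBraiding B where
  β := t
  monoidal X Y := by
    rw [← cancel_epi (t (X ⊗ Y)).inv, Iso.inv_hom_id, h.inv_tensor]
    simp
  naturality f := by
    rw [← cancel_epi (t _).inv, Iso.inv_hom_id_assoc, ← reassoc_of% h.inv_naturality f]
    simp

lemma stdCell_unit₁ (t : HalfBraiding B) (X : E) : (stdCell t X (𝟙_ E) (𝟙_ E)).hom =
    (unit₁ X).hom ▷ B ≫ (t.β X).inv ≫ B ◁ (unit₂ X).inv := by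
  simp [stdCell, swapFst_unit₁, reassoc_of% (HalfBraiding_inv_naturality t)]

lemma stdCell_unit₂ (t : HalfBraiding B) (X : E) : (stdCell t (𝟙_ E) X (𝟙_ E)).hom =
    (unit₂ X).hom ▷ B ≫ (t.β X).inv ≫ B ◁ (unit₁ X).inv := by
  simp [stdCell, swapFst_unit₂, reassoc_of% (HalfBraiding_inv_naturality t)]

lemma stdCell_unit₃ (t : HalfBraiding B) (X : E) : (stdCell t (𝟙_ E) (𝟙_ E) X).hom =
    (unit₃ X).hom ▷ B ≫ (t.β X).inv ≫ B ◁ (unit₃ X).inv := by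
  simp [stdCell, swapFst_unit₃, reassoc_of% (HalfBraiding_inv_naturality t),
    ← MonoidalCategory.whiskerLeft_comp]

lemma innerTwist_unit_left (X Y Z : E) : innerTwist X (𝟙_ E) Y Z = 𝟙 _ := by
  simp [innerTwist]

lemma innerTwist_unit_right (X Y Z : E) : innerTwist X Y (𝟙_ E) Z = 𝟙 _ := by
  simp [innerTwist]

/-- Given and standard cells obey the same composition law as soon as the inner twist is trivial, so
agreement on two triples passes to their product. -/
lemma eq_stdCell_comp (t : HalfBraiding B) {X X' Y Y' Z Z' : E}
    (h : (c.σ X Y Z).hom = (stdCell t X Y Z).hom) (h' : (c.σ X' Y' Z').hom = (stdCell t X' Y' Z').hom)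
    (hi : innerTwist Y X Y' X' = 𝟙 _) :
    (c.σ (X ⊗ X') (Y ⊗ Y') (Z ⊗ Z')).hom = (stdCell t (X ⊗ X') (Y ⊗ Y') (Z ⊗ Z')).hom := by
  have h1 := (stdCell_comp_iff t X X' Y Y' Z Z').2 (by simp [hi])
  rw [← cancel_mono (B ◁ tensorμ₃ Y Y' X X' Z Z'), h1, c.comp, h, h']

lemma eq_stdCell_of_iso (t : HalfBraiding B) {X X' Y Y' Z Z' : E}
    (h : (c.σ X Y Z).hom = (stdCell t X Y Z).hom) (e : X ≅ X') (e' : Y ≅ Y') (e'' : Z ≅ Z') :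
    (c.σ X' Y' Z').hom = (stdCell t X' Y' Z').hom := by
  rw [← cancel_epi ((e.hom ⊗ₘ (e'.hom ⊗ₘ e''.hom)) ▷ B), c.naturality, h, stdCell_naturality]

/-- In the product `(1,Y,1)(X,1,1)(1,1,Z)`, taken in this order, each inner twist is a double
braiding with a unit and hence trivial. The isomorphisms at the end remove the superfluous units. -/
lemma IsGeneratedBy.eq_stdCell (h : c.IsGeneratedBy t) (X Y Z : E) :
    (c.σ X Y Z).hom = (stdCell h.halfBraiding X Y Z).hom := by
  have h1 := (h.cell₁ X).trans (stdCell_unit₁ h.halfBraiding X).symm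
  have h2 := (h.cell₂ Y).trans (stdCell_unit₂ h.halfBraiding Y).symm
  have h3 := (h.cell₃ Z).trans (stdCell_unit₃ h.halfBraiding Z).symm
  exact eq_stdCell_of_iso _ (eq_stdCell_comp _ (eq_stdCell_comp _ h2 h1 (innerTwist_unit_left _ _ _))
    h3 (innerTwist_unit_right _ _ _)) (ρ_ _ ≪≫ λ_ X) (ρ_ _ ≪≫ ρ_ Y) (whiskerRightIso (λ_ _) _ ≪≫ λ_ Z)

/-- The opposite order `(X,1,1)(1,Y,1)` has the double braiding of `X` and `Y` as its inner twist.
All cells being standard, the composition law forces `B` to absorb it. -/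
lemma IsGeneratedBy.whiskerLeft_double_braiding (h : c.IsGeneratedBy t) (X Y : E) :
    B ◁ ((β_ X Y).hom ≫ (β_ Y X).hom) = 𝟙 _ := by
  have h1 := c.comp X (𝟙_ E) (𝟙_ E) Y (𝟙_ E) (𝟙_ E)
  simp only [h.eq_stdCell] at h1
  rw [stdCell_comp_iff] at h1
  have h2 : (β_ X Y).hom ≫ (β_ Y X).hom = ((λ_ X).inv ⊗ₘ (ρ_ Y).inv) ≫ (ρ_ _).inv ≫ _ ◁ (λ_ _).inv ≫
      innerTwist (𝟙_ E) X Y (𝟙_ E) ▷ (𝟙_ E ⊗ 𝟙_ E) ≫ _ ◁ (λ_ _).hom ≫ (ρ_ _).hom ≫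
        ((λ_ X).hom ⊗ₘ (ρ_ Y).hom) := by
    simp only [innerTwist]
    monoidal
  rw [h2]
  simp only [MonoidalCategory.whiskerLeft_comp]
  rw [reassoc_of% h1]
  simp only [← MonoidalCategory.whiskerLeft_comp]
  simp

lemma innerTwist_absorbed (t : HalfBraiding B)
    (h : ∀ X Y : E, B ◁ ((β_ X Y).hom ≫ (β_ Y X).hom) = 𝟙 _) (X Y Z W V : E) :
    B ◁ innerTwist X Y Z W ▷ V = 𝟙 _ := by
  have h1 : B ◁ ((β_ Y Z).hom ≫ (β_ Z Y).hom) = B ◁ 𝟙 _ := by rw [h]; simp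
  have h2 := whiskerLeft_whiskerLeft_eq_of_eq t X (whiskerLeft_whiskerRight_eq_of_eq W h1)
  have h3 : B ◁ innerTwist X Y Z W = B ◁ 𝟙 _ := by
    simp only [innerTwist, MonoidalCategory.whiskerLeft_comp, Category.assoc] at h2 ⊢
    rw [reassoc_of% h2]
    simp only [← MonoidalCategory.whiskerLeft_comp]
    simp
  rw [whiskerLeft_whiskerRight_eq_of_eq V h3]
  simp

/-- The cells determined by a half-braiding which absorbs double braidings. -/
def std (t : HalfBraiding B) (h : ∀ X Y : E, B ◁ ((β_ X Y).hom ≫ (β_ Y X).hom) = 𝟙 _) : Cells B where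
  σ := stdCell t
  naturality f g h := stdCell_naturality t f g h
  comp X X' Y Y' Z Z' :=
    (stdCell_comp_iff t X X' Y Y' Z Z').2 (innerTwist_absorbed t h _ _ _ _ _)

end Cells

end BraidedCells

/-! ### Naturality of an endomorphism of the cube of `B` with respect to the hexagon. -/

section HexagonNaturality

variable {E : Type u} [Category.{v} E] [MonoidalCategory E]

section Paste

/-- Vertical pasting of two squares. -/
def paste {W₁ W₂ W₃ P Q : E} (σ : W₁ ⊗ P ⟶ P ⊗ W₂) (τ : W₂ ⊗ Q ⟶ Q ⊗ W₃) :
    W₁ ⊗ (P ⊗ Q) ⟶ (P ⊗ Q) ⊗ W₃ :=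
  (α_ _ _ _).inv ≫ σ ▷ Q ≫ (α_ _ _ _).hom ≫ P ◁ τ ≫ (α_ _ _ _).inv

/-- The tensor product of two half-braidings. -/
def tensorHB {P Q : E} (b : HalfBraiding P) (b' : HalfBraiding Q) : HalfBraiding (P ⊗ Q) :=
  (Center.tensorObj ⟨P, b⟩ ⟨Q, b'⟩).2

lemma tensorHB_inv {P Q : E} (b : HalfBraiding P) (b' : HalfBraiding Q) (W : E) :
    ((tensorHB b b').β W).inv = paste (b.β W).inv (b'.β W).inv := by
  simp [tensorHB, paste, Center.tensorObj]

/-- The square given by a half-braiding and a morphism. -/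
def hbSq {P : E} (b : HalfBraiding P) {W W' : E} (θ : W ⟶ W') : W ⊗ P ⟶ P ⊗ W' :=
  (b.β W).inv ≫ P ◁ θ

/-- Naturality of the second half-braiding moves `θ` past `Q`. A whole path is thus reduced to a
single half-braiding followed by a single morphism. -/
lemma paste_hbSq {P Q : E} (b : HalfBraiding P) (b' : HalfBraiding Q) {W₁ W₂ W₃ : E}
    (θ : W₁ ⟶ W₂) (θ' : W₂ ⟶ W₃) :
    paste (hbSq b θ) (hbSq b' θ') = hbSq (tensorHB b b') (θ ≫ θ') := by
  simp only [hbSq, tensorHB_inv, paste, comp_whiskerRight, Category.assoc,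
    MonoidalCategory.whiskerLeft_comp, whisker_assoc, Iso.inv_hom_id_assoc,
    tensor_whiskerLeft]
  rw [← MonoidalCategory.whiskerLeft_comp_assoc P (θ ▷ Q), HalfBraiding_inv_naturality,
    MonoidalCategory.whiskerLeft_comp_assoc]

lemma tensorHB_congr {P Q : E} (b : HalfBraiding P) {b₁ b₂ : HalfBraiding Q} {W : E}
    (h : (b₁.β W).inv = (b₂.β W).inv) :
    ((tensorHB b b₁).β W).inv = ((tensorHB b b₂).β W).inv := by
  rw [tensorHB_inv, tensorHB_inv, h]

/-- A half-braiding carries no unit axiom. Up to unitors its component at the unit is an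
automorphism `y` of `B`; multiplicativity at `1 ⊗ 1` makes it idempotent, hence the identity. -/
lemma HalfBraiding_unit_inv {B : E} (t : HalfBraiding B) :
    (t.β (𝟙_ E)).inv = (λ_ B).hom ≫ (ρ_ B).inv := by
  have h1 := HalfBraiding_inv_tensor t (𝟙_ E) (𝟙_ E)
  have h2 := HalfBraiding_inv_naturality t (λ_ (𝟙_ E)).hom
  rw [h1] at h2
  obtain ⟨y, hy⟩ : ∃ y : B ⟶ B, (t.β (𝟙_ E)).inv = (λ_ B).hom ≫ y ≫ (ρ_ B).inv :=
    ⟨(λ_ B).inv ≫ (t.β (𝟙_ E)).inv ≫ (ρ_ B).hom, by simp⟩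
  have hyi : IsIso y := by
    have : y = (λ_ B).inv ≫ (t.β (𝟙_ E)).inv ≫ (ρ_ B).hom := by simp [hy]
    rw [this]
    infer_instance
  rw [hy] at h2 ⊢
  have h3 : y ≫ y = y := by
    calc
      y ≫ y = ((λ_ B).inv ≫ (λ_ _).inv ≫ (α_ _ _ _).inv) ≫ (((α_ (𝟙_ E) (𝟙_ E) B).hom ≫
          𝟙_ E ◁ ((λ_ B).hom ≫ y ≫ (ρ_ B).inv) ≫ (α_ (𝟙_ E) B (𝟙_ E)).inv ≫
          ((λ_ B).hom ≫ y ≫ (ρ_ B).inv) ▷ 𝟙_ E ≫ (α_ B (𝟙_ E) (𝟙_ E)).hom) ≫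
          B ◁ (λ_ (𝟙_ E)).hom) ≫ (ρ_ B).hom := by monoidal
      _ = y := by rw [← h2]; monoidal
  have h4 : y = 𝟙 _ := by rw [← cancel_epi y, h3, Category.comp_id]
  rw [h4, Category.id_comp]

lemma middle_eq_of_whiskerRight_eq {B : E} (t : HalfBraiding B) {X Y : E} {f g : X ⟶ Y}
    (h : f ▷ (B ⊗ B) = g ▷ (B ⊗ B)) : B ◁ f ▷ B = B ◁ g ▷ B := by
  apply whiskerLeft_eq_of_whiskerRight_eq t
  simpa [whiskerRight_tensor] using h

lemma last_eq_of_whiskerRight_eq {B : E} (t : HalfBraiding B) {X Y : E} {f g : X ⟶ Y}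
    (h : f ▷ (B ⊗ B) = g ▷ (B ⊗ B)) : B ◁ B ◁ f = B ◁ B ◁ g := by
  apply whiskerLeft_eq_of_whiskerRight_eq t
  rw [whisker_assoc, whisker_assoc, middle_eq_of_whiskerRight_eq t h]

/-- Each of the three squares stands beside two further copies of `B`, on whichever side, so only
its value after tensoring with `B ⊗ B` matters. -/
lemma paste_paste_congr (t : HalfBraiding B) {W₁ W₂ W₃ W₄ : E}
    {σ₁ τ₁ : W₁ ⊗ B ⟶ B ⊗ W₂} {σ₂ τ₂ : W₂ ⊗ B ⟶ B ⊗ W₃} {σ₃ τ₃ : W₃ ⊗ B ⟶ B ⊗ W₄}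
    (h₁ : σ₁ ▷ (B ⊗ B) = τ₁ ▷ (B ⊗ B)) (h₂ : σ₂ ▷ (B ⊗ B) = τ₂ ▷ (B ⊗ B))
    (h₃ : σ₃ ▷ (B ⊗ B) = τ₃ ▷ (B ⊗ B)) :
    paste σ₁ (paste σ₂ σ₃) = paste τ₁ (paste τ₂ τ₃) := by
  simp only [paste, MonoidalCategory.whiskerLeft_comp]
  rw [h₁, middle_eq_of_whiskerRight_eq t h₂, last_eq_of_whiskerRight_eq t h₃]

end Paste

variable [BraidedCategory E]

/-- The half-braiding given by the braiding. -/
def braidingHB (P : E) : HalfBraiding P where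
  β U := (β_ U P).symm
  monoidal U U' := by simp
  naturality f := by simp

/-- The tensor product of an object with a square. -/
def tensorLeftSq (X : E) {W W' P : E} (s : W ⊗ P ⟶ P ⊗ W') : (X ⊗ W) ⊗ P ⟶ P ⊗ (X ⊗ W') :=
  (α_ _ _ _).hom ≫ X ◁ s ≫ (α_ _ _ _).inv ≫ (β_ X P).hom ▷ W' ≫ (α_ _ _ _).hom

/-- `tensorLeftSq` moves `X` past `P` by the braiding. Where this is also what `b` does,
multiplicativity of `b` merges the two crossings. -/
lemma tensorLeftSq_hbSq {P : E} (b : HalfBraiding P) (X : E) (hX : (b.β X).inv = (β_ X P).hom)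
    {W W' : E} (θ : W ⟶ W') :
    tensorLeftSq X (hbSq b θ) = hbSq b (X ◁ θ) := by
  simp only [tensorLeftSq, hbSq, ← hX, HalfBraiding_inv_tensor]
  have h1 : X ◁ P ◁ θ ≫ (α_ X P W').inv ≫ (b.β X).inv ▷ W' ≫ (α_ P X W').hom =
      (α_ X P W).inv ≫ (b.β X).inv ▷ W ≫ (α_ P X W).hom ≫ P ◁ X ◁ θ := by
    rw [associator_inv_naturality_right_assoc, whisker_exchange_assoc]
    simp
  simp [h1]

lemma swapFst_yangBaxter (X Y Z W : E) :
    (swapFst X Y (Z ⊗ W)).hom ≫ Y ◁ (swapFst X Z W).hom ≫ (swapFst Y Z (X ⊗ W)).hom =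
      X ◁ (swapFst Y Z W).hom ≫ (swapFst X Z (Y ⊗ W)).hom ≫ Z ◁ (swapFst X Y W).hom := by
  calc
    _ = 𝟙 _ ⊗≫ ((α_ X Y Z).inv ≫ (β_ X Y).hom ▷ Z ≫ (α_ Y X Z).hom ≫
          Y ◁ (β_ X Z).hom ≫ (α_ Y Z X).inv ≫ (β_ Y Z).hom ▷ X ≫ (α_ Z Y X).hom) ▷ W ⊗≫ 𝟙 _ := by
      simp only [swapFst, Iso.trans_hom, Iso.symm_hom, whiskerRightIso_hom]
      monoidal
    _ = _ := by
      rw [BraidedCategory.yang_baxter]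
      simp only [swapFst, Iso.trans_hom, Iso.symm_hom, whiskerRightIso_hom]
      monoidal

section Hexagon

variable {B : E} (c : Cells B)

/-- The naturality square of the upper path of the hexagon. -/
def Cells.hexSrc (X Y Z W : E) : (X ⊗ (Y ⊗ (Z ⊗ W))) ⊗ (B ⊗ (B ⊗ B)) ⟶
    (B ⊗ (B ⊗ B)) ⊗ (Z ⊗ (Y ⊗ (X ⊗ W))) :=
  paste (c.σ X Y (Z ⊗ W)).hom
    (paste (tensorLeftSq Y (c.σ X Z W).hom) (c.σ Y Z (X ⊗ W)).hom)

/-- The naturality square of the lower path of the hexagon. -/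
def Cells.hexTgt (X Y Z W : E) : (X ⊗ (Y ⊗ (Z ⊗ W))) ⊗ (B ⊗ (B ⊗ B)) ⟶
    (B ⊗ (B ⊗ B)) ⊗ (Z ⊗ (Y ⊗ (X ⊗ W))) :=
  paste (tensorLeftSq X (c.σ Y Z W).hom)
    (paste (c.σ X Z (Y ⊗ W)).hom (tensorLeftSq Z (c.σ X Y W).hom))

/-- An endomorphism of `B ⊗ (B ⊗ B)` is natural with respect to the hexagon. -/
def Cells.HexNatural (S : B ⊗ (B ⊗ B) ⟶ B ⊗ (B ⊗ B)) : Prop :=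
  ∀ X Y Z W : E, (X ⊗ (Y ⊗ (Z ⊗ W))) ◁ S ≫ c.hexTgt X Y Z W =
    c.hexSrc X Y Z W ≫ S ▷ (Z ⊗ (Y ⊗ (X ⊗ W)))

lemma stdCell_hom (t : HalfBraiding B) (X Y Z : E) :
    (stdCell t X Y Z).hom = hbSq t (swapFst X Y Z).hom := rfl

variable (t : HalfBraiding B)

/-- A half-braiding agrees with the braiding after tensoring with `B ⊗ B`. -/
def AgreesWithBraiding : Prop :=
  ∀ X : E, (t.β X).inv ▷ (B ⊗ B) = (β_ X B).hom ▷ (B ⊗ B)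

variable {t}

lemma AgreesWithBraiding.hbSq_eq (h : AgreesWithBraiding t) {W W' : E} (θ : W ⟶ W') :
    hbSq t θ ▷ (B ⊗ B) = hbSq (braidingHB B) θ ▷ (B ⊗ B) := by
  rw [hbSq, comp_whiskerRight, h, ← comp_whiskerRight]
  rfl

lemma AgreesWithBraiding.tensorLeftSq_eq (h : AgreesWithBraiding t) (X : E) {W W' : E}
    (θ : W ⟶ W') :
    tensorLeftSq X (hbSq t θ) ▷ (B ⊗ B) = hbSq (braidingHB B) (X ◁ θ) ▷ (B ⊗ B) := by
  rw [← tensorLeftSq_hbSq (braidingHB B) X rfl]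
  have h1 : (X ◁ hbSq t θ) ▷ (B ⊗ B) = (X ◁ hbSq (braidingHB B) θ) ▷ (B ⊗ B) := by
    rw [whisker_assoc, h.hbSq_eq, whisker_assoc]
  simp only [tensorLeftSq, comp_whiskerRight _ _ (B ⊗ B), h1]

lemma braidingHB_tensor (P Q : E) (W : E) :
    ((tensorHB (braidingHB P) (braidingHB Q)).β W).inv = (β_ W (P ⊗ Q)).hom := by
  simp [tensorHB_inv, paste, braidingHB]

/-- Every square may be replaced by the one of the braiding. Both paths then become the braiding
with the cube of `B` followed by the same permutation, by the Yang–Baxter equation, and any `S`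
slides through. -/
lemma AgreesWithBraiding.hexNatural (h : AgreesWithBraiding t)
    (hc : ∀ X Y Z, (c.σ X Y Z).hom = (stdCell t X Y Z).hom)
    (S : B ⊗ (B ⊗ B) ⟶ B ⊗ (B ⊗ B)) : c.HexNatural S := by
  intro X Y Z W
  have h1 : c.hexSrc X Y Z W = (β_ _ _).hom ≫ (B ⊗ (B ⊗ B)) ◁
      ((swapFst X Y (Z ⊗ W)).hom ≫ Y ◁ (swapFst X Z W).hom ≫ (swapFst Y Z (X ⊗ W)).hom) := by
    simp only [Cells.hexSrc, hc, stdCell_hom]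
    rw [paste_paste_congr t (h.hbSq_eq _) (h.tensorLeftSq_eq _ _) (h.hbSq_eq _), paste_hbSq,
      paste_hbSq, hbSq, tensorHB_congr _ ((braidingHB_tensor B B _).trans (by rfl :
        _ = ((braidingHB (B ⊗ B)).β _).inv)), braidingHB_tensor]
  have h2 : c.hexTgt X Y Z W = (β_ _ _).hom ≫ (B ⊗ (B ⊗ B)) ◁
      ((swapFst X Y (Z ⊗ W)).hom ≫ Y ◁ (swapFst X Z W).hom ≫ (swapFst Y Z (X ⊗ W)).hom) := by
    simp only [Cells.hexTgt, hc, stdCell_hom]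
    rw [paste_paste_congr t (h.tensorLeftSq_eq _ _) (h.hbSq_eq _) (h.tensorLeftSq_eq _ _), paste_hbSq,
      paste_hbSq, hbSq, tensorHB_congr _ ((braidingHB_tensor B B _).trans (by rfl :
        _ = ((braidingHB (B ⊗ B)).β _).inv)), braidingHB_tensor, swapFst_yangBaxter]
  rw [h1, h2, BraidedCategory.braiding_naturality_right_assoc, Category.assoc, whisker_exchange]

/-- The case `(1,1,1,W)` lets `S` commute with the half-braiding of the cube of `B`, so that `S`
cancels in the case `(X,1,1,1)`. There the two paths differ only in how `X` passes the first copy of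
`B`. -/
lemma Cells.HexNatural.agreesWithBraiding {c : Cells B} {S : B ⊗ (B ⊗ B) ⟶ B ⊗ (B ⊗ B)}
    [IsIso S] (h : c.HexNatural S) (hc : ∀ X Y Z, (c.σ X Y Z).hom = (stdCell t X Y Z).hom) :
    AgreesWithBraiding t := by
  have hu : (t.β (𝟙_ E)).inv = (β_ (𝟙_ E) B).hom := by
    rw [HalfBraiding_unit_inv, braiding_tensorUnit_left]
  let b := tensorHB t (tensorHB t t)
  -- At `(1,1,1,W)` the braiding only moves units, where it equals `t` by `hu`, so both paths
  -- consist of crossings by `t`.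
  have hb : ∀ W : E, W ◁ S ≫ (b.β W).inv = (b.β W).inv ≫ S ▷ W := by
    intro W
    have h1 := h (𝟙_ E) (𝟙_ E) (𝟙_ E) W
    simp only [Cells.hexSrc, Cells.hexTgt, hc, stdCell_hom] at h1
    simp only [tensorLeftSq_hbSq t _ hu, paste_hbSq] at h1
    simp only [swapFst_unit₃, MonoidalCategory.whiskerLeft_id, Category.comp_id, hbSq] at h1
    let e : W ≅ 𝟙_ E ⊗ (𝟙_ E ⊗ (𝟙_ E ⊗ W)) := (unit₃ W).symm ≪≫ (λ_ _).symm
    rw [← cancel_mono ((B ⊗ (B ⊗ B)) ◁ e.hom), Category.assoc, Category.assoc, ← whisker_exchange,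
      ← HalfBraiding_inv_naturality, ← reassoc_of% (HalfBraiding_inv_naturality b),
      whisker_exchange_assoc]
    exact congrArg (e.hom ▷ _ ≫ ·) h1
  intro X
  have h1 := h X (𝟙_ E) (𝟙_ E) (𝟙_ E)
  -- On the upper path `X` passes all three copies of `B` by `t`. The swaps are redistributed by
  -- Yang–Baxter so that the last two squares match those of the lower path.
  have h2 : c.hexSrc X (𝟙_ E) (𝟙_ E) (𝟙_ E) =
      paste (hbSq t (X ◁ (swapFst (𝟙_ E) (𝟙_ E) (𝟙_ E)).hom))
        (paste (hbSq t (swapFst X (𝟙_ E) (𝟙_ E ⊗ 𝟙_ E)).hom)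
          (hbSq t (𝟙_ E ◁ (swapFst X (𝟙_ E) (𝟙_ E)).hom))) := by
    simp only [Cells.hexSrc, hc, stdCell_hom]
    rw [tensorLeftSq_hbSq t _ hu, paste_hbSq, paste_hbSq, paste_hbSq, paste_hbSq,
      swapFst_yangBaxter]
  have h3 : c.hexSrc X (𝟙_ E) (𝟙_ E) (𝟙_ E) ≫ S ▷ _ =
      _ ◁ S ≫ c.hexSrc X (𝟙_ E) (𝟙_ E) (𝟙_ E) := by
    rw [h2, paste_hbSq, paste_hbSq, hbSq, reassoc_of% (hb _), Category.assoc, whisker_exchange]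
  rw [h3, cancel_epi, h2] at h1
  simp only [Cells.hexTgt, hc, stdCell_hom] at h1
  rw [tensorLeftSq_hbSq t _ hu] at h1
  have hi : ∀ {W W' : E} (θ : W ⟶ W') [IsIso θ], IsIso (hbSq t θ) := fun θ _ => by
    unfold hbSq; infer_instance
  -- The last two squares are invertible and cancel; what remains compares the braiding with `t` on
  -- the first copy.
  have h4 : tensorLeftSq X (hbSq t (swapFst (𝟙_ E) (𝟙_ E) (𝟙_ E)).hom) ▷ (B ⊗ B) =
      hbSq t (X ◁ (swapFst (𝟙_ E) (𝟙_ E) (𝟙_ E)).hom) ▷ (B ⊗ B) := by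
    have i1 := hi (swapFst X (𝟙_ E) (𝟙_ E ⊗ 𝟙_ E)).hom
    have i2 := hi (𝟙_ E ◁ (swapFst X (𝟙_ E) (𝟙_ E)).hom)
    simpa only [paste, cancel_epi, cancel_mono] using h1
  rw [swapFst_unit₃, MonoidalCategory.whiskerLeft_id, hbSq, hbSq, MonoidalCategory.whiskerLeft_id,
    Category.comp_id, MonoidalCategory.whiskerLeft_id, Category.comp_id, tensorLeftSq,
    HalfBraiding_inv_tensor t X] at h4
  have h5 : (t.β X).inv ▷ (𝟙_ E ⊗ (𝟙_ E ⊗ 𝟙_ E)) ▷ (B ⊗ B) =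
      (β_ X B).hom ▷ (𝟙_ E ⊗ (𝟙_ E ⊗ 𝟙_ E)) ▷ (B ⊗ B) := by
    simpa only [comp_whiskerRight _ _ (B ⊗ B), cancel_epi, cancel_mono] using h4.symm
  -- This removes the unit factors left over from `Y`, `Z`, `W`.
  have key : ∀ f : X ⊗ B ⟶ B ⊗ X, f ▷ (B ⊗ B) =
      ((ρ_ _).inv ≫ _ ◁ (unit₃ (𝟙_ E)).inv) ▷ (B ⊗ B) ≫
        f ▷ (𝟙_ E ⊗ (𝟙_ E ⊗ 𝟙_ E)) ▷ (B ⊗ B) ≫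
          (_ ◁ (unit₃ (𝟙_ E)).hom ≫ (ρ_ _).hom) ▷ (B ⊗ B) := by
    intro f
    simp only [← comp_whiskerRight]
    congr 1
    rw [← whisker_exchange_assoc]
    simp
  rw [key, key (β_ X B).hom, h5]

end Hexagon

end HexagonNaturality

/-! ### Word computations with transpositions of six strands. -/

section TetrahedronWords

section Words

variable {C : Type u} [Category.{v} C]

/-- Endomorphisms satisfying the relations between the adjacent transpositions of six strands. -/
structure SixTranspositions {P : C} (t₁ t₂ t₃ t₄ t₅ : P ⟶ P) : Prop where
  sq₁ : t₁ ≫ t₁ = 𝟙 P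
  sq₂ : t₂ ≫ t₂ = 𝟙 P
  sq₃ : t₃ ≫ t₃ = 𝟙 P
  sq₄ : t₄ ≫ t₄ = 𝟙 P
  sq₅ : t₅ ≫ t₅ = 𝟙 P
  comm₁₃ : t₃ ≫ t₁ = t₁ ≫ t₃
  comm₁₄ : t₄ ≫ t₁ = t₁ ≫ t₄
  comm₁₅ : t₅ ≫ t₁ = t₁ ≫ t₅
  comm₂₄ : t₄ ≫ t₂ = t₂ ≫ t₄
  comm₂₅ : t₅ ≫ t₂ = t₂ ≫ t₅
  comm₃₅ : t₅ ≫ t₃ = t₃ ≫ t₅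
  braid₁₂ : t₂ ≫ t₁ ≫ t₂ = t₁ ≫ t₂ ≫ t₁
  braid₂₃ : t₃ ≫ t₂ ≫ t₃ = t₂ ≫ t₃ ≫ t₂
  braid₃₄ : t₄ ≫ t₃ ≫ t₄ = t₃ ≫ t₄ ≫ t₃
  braid₄₅ : t₅ ≫ t₄ ≫ t₅ = t₄ ≫ t₅ ≫ t₄

/-- Endomorphisms acting on three adjacent strands out of six, compatible with the adjacent
transpositions. -/
structure SixStrands {P : C} (t₁ t₂ t₃ t₄ t₅ z₁ z₂ z₃ z₄ : P ⟶ P) : Prop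
    extends SixTranspositions t₁ t₂ t₃ t₄ t₅ where
  zcomm₁₄ : t₄ ≫ z₁ = z₁ ≫ t₄
  zcomm₁₅ : t₅ ≫ z₁ = z₁ ≫ t₅
  shift₁ : z₂ ≫ t₁ ≫ t₂ ≫ t₃ = t₁ ≫ t₂ ≫ t₃ ≫ z₁
  shift₂ : z₃ ≫ t₂ ≫ t₃ ≫ t₄ = t₂ ≫ t₃ ≫ t₄ ≫ z₂
  shift₃ : z₄ ≫ t₃ ≫ t₄ ≫ t₅ = t₃ ≫ t₄ ≫ t₅ ≫ z₃

variable {P : C} {t₁ t₂ t₃ t₄ t₅ z₁ z₂ z₃ z₄ : P ⟶ P}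

-- The first five identities have the form `p ≫ a = u ≫ w` needed for `move_conjugate`; the last
-- compares the permutations left over on the two sides of the permutohedron equation.
set_option linter.unusedSimpArgs false in
lemma SixTranspositions.words (h : SixTranspositions t₁ t₂ t₃ t₄ t₅) :
    t₄ ≫ t₅ ≫ t₄ ≫ t₂ ≫ t₃ ≫ t₂ ≫ t₁ ≫ t₄ ≫ t₁ ≫ t₂ ≫ t₃ =
      t₂ ≫ t₄ ≫ t₃ ≫ t₅ ≫ t₄ ∧
    t₄ ≫ t₅ ≫ t₄ ≫ t₂ ≫ t₃ ≫ t₂ ≫ t₁ ≫ t₄ ≫ t₂ ≫ t₃ ≫ t₂ ≫ t₃ ≫ t₄ ≫ t₅ ≫ t₂ ≫ t₃ ≫ t₄ ≫ t₁ ≫ t₂ ≫ t₃ =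
      t₃ ≫ t₄ ≫ t₅ ≫ t₄ ∧
    t₃ ≫ t₁ ≫ t₂ ≫ t₁ ≫ t₂ ≫ t₃ ≫ t₄ ≫ t₁ ≫ t₂ ≫ t₃ =
      t₂ ≫ t₄ ≫ t₃ ≫ t₄ ∧
    t₃ ≫ t₁ ≫ t₂ ≫ t₁ ≫ t₃ ≫ t₄ ≫ t₃ ≫ t₂ ≫ t₅ ≫ t₂ ≫ t₃ ≫ t₄ ≫ t₁ ≫ t₂ ≫ t₃ =
      t₅ ≫ t₄ ≫ t₁ ≫ t₂ ≫ t₃ ≫ t₄ ≫ t₅ ∧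
    t₃ ≫ t₁ ≫ t₂ ≫ t₁ ≫ t₃ ≫ t₄ ≫ t₃ ≫ t₂ ≫ t₅ ≫ t₃ ≫ t₄ ≫ t₃ =
      t₃ ≫ t₄ ≫ t₅ ≫ t₂ ≫ t₃ ≫ t₄ ≫ t₁ ≫ t₂ ≫ t₃ ≫ t₄ ≫ t₅ ≫ t₄ ∧
    t₄ ≫ t₅ ≫ t₄ ≫ t₂ ≫ t₃ ≫ t₂ ≫ t₁ ≫ t₄ ≫ t₂ ≫ t₃ ≫ t₂ ≫ t₄ ≫ t₅ ≫ t₄ ≫ t₃ =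
      t₃ ≫ t₁ ≫ t₂ ≫ t₁ ≫ t₃ ≫ t₄ ≫ t₃ ≫ t₂ ≫ t₅ ≫ t₃ ≫ t₄ ≫ t₃ ≫ t₁ ≫ t₂ ≫ t₁ := by
  have s1 := h.sq₁
  have s2 := h.sq₂
  have s3 := h.sq₃
  have s4 := h.sq₄
  have s5 := h.sq₅
  have c13 := h.comm₁₃
  have c14 := h.comm₁₄
  have c15 := h.comm₁₅
  have c24 := h.comm₂₄
  have c25 := h.comm₂₅
  have c35 := h.comm₃₅
  have b12 := h.braid₁₂
  have b23 := h.braid₂₃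
  have b34 := h.braid₃₄
  have b45 := h.braid₄₅
  -- These longer braid relations complete the Coxeter relations to the standard rewriting system of
  -- the symmetric group, so that `simp` brings both words to a common form.
  have b13 : t₃ ≫ t₂ ≫ t₁ ≫ t₃ = t₂ ≫ t₃ ≫ t₂ ≫ t₁ := by rw [← c13, reassoc_of% b23]
  have b24 : t₄ ≫ t₃ ≫ t₂ ≫ t₄ = t₃ ≫ t₄ ≫ t₃ ≫ t₂ := by rw [← c24, reassoc_of% b34]
  have b35 : t₅ ≫ t₄ ≫ t₃ ≫ t₅ = t₄ ≫ t₅ ≫ t₄ ≫ t₃ := by rw [← c35, reassoc_of% b45]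
  have b14 : t₄ ≫ t₃ ≫ t₂ ≫ t₁ ≫ t₄ = t₃ ≫ t₄ ≫ t₃ ≫ t₂ ≫ t₁ := by
    rw [← c14, reassoc_of% b24]
  have b25 : t₅ ≫ t₄ ≫ t₃ ≫ t₂ ≫ t₅ = t₄ ≫ t₅ ≫ t₄ ≫ t₃ ≫ t₂ := by
    rw [← c25, reassoc_of% b35]
  have b15 : t₅ ≫ t₄ ≫ t₃ ≫ t₂ ≫ t₁ ≫ t₅ = t₄ ≫ t₅ ≫ t₄ ≫ t₃ ≫ t₂ ≫ t₁ := by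
    rw [← c15, reassoc_of% b25]
  refine ⟨?_, ?_, ?_, ?_, ?_, ?_⟩ <;>
  simp only [s1, s2, s3, s4, s5, c13, c14, c15, c24, c25, c35, b12, b23, b34, b45, b13, b24, b35, b14,
    b25, b15, Category.comp_id, Category.id_comp, reassoc_of% s1, reassoc_of% s2, reassoc_of% s3,
    reassoc_of% s4, reassoc_of% s5, reassoc_of% c13, reassoc_of% c14, reassoc_of% c15,
    reassoc_of% c24, reassoc_of% c25, reassoc_of% c35, reassoc_of% b12, reassoc_of% b23,
    reassoc_of% b34, reassoc_of% b45, reassoc_of% b13, reassoc_of% b24, reassoc_of% b35,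
    reassoc_of% b14, reassoc_of% b25, reassoc_of% b15]

/-- The conjugate of `z` by a permutation depends only on what the permutation does to the strands
on which `z` acts. Accordingly `p ≫ a` may be replaced by a simpler `u`, up to a `w` that commutes
with `z`. -/
lemma move_conjugate {p a a' u u' w z z' : P ⟶ P} (hz : z' = a ≫ z ≫ a') (ha : a ≫ a' = 𝟙 P)
    (hu : u' ≫ u = 𝟙 P) (hp : p ≫ a = u ≫ w) (hw : w ≫ z = z ≫ w) :
    p ≫ z' = (u ≫ z ≫ u') ≫ p := by
  have h1 : u' ≫ p = w ≫ a' := by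
    rw [← Category.comp_id p, ← ha, reassoc_of% hp, reassoc_of% hu]
  rw [hz, reassoc_of% hp, reassoc_of% hw, Category.assoc, Category.assoc, h1]

-- All transpositions are moved to the right past the `z`'s. Each `z` turns into its conjugate on
-- the strands it really acts on, and the same permutation is left at the end of both sides.
set_option linter.unusedSimpArgs false in
lemma SixStrands.permutohedron_iff (h : SixStrands t₁ t₂ t₃ t₄ t₅ z₁ z₂ z₃ z₄) :
    (z₄ ≫ t₄ ≫ t₅ ≫ t₄) ≫ (z₂ ≫ t₂ ≫ t₃ ≫ t₂) ≫ t₁ ≫ t₄ ≫ (z₂ ≫ t₂ ≫ t₃ ≫ t₂) ≫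
        (z₄ ≫ t₄ ≫ t₅ ≫ t₄) ≫ t₃ =
      t₃ ≫ (z₁ ≫ t₁ ≫ t₂ ≫ t₁) ≫ (z₃ ≫ t₃ ≫ t₄ ≫ t₃) ≫ t₂ ≫ t₅ ≫ (z₃ ≫ t₃ ≫ t₄ ≫ t₃) ≫
        (z₁ ≫ t₁ ≫ t₂ ≫ t₁) ↔
    z₄ ≫ ((t₅ ≫ t₄) ≫ z₂ ≫ (t₄ ≫ t₅)) ≫ ((t₂ ≫ t₄ ≫ t₃) ≫ z₁ ≫ (t₃ ≫ t₄ ≫ t₂)) ≫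
        (t₃ ≫ z₁ ≫ t₃) =
      (t₃ ≫ z₁ ≫ t₃) ≫ ((t₂ ≫ t₄ ≫ t₃) ≫ z₁ ≫ (t₃ ≫ t₄ ≫ t₂)) ≫
        ((t₅ ≫ t₄) ≫ z₂ ≫ (t₄ ≫ t₅)) ≫ z₄ := by
  have s1 := h.sq₁
  have s2 := h.sq₂
  have s3 := h.sq₃
  have s4 := h.sq₄
  have s5 := h.sq₅
  have d4 := h.zcomm₁₄
  have d5 := h.zcomm₁₅
  obtain ⟨w₁, w₂, w₃, w₄, w₅, w₆⟩ := h.toSixTranspositions.words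
  -- By the shift relations every `z` is a conjugate of `z₁`, so `move_conjugate` is needed only for
  -- `z₁`, with `w` a word in `t₄` and `t₅`.
  have hz2 : z₂ = t₁ ≫ t₂ ≫ t₃ ≫ z₁ ≫ t₃ ≫ t₂ ≫ t₁ := by
    rw [← reassoc_of% h.shift₁, reassoc_of% s3, reassoc_of% s2, s1, Category.comp_id]
  have hz3 : z₃ = t₂ ≫ t₃ ≫ t₄ ≫ z₂ ≫ t₄ ≫ t₃ ≫ t₂ := by
    rw [← reassoc_of% h.shift₂, reassoc_of% s4, reassoc_of% s3, s2, Category.comp_id]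
  have hz4 : z₄ = t₃ ≫ t₄ ≫ t₅ ≫ z₃ ≫ t₅ ≫ t₄ ≫ t₃ := by
    rw [← reassoc_of% h.shift₃, reassoc_of% s5, reassoc_of% s4, s3, Category.comp_id]
  have e2 : z₂ = (t₁ ≫ t₂ ≫ t₃) ≫ z₁ ≫ (t₃ ≫ t₂ ≫ t₁) := by simpa only [Category.assoc] using hz2
  have e3 : z₃ = (t₂ ≫ t₃ ≫ t₄ ≫ t₁ ≫ t₂ ≫ t₃) ≫ z₁ ≫ (t₃ ≫ t₂ ≫ t₁ ≫ t₄ ≫ t₃ ≫ t₂) := by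
    rw [hz3, hz2]
    simp only [Category.assoc]
  have e4 : z₄ = (t₃ ≫ t₄ ≫ t₅ ≫ t₂ ≫ t₃ ≫ t₄ ≫ t₁ ≫ t₂ ≫ t₃) ≫ z₁ ≫ (t₃ ≫ t₂ ≫ t₁ ≫ t₄ ≫ t₃ ≫ t₂ ≫ t₅ ≫ t₄ ≫ t₃) := by
    rw [hz4, hz3, hz2]
    simp only [Category.assoc]
  -- Here it suffices that `t₅` commutes with `z₂`, which acts on the strands 2, 3, 4.
  have mA : (t₄ ≫ t₅ ≫ t₄) ≫ z₂ = ((t₅ ≫ t₄) ≫ z₂ ≫ (t₄ ≫ t₅)) ≫ (t₄ ≫ t₅ ≫ t₄) := by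
    have d : t₅ ≫ z₂ = z₂ ≫ t₅ := by
      rw [hz2]
      simp only [Category.assoc, ← h.comm₁₅, reassoc_of% h.comm₁₅, reassoc_of% h.comm₂₅, h.comm₂₅,
        reassoc_of% h.comm₃₅, reassoc_of% d5]
    simp only [Category.assoc, reassoc_of% s4, s5, Category.comp_id, ← h.braid₄₅]
    rw [d, reassoc_of% s5, reassoc_of% s4]
  have mB : (t₄ ≫ t₅ ≫ t₄ ≫ t₂ ≫ t₃ ≫ t₂ ≫ t₁ ≫ t₄) ≫ z₂ = ((t₂ ≫ t₄ ≫ t₃) ≫ z₁ ≫ (t₃ ≫ t₄ ≫ t₂)) ≫ (t₄ ≫ t₅ ≫ t₄ ≫ t₂ ≫ t₃ ≫ t₂ ≫ t₁ ≫ t₄) := by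
    refine move_conjugate (a := (t₁ ≫ t₂ ≫ t₃)) (a' := (t₃ ≫ t₂ ≫ t₁)) (w := (t₅ ≫ t₄))
      e2 ?_ ?_ ?_ ?_
    · simp only [Category.assoc, s1, s2, s3, s4, s5, Category.comp_id, reassoc_of% s1, reassoc_of% s2,
        reassoc_of% s3, reassoc_of% s4, reassoc_of% s5]
    · simp only [Category.assoc, s1, s2, s3, s4, s5, Category.comp_id, reassoc_of% s1, reassoc_of% s2,
        reassoc_of% s3, reassoc_of% s4, reassoc_of% s5]
    · simpa only [Category.assoc] using w₁
    · simp only [Category.assoc, d4, reassoc_of% d4, d5, reassoc_of% d5]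
  have mC : (t₄ ≫ t₅ ≫ t₄ ≫ t₂ ≫ t₃ ≫ t₂ ≫ t₁ ≫ t₄ ≫ t₂ ≫ t₃ ≫ t₂) ≫ z₄ = ((t₃) ≫ z₁ ≫ (t₃)) ≫ (t₄ ≫ t₅ ≫ t₄ ≫ t₂ ≫ t₃ ≫ t₂ ≫ t₁ ≫ t₄ ≫ t₂ ≫ t₃ ≫ t₂) := by
    refine move_conjugate (a := (t₃ ≫ t₄ ≫ t₅ ≫ t₂ ≫ t₃ ≫ t₄ ≫ t₁ ≫ t₂ ≫ t₃)) (a' := (t₃ ≫ t₂ ≫ t₁ ≫ t₄ ≫ t₃ ≫ t₂ ≫ t₅ ≫ t₄ ≫ t₃)) (w := (t₄ ≫ t₅ ≫ t₄))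
      e4 ?_ ?_ ?_ ?_
    · simp only [Category.assoc, s1, s2, s3, s4, s5, Category.comp_id, reassoc_of% s1, reassoc_of% s2,
        reassoc_of% s3, reassoc_of% s4, reassoc_of% s5]
    · simp only [Category.assoc, s1, s2, s3, s4, s5, Category.comp_id, reassoc_of% s1, reassoc_of% s2,
        reassoc_of% s3, reassoc_of% s4, reassoc_of% s5]
    · simpa only [Category.assoc] using w₂
    · simp only [Category.assoc, d4, reassoc_of% d4, d5, reassoc_of% d5]
  have m1 : (t₃ ≫ t₁ ≫ t₂ ≫ t₁) ≫ z₃ = ((t₂ ≫ t₄ ≫ t₃) ≫ z₁ ≫ (t₃ ≫ t₄ ≫ t₂)) ≫ (t₃ ≫ t₁ ≫ t₂ ≫ t₁) := by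
    refine move_conjugate (a := (t₂ ≫ t₃ ≫ t₄ ≫ t₁ ≫ t₂ ≫ t₃)) (a' := (t₃ ≫ t₂ ≫ t₁ ≫ t₄ ≫ t₃ ≫ t₂)) (w := (t₄))
      e3 ?_ ?_ ?_ ?_
    · simp only [Category.assoc, s1, s2, s3, s4, s5, Category.comp_id, reassoc_of% s1, reassoc_of% s2,
        reassoc_of% s3, reassoc_of% s4, reassoc_of% s5]
    · simp only [Category.assoc, s1, s2, s3, s4, s5, Category.comp_id, reassoc_of% s1, reassoc_of% s2,
        reassoc_of% s3, reassoc_of% s4, reassoc_of% s5]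
    · simpa only [Category.assoc] using w₃
    · simp only [Category.assoc, d4, reassoc_of% d4, d5, reassoc_of% d5]
  have m2 : (t₃ ≫ t₁ ≫ t₂ ≫ t₁ ≫ t₃ ≫ t₄ ≫ t₃ ≫ t₂ ≫ t₅) ≫ z₃ = ((t₅ ≫ t₄ ≫ t₁ ≫ t₂ ≫ t₃) ≫ z₁ ≫ (t₃ ≫ t₂ ≫ t₁ ≫ t₄ ≫ t₅)) ≫ (t₃ ≫ t₁ ≫ t₂ ≫ t₁ ≫ t₃ ≫ t₄ ≫ t₃ ≫ t₂ ≫ t₅) := by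
    refine move_conjugate (a := (t₂ ≫ t₃ ≫ t₄ ≫ t₁ ≫ t₂ ≫ t₃)) (a' := (t₃ ≫ t₂ ≫ t₁ ≫ t₄ ≫ t₃ ≫ t₂)) (w := (t₄ ≫ t₅))
      e3 ?_ ?_ ?_ ?_
    · simp only [Category.assoc, s1, s2, s3, s4, s5, Category.comp_id, reassoc_of% s1, reassoc_of% s2,
        reassoc_of% s3, reassoc_of% s4, reassoc_of% s5]
    · simp only [Category.assoc, s1, s2, s3, s4, s5, Category.comp_id, reassoc_of% s1, reassoc_of% s2,
        reassoc_of% s3, reassoc_of% s4, reassoc_of% s5]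
    · simpa only [Category.assoc] using w₄
    · simp only [Category.assoc, d4, reassoc_of% d4, d5, reassoc_of% d5]
  have m3 : (t₃ ≫ t₁ ≫ t₂ ≫ t₁ ≫ t₃ ≫ t₄ ≫ t₃ ≫ t₂ ≫ t₅ ≫ t₃ ≫ t₄ ≫ t₃) ≫ z₁ = z₄ ≫ (t₃ ≫ t₁ ≫ t₂ ≫ t₁ ≫ t₃ ≫ t₄ ≫ t₃ ≫ t₂ ≫ t₅ ≫ t₃ ≫ t₄ ≫ t₃) := by
    refine (move_conjugate (z := z₁) (a := 𝟙 P) (a' := 𝟙 P) (u := (t₃ ≫ t₄ ≫ t₅ ≫ t₂ ≫ t₃ ≫ t₄ ≫ t₁ ≫ t₂ ≫ t₃)) (u' := (t₃ ≫ t₂ ≫ t₁ ≫ t₄ ≫ t₃ ≫ t₂ ≫ t₅ ≫ t₄ ≫ t₃))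
      (w := (t₄ ≫ t₅ ≫ t₄)) (by simp) (by simp) ?_ ?_ ?_).trans (by rw [← e4])
    · simp only [Category.assoc, s1, s2, s3, s4, s5, Category.comp_id, reassoc_of% s1, reassoc_of% s2,
        reassoc_of% s3, reassoc_of% s4, reassoc_of% s5]
    · simpa only [Category.assoc, Category.comp_id] using w₅
    · simp only [Category.assoc, d4, reassoc_of% d4, d5, reassoc_of% d5]
  have m2' : (t₃ ≫ t₁ ≫ t₂ ≫ t₁ ≫ t₃ ≫ t₄ ≫ t₃ ≫ t₂ ≫ t₅) ≫ z₃ = ((t₅ ≫ t₄) ≫ z₂ ≫ (t₄ ≫ t₅)) ≫ (t₃ ≫ t₁ ≫ t₂ ≫ t₁ ≫ t₃ ≫ t₄ ≫ t₃ ≫ t₂ ≫ t₅) := by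
    rw [m2, e2]
    simp only [Category.assoc]
  have hL : (z₄ ≫ (t₄ ≫ t₅ ≫ t₄)) ≫ (z₂ ≫ (t₂ ≫ t₃ ≫ t₂)) ≫ t₁ ≫ t₄ ≫ (z₂ ≫ (t₂ ≫ t₃ ≫ t₂)) ≫ (z₄ ≫ (t₄ ≫ t₅ ≫ t₄)) ≫ t₃ =
      (z₄ ≫ ((t₅ ≫ t₄) ≫ z₂ ≫ (t₄ ≫ t₅)) ≫ ((t₂ ≫ t₄ ≫ t₃) ≫ z₁ ≫ (t₃ ≫ t₄ ≫ t₂)) ≫ (t₃ ≫ z₁ ≫ t₃)) ≫ (t₄ ≫ t₅ ≫ t₄ ≫ t₂ ≫ t₃ ≫ t₂ ≫ t₁ ≫ t₄ ≫ t₂ ≫ t₃ ≫ t₂ ≫ t₄ ≫ t₅ ≫ t₄ ≫ t₃) := by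
    calc
      _ = z₄ ≫ ((t₄ ≫ t₅ ≫ t₄) ≫ z₂) ≫ (t₂ ≫ t₃ ≫ t₂ ≫ t₁ ≫ t₄) ≫ z₂ ≫ (t₂ ≫ t₃ ≫ t₂) ≫ z₄ ≫ (t₄ ≫ t₅ ≫ t₄ ≫ t₃) := by
        simp only [Category.assoc]
      _ = z₄ ≫ ((t₅ ≫ t₄) ≫ z₂ ≫ (t₄ ≫ t₅)) ≫ ((t₄ ≫ t₅ ≫ t₄ ≫ t₂ ≫ t₃ ≫ t₂ ≫ t₁ ≫ t₄) ≫ z₂) ≫ (t₂ ≫ t₃ ≫ t₂) ≫ z₄ ≫ (t₄ ≫ t₅ ≫ t₄ ≫ t₃) := by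
        rw [mA]
        simp only [Category.assoc]
      _ = z₄ ≫ ((t₅ ≫ t₄) ≫ z₂ ≫ (t₄ ≫ t₅)) ≫ ((t₂ ≫ t₄ ≫ t₃) ≫ z₁ ≫ (t₃ ≫ t₄ ≫ t₂)) ≫ ((t₄ ≫ t₅ ≫ t₄ ≫ t₂ ≫ t₃ ≫ t₂ ≫ t₁ ≫ t₄ ≫ t₂ ≫ t₃ ≫ t₂) ≫ z₄) ≫ (t₄ ≫ t₅ ≫ t₄ ≫ t₃) := by
        rw [mB]
        simp only [Category.assoc]
      _ = _ := by
        rw [mC]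
        simp only [Category.assoc]
  have hR : t₃ ≫ (z₁ ≫ (t₁ ≫ t₂ ≫ t₁)) ≫ (z₃ ≫ (t₃ ≫ t₄ ≫ t₃)) ≫ t₂ ≫ t₅ ≫ (z₃ ≫ (t₃ ≫ t₄ ≫ t₃)) ≫ (z₁ ≫ (t₁ ≫ t₂ ≫ t₁)) =
      ((t₃ ≫ z₁ ≫ t₃) ≫ ((t₂ ≫ t₄ ≫ t₃) ≫ z₁ ≫ (t₃ ≫ t₄ ≫ t₂)) ≫ ((t₅ ≫ t₄) ≫ z₂ ≫ (t₄ ≫ t₅)) ≫ z₄) ≫ (t₃ ≫ t₁ ≫ t₂ ≫ t₁ ≫ t₃ ≫ t₄ ≫ t₃ ≫ t₂ ≫ t₅ ≫ t₃ ≫ t₄ ≫ t₃ ≫ t₁ ≫ t₂ ≫ t₁) := by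
    calc
      _ = (t₃ ≫ z₁ ≫ t₃) ≫ ((t₃ ≫ t₁ ≫ t₂ ≫ t₁) ≫ z₃) ≫ (t₃ ≫ t₄ ≫ t₃ ≫ t₂ ≫ t₅) ≫ z₃ ≫ (t₃ ≫ t₄ ≫ t₃) ≫ z₁ ≫ (t₁ ≫ t₂ ≫ t₁) := by
        simp only [Category.assoc, reassoc_of% s3]
      _ = (t₃ ≫ z₁ ≫ t₃) ≫ ((t₂ ≫ t₄ ≫ t₃) ≫ z₁ ≫ (t₃ ≫ t₄ ≫ t₂)) ≫ ((t₃ ≫ t₁ ≫ t₂ ≫ t₁ ≫ t₃ ≫ t₄ ≫ t₃ ≫ t₂ ≫ t₅) ≫ z₃) ≫ (t₃ ≫ t₄ ≫ t₃) ≫ z₁ ≫ (t₁ ≫ t₂ ≫ t₁) := by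
        rw [m1]
        simp only [Category.assoc]
      _ = (t₃ ≫ z₁ ≫ t₃) ≫ ((t₂ ≫ t₄ ≫ t₃) ≫ z₁ ≫ (t₃ ≫ t₄ ≫ t₂)) ≫ ((t₅ ≫ t₄) ≫ z₂ ≫ (t₄ ≫ t₅)) ≫ ((t₃ ≫ t₁ ≫ t₂ ≫ t₁ ≫ t₃ ≫ t₄ ≫ t₃ ≫ t₂ ≫ t₅ ≫ t₃ ≫ t₄ ≫ t₃) ≫ z₁) ≫ (t₁ ≫ t₂ ≫ t₁) := by
        rw [m2']
        simp only [Category.assoc]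
      _ = _ := by
        rw [m3]
        simp only [Category.assoc]
  -- By `w₆` both sides end with the same word in the `t`'s, an isomorphism, which cancels.
  rw [hL, hR, ← w₆]
  have i1 : IsIso t₁ := ⟨t₁, s1, s1⟩
  have i2 : IsIso t₂ := ⟨t₂, s2, s2⟩
  have i3 : IsIso t₃ := ⟨t₃, s3, s3⟩
  have i4 : IsIso t₄ := ⟨t₄, s4, s4⟩
  have i5 : IsIso t₅ := ⟨t₅, s5, s5⟩
  exact cancel_mono _

end Words

end TetrahedronWords

/-! ### The strand relations for powers of `B`, and the tetrahedron equation. -/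

section TetrahedronStrands

variable {E : Type u} [Category.{v} E] [MonoidalCategory E] {B : E}

lemma first2_comp (f g : B ⊗ B ⟶ B ⊗ B) (P : E) :
    first2 f P ≫ first2 g P = first2 (f ≫ g) P := by
  simp [first2]

lemma first2_id (P : E) : first2 (𝟙 (B ⊗ B)) P = 𝟙 _ := by
  simp [first2]

lemma first2_naturality (f : B ⊗ B ⟶ B ⊗ B) {P Q : E} (g : P ⟶ Q) :
    B ◁ B ◁ g ≫ first2 f Q = first2 f P ≫ B ◁ B ◁ g := by
  simp only [first2, Category.assoc]
  rw [associator_inv_naturality_right_assoc, whisker_exchange_assoc, associator_naturality_right]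

lemma first3_comp (f g : B ⊗ (B ⊗ B) ⟶ B ⊗ (B ⊗ B)) (P : E) :
    first3 f P ≫ first3 g P = first3 (f ≫ g) P := by
  simp [first3, ← MonoidalCategory.whiskerLeft_comp_assoc]

lemma first3_naturality (f : B ⊗ (B ⊗ B) ⟶ B ⊗ (B ⊗ B)) {P Q : E} (g : P ⟶ Q) :
    B ◁ B ◁ B ◁ g ≫ first3 f Q = first3 f P ≫ B ◁ B ◁ B ◁ g := by
  have h1 : B ◁ B ◁ B ◁ g ≫ B ◁ (α_ B B Q).inv ≫ (α_ B (B ⊗ B) Q).inv =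
      (B ◁ (α_ B B P).inv ≫ (α_ B (B ⊗ B) P).inv) ≫ (B ⊗ (B ⊗ B)) ◁ g := by monoidal
  have h2 : (B ⊗ (B ⊗ B)) ◁ g ≫ (α_ B (B ⊗ B) Q).hom ≫ B ◁ (α_ B B Q).hom =
      ((α_ B (B ⊗ B) P).hom ≫ B ◁ (α_ B B P).hom) ≫ B ◁ B ◁ B ◁ g := by monoidal
  simp only [first3, Category.assoc]
  rw [reassoc_of% h1, whisker_exchange_assoc, h2]
  simp only [Category.assoc]

lemma first3_first2 (f : B ⊗ B ⟶ B ⊗ B) (P : E) : first3 (first2 f B) P = first2 f (B ⊗ P) := by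
  simp only [first3, first2]
  monoidal

lemma first3_whiskerLeft (f : B ⊗ B ⟶ B ⊗ B) (P : E) : first3 (B ◁ f) P = B ◁ first2 f P := by
  simp only [first3, first2]
  monoidal

/-- An endomorphism acting on the first four factors. -/
def first4 (f : B ⊗ (B ⊗ (B ⊗ B)) ⟶ B ⊗ (B ⊗ (B ⊗ B))) (P : E) :
    B ⊗ (B ⊗ (B ⊗ (B ⊗ P))) ⟶ B ⊗ (B ⊗ (B ⊗ (B ⊗ P))) :=
  B ◁ B ◁ (α_ B B P).inv ≫ B ◁ (α_ B (B ⊗ B) P).inv ≫ (α_ B (B ⊗ (B ⊗ B)) P).inv ≫ f ▷ P ≫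
    (α_ B (B ⊗ (B ⊗ B)) P).hom ≫ B ◁ (α_ B (B ⊗ B) P).hom ≫ B ◁ B ◁ (α_ B B P).hom

lemma first4_comp (f g : B ⊗ (B ⊗ (B ⊗ B)) ⟶ B ⊗ (B ⊗ (B ⊗ B))) (P : E) :
    first4 f P ≫ first4 g P = first4 (f ≫ g) P := by
  simp only [first4]
  monoidal

lemma first4_first2 (f : B ⊗ B ⟶ B ⊗ B) (P : E) :
    first4 (first2 f (B ⊗ B)) P = first2 f (B ⊗ (B ⊗ P)) := by
  simp only [first4, first2]
  monoidal

lemma first4_first3 (f : B ⊗ (B ⊗ B) ⟶ B ⊗ (B ⊗ B)) (P : E) :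
    first4 (first3 f B) P = first3 f (B ⊗ P) := by
  simp only [first4, first3]
  monoidal

lemma first4_whiskerLeft (f : B ⊗ (B ⊗ B) ⟶ B ⊗ (B ⊗ B)) (P : E) :
    first4 (B ◁ f) P = B ◁ first3 f P := by
  simp only [first4, first3]
  monoidal

section

variable (t : HalfBraiding B)

/-- The Yang–Baxter equation for a half-braiding. -/
lemma yangBaxter :
    B ◁ (t.β B).hom ≫ first2 (t.β B).hom B ≫ B ◁ (t.β B).hom =
      first2 (t.β B).hom B ≫ B ◁ (t.β B).hom ≫ first2 (t.β B).hom B := by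
  have h := t.naturality (t.β B).hom
  rw [t.monoidal] at h
  have h2 := congrArg (· ≫ (α_ B B B).hom) h
  simpa [first2] using h2

/-- Naturality of the half-braiding at `Z`, with the component at `B ⊗ (B ⊗ B)` expanded by
multiplicativity: a strand passes the three strands of `Z` one at a time. -/
lemma shift_four (Z : B ⊗ (B ⊗ B) ⟶ B ⊗ (B ⊗ B)) :
    B ◁ Z ≫ first2 (t.β B).hom (B ⊗ B) ≫ B ◁ first2 (t.β B).hom B ≫ B ◁ B ◁ (t.β B).hom =
      first2 (t.β B).hom (B ⊗ B) ≫ B ◁ first2 (t.β B).hom B ≫ B ◁ B ◁ (t.β B).hom ≫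
        first3 Z B := by
  have h := t.naturality Z
  rw [t.monoidal, t.monoidal] at h
  have h2 := congrArg (· ≫ (α_ B (B ⊗ B) B).hom ≫ B ◁ (α_ B B B).hom) h
  have h3 : first2 (t.β B).hom (B ⊗ B) ≫ B ◁ first2 (t.β B).hom B ≫ B ◁ B ◁ (t.β B).hom =
      ((α_ B B (B ⊗ B)).inv ≫ (t.β B).hom ▷ (B ⊗ B) ≫ (α_ B B (B ⊗ B)).hom ≫
        B ◁ ((α_ B B B).inv ≫ (t.β B).hom ▷ B ≫ (α_ B B B).hom ≫ B ◁ (t.β B).hom ≫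
          (α_ B B B).inv) ≫ (α_ B (B ⊗ B) B).inv) ≫
            (α_ B (B ⊗ B) B).hom ≫ B ◁ (α_ B B B).hom := by
    simp only [first2]
    monoidal
  rw [h3]
  simp only [Category.assoc] at h2 ⊢
  rw [h2]
  simp only [first3, first2]
  monoidal

/-- `τ` on the factors 1, 2 of the sixth tensor power. -/
def t1 (τ : B ⊗ B ⟶ B ⊗ B) : pow6 B ⟶ pow6 B := first2 τ (B ⊗ (B ⊗ (B ⊗ B)))

variable {t}

/-- The relations come from at most four strands; `first3` and `first4` add strands on the right,
whiskering adds them on the left. -/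
lemma sixStrands (ht : (t.β B).hom ≫ (t.β B).hom = 𝟙 _) (Z : B ⊗ (B ⊗ B) ⟶ B ⊗ (B ⊗ B)) :
    SixStrands (t1 (t.β B).hom) (t2 (t.β B).hom) (t3 (t.β B).hom) (t4 (t.β B).hom)
      (t5 (t.β B).hom) (first3 Z (B ⊗ (B ⊗ B))) (B ◁ first3 Z (B ⊗ B)) (B ◁ B ◁ first3 Z B)
      (Z456 Z) := by
  have hy := yangBaxter t
  have hs := shift_four t Z
  set τ := (t.β B).hom
  have hsq : ∀ P : E, first2 τ P ≫ first2 τ P = 𝟙 _ := fun P => by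
    rw [first2_comp, ht, first2_id]
  have hy' : ∀ P : E, B ◁ first2 τ P ≫ first2 τ (B ⊗ P) ≫ B ◁ first2 τ P =
      first2 τ (B ⊗ P) ≫ B ◁ first2 τ P ≫ first2 τ (B ⊗ P) := fun P => by
    simpa only [← first3_comp, first3_first2, first3_whiskerLeft] using congrArg (first3 · P) hy
  have hs' : ∀ P : E, B ◁ first3 Z P ≫ first2 τ (B ⊗ (B ⊗ P)) ≫ B ◁ first2 τ (B ⊗ P) ≫
      B ◁ B ◁ first2 τ P = first2 τ (B ⊗ (B ⊗ P)) ≫ B ◁ first2 τ (B ⊗ P) ≫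
      B ◁ B ◁ first2 τ P ≫ first3 Z (B ⊗ P) := fun P => by
    simpa only [← first4_comp, first4_first2, first4_first3, first4_whiskerLeft,
      first3_first2, first3_whiskerLeft] using congrArg (first4 · P) hs
  constructor
  · constructor
    · exact hsq _
    · simp only [t2, ← MonoidalCategory.whiskerLeft_comp, hsq, MonoidalCategory.whiskerLeft_id]
    · simp only [t3, ← MonoidalCategory.whiskerLeft_comp, hsq, MonoidalCategory.whiskerLeft_id]
    · simp only [t4, ← MonoidalCategory.whiskerLeft_comp, hsq, MonoidalCategory.whiskerLeft_id]
    · simp only [t5, ← MonoidalCategory.whiskerLeft_comp, ht, MonoidalCategory.whiskerLeft_id]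
    · exact first2_naturality _ _
    · exact first2_naturality _ _
    · exact first2_naturality _ _
    · simp only [t2, t4, ← MonoidalCategory.whiskerLeft_comp, first2_naturality]
    · simp only [t2, t5, ← MonoidalCategory.whiskerLeft_comp, first2_naturality]
    · simp only [t3, t5, ← MonoidalCategory.whiskerLeft_comp, first2_naturality]
    · exact hy' _
    · simp only [t2, t3, ← MonoidalCategory.whiskerLeft_comp, hy']
    · simp only [t3, t4, ← MonoidalCategory.whiskerLeft_comp, hy']
    · simp only [t4, t5, ← MonoidalCategory.whiskerLeft_comp, hy]
  · exact first3_naturality _ _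
  · exact first3_naturality _ _
  · exact hs' _
  · simpa only [MonoidalCategory.whiskerLeft_comp, t2, t3, t4] using congrArg (B ◁ ·) (hs' _)
  · simpa only [MonoidalCategory.whiskerLeft_comp, t3, t4, t5, Z456] using
      congrArg (fun f => B ◁ B ◁ f) hs

open WeakBStructure in
/-- The permutohedron equation for `S = Z ≫ t₁ t₂ t₁` is equivalent to the tetrahedron equation
for `Z`. -/
lemma permutohedron_iff_tetrahedron (ht : (t.β B).hom ≫ (t.β B).hom = 𝟙 _)
    (Z S : B ⊗ (B ⊗ B) ⟶ B ⊗ (B ⊗ B)) (hS : S = Z ≫ (reversal (t.β B)).hom) :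
    Z456 S ≫ B ◁ first3 S (B ⊗ B) ≫ t1 (t.β B).hom ≫ t4 (t.β B).inv ≫
        B ◁ first3 S (B ⊗ B) ≫ Z456 S ≫ t3 (t.β B).hom =
      t3 (t.β B).inv ≫ first3 S (B ⊗ (B ⊗ B)) ≫ B ◁ B ◁ first3 S B ≫ t2 (t.β B).hom ≫
        t5 (t.β B).inv ≫ B ◁ B ◁ first3 S B ≫ first3 S (B ⊗ (B ⊗ B)) ↔
    TetrahedronEq (t.β B).hom Z := by
  have hinv : (t.β B).inv = (t.β B).hom := by
    rw [← cancel_epi (t.β B).hom, Iso.hom_inv_id, ht]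
  have hr : (reversal (t.β B)).hom =
      first2 (t.β B).hom B ≫ B ◁ (t.β B).hom ≫ first2 (t.β B).hom B := rfl
  have h := (sixStrands ht Z).permutohedron_iff
  have h1 : first3 S (B ⊗ (B ⊗ B)) = first3 Z (B ⊗ (B ⊗ B)) ≫ t1 (t.β B).hom ≫ t2 (t.β B).hom ≫
      t1 (t.β B).hom := by
    rw [hS, hr, ← first3_comp, ← first3_comp, ← first3_comp, first3_first2, first3_whiskerLeft]
    rfl
  have h2 : B ◁ first3 S (B ⊗ B) = B ◁ first3 Z (B ⊗ B) ≫ t2 (t.β B).hom ≫ t3 (t.β B).hom ≫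
      t2 (t.β B).hom := by
    rw [hS, hr, ← first3_comp, ← first3_comp, ← first3_comp, first3_first2, first3_whiskerLeft]
    simp only [t2, t3, MonoidalCategory.whiskerLeft_comp]
  have h3 : B ◁ B ◁ first3 S B = B ◁ B ◁ first3 Z B ≫ t3 (t.β B).hom ≫ t4 (t.β B).hom ≫
      t3 (t.β B).hom := by
    rw [hS, hr, ← first3_comp, ← first3_comp, ← first3_comp, first3_first2, first3_whiskerLeft]
    simp only [t3, t4, MonoidalCategory.whiskerLeft_comp]
  have h4 : Z456 S = Z456 Z ≫ t4 (t.β B).hom ≫ t5 (t.β B).hom ≫ t4 (t.β B).hom := by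
    rw [hS, hr]
    simp only [Z456, t4, t5, MonoidalCategory.whiskerLeft_comp]
  rw [hinv, h1, h2, h3, h4]
  exact h

end

end TetrahedronStrands

/-! ### Strong transformations and cells in `E` determine each other. -/

section TransformationCells

variable {E : Type u} [Category.{v} E] [MonoidalCategory E]

/-- Compatibility with composition is preserved by conjugation with isomorphisms. -/
lemma comp_conj {B P₀ P₁ P₂ Q₀ Q₁ Q₂ P₀' P₁' P₂' Q₀' Q₁' Q₂' : E} (a₀ : P₀ ≅ P₀') (a₁ : P₁ ≅ P₁')
    (a₂ : P₂ ≅ P₂') (b₀ : Q₀ ≅ Q₀') (b₁ : Q₁ ≅ Q₁') (b₂ : Q₂ ≅ Q₂') {ν₀ : P₀ ⊗ B ⟶ B ⊗ Q₀}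
    {ν₁ : P₁ ⊗ B ⟶ B ⊗ Q₁} {ν₂ : P₂ ⊗ B ⟶ B ⊗ Q₂} {m : P₀ ⟶ P₁ ⊗ P₂} {n : Q₀ ⟶ Q₁ ⊗ Q₂}
    {m' : P₀' ⟶ P₁' ⊗ P₂'} {n' : Q₀' ⟶ Q₁' ⊗ Q₂'} (hm : m ≫ (a₁.hom ⊗ₘ a₂.hom) = a₀.hom ≫ m')
    (hn : n ≫ (b₁.hom ⊗ₘ b₂.hom) = b₀.hom ≫ n')
    (h : ν₀ ≫ B ◁ n = m ▷ B ≫ (α_ _ _ _).hom ≫ P₁ ◁ ν₂ ≫ (α_ _ _ _).inv ≫ ν₁ ▷ Q₂ ≫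
      (α_ _ _ _).hom) :
    (a₀.inv ▷ B ≫ ν₀ ≫ B ◁ b₀.hom) ≫ B ◁ n' = m' ▷ B ≫ (α_ _ _ _).hom ≫
      P₁' ◁ (a₂.inv ▷ B ≫ ν₂ ≫ B ◁ b₂.hom) ≫ (α_ _ _ _).inv ≫
        (a₁.inv ▷ B ≫ ν₁ ≫ B ◁ b₁.hom) ▷ Q₂' ≫ (α_ _ _ _).hom := by
  have hm' : m' = a₀.inv ≫ m ≫ (a₁.hom ⊗ₘ a₂.hom) := by rw [hm, Iso.inv_hom_id_assoc]
  have h1 : ∀ {R S : E} (f : R ⟶ B ⊗ S), a₁.hom ▷ R ≫ P₁' ◁ f ≫ (α_ _ _ _).inv ≫ a₁.inv ▷ B ▷ S =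
      P₁ ◁ f ≫ (α_ _ _ _).inv := by
    intro R S f
    rw [← whisker_exchange_assoc]
    simp
  rw [Category.assoc, Category.assoc, ← MonoidalCategory.whiskerLeft_comp, ← hn,
    MonoidalCategory.whiskerLeft_comp, reassoc_of% h, hm', MonoidalCategory.tensorHom_def', tensorHom_def']
  simp only [comp_whiskerRight, Category.assoc]
  rw [associator_naturality_left_assoc, reassoc_of% h1]
  have h2 : P₁ ◁ B ◁ b₂.hom ≫ (α_ _ _ _).inv ≫ ν₁ ▷ Q₂' =
      (α_ _ _ _).inv ≫ ν₁ ▷ Q₂ ≫ (B ⊗ Q₁) ◁ b₂.hom := by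
    rw [associator_inv_naturality_right_assoc, whisker_exchange]
  simp [reassoc_of% h2]

section Triple

variable {T : TensorProduct (MonoidalSingleObj E)} (u : UnitIdent T)

lemma pair_rIso (X : E) : (pair u X (𝟙_ E)).hom ≫ (u.rIso X).hom = (ρ_ X).hom := by
  have h := tensMul_unit_right T X (𝟙_ E)
  have h1 := rightUnitor_naturality (u.rIso X).inv
  rw [pair_hom, lIso_unit, MonoidalCategory.tensorHom_def, unitors_equal]
  simp only [Category.assoc]
  rw [reassoc_of% h, reassoc_of% h1]
  simp

lemma pair_lIso (X : E) : (pair u (𝟙_ E) X).hom ≫ (u.lIso X).hom = (λ_ X).hom := by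
  have h := tensMul_unit_left T (𝟙_ E) X
  have h1 := leftUnitor_naturality (u.lIso X).inv
  rw [pair_hom, rIso_unit, MonoidalCategory.tensorHom_def', ← unitors_equal]
  simp only [Category.assoc]
  rw [reassoc_of% h, reassoc_of% h1]
  simp

/-- The isomorphism between threefold tensor products in `E` and in the bicategory. -/
def triple (X Y Z : E) : X ⊗ (Y ⊗ Z) ≅ tens T X (tens T Y Z) :=
  whiskerLeftIso X (pair u Y Z) ≪≫ pair u X (tens T Y Z)

lemma triple_hom (X Y Z : E) :
    (triple u X Y Z).hom = X ◁ (pair u Y Z).hom ≫ (pair u X (tens T Y Z)).hom := rfl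

lemma triple_naturality {X X' Y Y' Z Z' : E} (f : X ⟶ X') (g : Y ⟶ Y') (h : Z ⟶ Z') :
    (f ⊗ₘ (g ⊗ₘ h)) ≫ (triple u X' Y' Z').hom =
      (triple u X Y Z).hom ≫ tensHom T f (tensHom T g h) := by
  have h1 := pair_naturality u f (tensHom T g h)
  rw [triple_hom, triple_hom, Category.assoc, ← h1, ← id_tensorHom, ← id_tensorHom,
    tensorHom_comp_tensorHom_assoc, tensorHom_comp_tensorHom_assoc, pair_naturality u g h,
    Category.comp_id, Category.id_comp]

lemma triple_inv_naturality {X X' Y Y' Z Z' : E} (f : X ⟶ X') (g : Y ⟶ Y') (h : Z ⟶ Z') :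
    tensHom T f (tensHom T g h) ≫ (triple u X' Y' Z').inv =
      (triple u X Y Z).inv ≫ (f ⊗ₘ (g ⊗ₘ h)) := by
  rw [Iso.comp_inv_eq, Category.assoc, triple_naturality, Iso.inv_hom_id_assoc]

/-- Through this and its two companions the cells at `(X,1,1)`, `(1,X,1)`, `(1,1,X)` become the
isomorphisms `halfBraiding1`, `halfBraiding2`, `halfBraiding3`. -/
lemma triple_eq_unit₁ (X : E) : triple u X (𝟙_ E) (𝟙_ E) = unit₁ X ≪≫ (u.iso1 X).symm := by
  ext
  have h := pair_naturality u (𝟙 X) (u.lIso (𝟙_ E)).hom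
  rw [Iso.trans_hom, Iso.symm_hom, Iso.eq_comp_inv, UnitIdent.iso1, Iso.trans_hom, tensIso_hom,
    Iso.refl_hom, triple_hom, Category.assoc, ← reassoc_of% h, pair_rIso, id_tensorHom,
    ← MonoidalCategory.whiskerLeft_comp_assoc, pair_lIso, unit₁_hom]

lemma triple_eq_unit₂ (X : E) : triple u (𝟙_ E) X (𝟙_ E) = unit₂ X ≪≫ (u.iso2 X).symm := by
  ext
  have h := pair_lIso u (tens T X (𝟙_ E))
  rw [Iso.trans_hom, Iso.symm_hom, Iso.eq_comp_inv, UnitIdent.iso2, Iso.trans_hom, triple_hom,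
    Category.assoc, reassoc_of% h, leftUnitor_naturality_assoc, pair_rIso, unit₂_hom]

lemma triple_eq_unit₃ (X : E) : triple u (𝟙_ E) (𝟙_ E) X = unit₃ X ≪≫ (u.iso3 X).symm := by
  ext
  have h := pair_lIso u (tens T (𝟙_ E) X)
  rw [Iso.trans_hom, Iso.symm_hom, Iso.eq_comp_inv, UnitIdent.iso3, Iso.trans_hom, triple_hom,
    Category.assoc, reassoc_of% h, leftUnitor_naturality_assoc, pair_lIso, unit₃_hom]

variable (T) in
/-- The composition constraint of the threefold tensor product. -/
def tensMul₃ (X X' Y Y' Z Z' : E) : tens T X (tens T Y Z) ⊗ tens T X' (tens T Y' Z') ≅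
    tens T (X ⊗ X') (tens T (Y ⊗ Y') (Z ⊗ Z')) :=
  tensMul T X (tens T Y Z) X' (tens T Y' Z') ≪≫ tensIso (Iso.refl _) (tensMul T Y Z Y' Z')

variable (T) in
/-- The unit constraint of the threefold tensor product. -/
def tensUnit₃ : tens T (𝟙_ E) (tens T (𝟙_ E) (𝟙_ E)) ≅ 𝟙_ E :=
  tensIso (Iso.refl _) (tensUnit T) ≪≫ tensUnit T

lemma tensUnit₃_eq : tensUnit₃ T = u.iso3 (𝟙_ E) := by
  ext
  have h := lIso_naturality u (u.lIso (𝟙_ E)).hom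
  rw [UnitIdent.iso3, Iso.trans_hom, ← h, tensUnit₃, Iso.trans_hom, lIso_unit]
  rfl

variable [BraidedCategory E]

lemma pair_tensMul_inv (hu : ∀ X Y : E, β_ X Y = (swapIso u X Y).symm) (X Y X' Y' : E) :
    (pair u (X ⊗ X') (Y ⊗ Y')).hom ≫ (tensMul T X Y X' Y').inv =
      tensorμ X X' Y Y' ≫ ((pair u X Y).hom ⊗ₘ (pair u X' Y').hom) := by
  rw [Iso.comp_inv_eq, Category.assoc, pair_tensMul u hu, tensorμ_tensorδ_assoc]

/-- `pair_tensMul_inv` is applied once to the outer and once to the inner tensor product. This turns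
the composition axiom of a strong transformation into the one of `Cells`. -/
lemma triple_tensMul₃_inv (hu : ∀ X Y : E, β_ X Y = (swapIso u X Y).symm) (X X' Y Y' Z Z' : E) :
    (triple u (X ⊗ X') (Y ⊗ Y') (Z ⊗ Z')).hom ≫ (tensMul₃ T X X' Y Y' Z Z').inv =
      tensorμ₃ X X' Y Y' Z Z' ≫ ((triple u X Y Z).hom ⊗ₘ (triple u X' Y' Z').hom) := by
  have h1 := pair_naturality u (𝟙 (X ⊗ X')) (tensMul T Y Z Y' Z').inv
  have h2 := pair_tensMul_inv u hu X (tens T Y Z) X' (tens T Y' Z')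
  have h3 := tensorμ_natural (𝟙 X) (𝟙 X') (pair u Y Z).hom (pair u Y' Z').hom
  rw [id_tensorHom] at h1
  rw [id_tensorHom_id, id_tensorHom, id_tensorHom, id_tensorHom] at h3
  rw [tensMul₃, Iso.trans_inv, tensIso_inv, Iso.refl_inv, triple_hom, Category.assoc,
    ← reassoc_of% h1, h2, ← MonoidalCategory.whiskerLeft_comp_assoc, pair_tensMul_inv u hu,
    MonoidalCategory.whiskerLeft_comp_assoc, reassoc_of% h3, tensorHom_comp_tensorHom, tensorμ₃,
    Category.assoc]
  rfl

lemma triple_inv_tensMul₃ (hu : ∀ X Y : E, β_ X Y = (swapIso u X Y).symm) (X X' Y Y' Z Z' : E) :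
    (tensMul₃ T X X' Y Y' Z Z').inv ≫ ((triple u X Y Z).inv ⊗ₘ (triple u X' Y' Z').inv) =
      (triple u (X ⊗ X') (Y ⊗ Y') (Z ⊗ Z')).inv ≫ tensorμ₃ X X' Y Y' Z Z' := by
  rw [Iso.eq_inv_comp, reassoc_of% (triple_tensMul₃_inv u hu)]
  simp

end Triple

section StrongTrans

variable {T : TensorProduct (MonoidalSingleObj E)} (β : Pseudofunctor.StrongTrans (tensor3 T) (tensor3Swap T))

/-- The pseudo-naturality cell of `β` as an isomorphism in `E`. -/
def bNatIso (X Y Z : E) : tens T X (tens T Y Z) ⊗ bObj β ≅ bObj β ⊗ tens T Y (tens T X Z) :=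
  (bCell β X Y Z).symm

lemma bNatIso_naturality {X X' Y Y' Z Z' : E} (f : X ⟶ X') (g : Y ⟶ Y') (h : Z ⟶ Z') :
    tensHom T f (tensHom T g h) ▷ bObj β ≫ (bNatIso β X' Y' Z').hom =
      (bNatIso β X Y Z).hom ≫ bObj β ◁ tensHom T g (tensHom T f h) :=
  β.naturality_naturality (a := (.star E, (.star E, .star E))) (b := (.star E, (.star E, .star E)))
    (f := (X, (Y, Z))) (g := (X', (Y', Z'))) (f, (g, h))

lemma bNatIso_comp (X X' Y Y' Z Z' : E) :
    (bNatIso β (X ⊗ X') (Y ⊗ Y') (Z ⊗ Z')).hom ≫ bObj β ◁ (tensMul₃ T Y Y' X X' Z Z').inv =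
      (tensMul₃ T X X' Y Y' Z Z').inv ▷ bObj β ≫ (α_ _ _ _).hom ≫
        tens T X (tens T Y Z) ◁ (bNatIso β X' Y' Z').hom ≫ (α_ _ _ _).inv ≫
          (bNatIso β X Y Z).hom ▷ tens T Y' (tens T X' Z') ≫ (α_ _ _ _).hom := by
  have h := β.naturality_comp (a := (.star E, (.star E, .star E)))
    (b := (.star E, (.star E, .star E))) (c := (.star E, (.star E, .star E)))
    (X, (Y, Z)) (X', (Y', Z'))
  -- The extra identity factor is the trivial composition constraint of `swapFirst`.
  have h' : (bNatIso β (X ⊗ X') (Y ⊗ Y') (Z ⊗ Z')).hom ≫ bObj β ◁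
      (tensHom T (𝟙 _) (tensHom T (𝟙 _) (𝟙 _)) ≫ (tensMul₃ T Y Y' X X' Z Z').inv) =
    (tensMul₃ T X X' Y Y' Z Z').inv ▷ bObj β ≫ (α_ _ _ _).hom ≫
        tens T X (tens T Y Z) ◁ (bNatIso β X' Y' Z').hom ≫ (α_ _ _ _).inv ≫
          (bNatIso β X Y Z).hom ▷ tens T Y' (tens T X' Z') ≫ (α_ _ _ _).hom := h
  simpa using h'

variable (u : UnitIdent T)

section

variable [BraidedCategory E] (hu : ∀ X Y : E, β_ X Y = (swapIso u X Y).symm)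

/-- The cells in `E` given by the pseudo-naturality cells of `β`. -/
def cellsOfStrongTrans : Cells (bObj β) where
  σ X Y Z := whiskerRightIso (triple u X Y Z) _ ≪≫ bNatIso β X Y Z ≪≫
    whiskerLeftIso _ (triple u Y X Z).symm
  naturality f g h := by
    simp only [Iso.trans_hom, whiskerRightIso_hom, whiskerLeftIso_hom, Iso.symm_hom, Category.assoc]
    rw [← comp_whiskerRight_assoc, triple_naturality, ← MonoidalCategory.whiskerLeft_comp,
      ← triple_inv_naturality, MonoidalCategory.whiskerLeft_comp, comp_whiskerRight_assoc,
      reassoc_of% (bNatIso_naturality β)]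
  comp X X' Y Y' Z Z' := by
    exact comp_conj (triple u _ _ _).symm (triple u _ _ _).symm (triple u _ _ _).symm
      (triple u _ _ _).symm (triple u _ _ _).symm (triple u _ _ _).symm
      (triple_inv_tensMul₃ u hu _ _ _ _ _ _) (triple_inv_tensMul₃ u hu _ _ _ _ _ _)
      (bNatIso_comp β X X' Y Y' Z Z')

lemma cellsOfStrongTrans_hom (X Y Z : E) : ((cellsOfStrongTrans β u hu).σ X Y Z).hom =
    (triple u X Y Z).hom ▷ _ ≫ (bNatIso β X Y Z).hom ≫ _ ◁ (triple u Y X Z).inv := rfl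

lemma cellsOfStrongTrans_isGeneratedBy (h1 : halfBraiding1 u β = halfBraiding3 u β)
    (h2 : halfBraiding2 u β = halfBraiding3 u β) :
    (cellsOfStrongTrans β u hu).IsGeneratedBy (halfBraiding3 u β) where
  cell₁ X := by
    rw [← h1, cellsOfStrongTrans_hom, triple_eq_unit₁, triple_eq_unit₂]
    simp [halfBraiding1, bNatIso]
  cell₂ X := by
    rw [← h2, cellsOfStrongTrans_hom, triple_eq_unit₁, triple_eq_unit₂]
    simp [halfBraiding2, bNatIso]
  cell₃ X := by
    rw [cellsOfStrongTrans_hom, triple_eq_unit₃]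
    simp [halfBraiding3, bNatIso]

variable {B : E} (c : Cells B)

/-- The isomorphisms of the threefold tensor products of the bicategory given by cells in `E`. -/
def Cells.nat (X Y Z : E) : tens T X (tens T Y Z) ⊗ B ≅ B ⊗ tens T Y (tens T X Z) :=
  whiskerRightIso (triple u X Y Z).symm _ ≪≫ c.σ X Y Z ≪≫ whiskerLeftIso _ (triple u Y X Z)

lemma Cells.nat_hom (X Y Z : E) : (c.nat u X Y Z).hom =
    (triple u X Y Z).inv ▷ B ≫ (c.σ X Y Z).hom ≫ B ◁ (triple u Y X Z).hom := rfl

/-- A strong transformation given by cells in `E`. -/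
def Cells.strongTrans (hc : (c.σ (𝟙_ E) (𝟙_ E) (𝟙_ E)).hom = (unit₃ (𝟙_ E)).hom ▷ B ≫ (λ_ B).hom ≫
    (ρ_ B).inv ≫ B ◁ (unit₃ (𝟙_ E)).inv) :
    Pseudofunctor.StrongTrans (tensor3 T) (tensor3Swap T) where
  app _ := B
  naturality f := c.nat u f.1 f.2.1 f.2.2
  naturality_naturality {_ _ f g} η := by
    have h : tensHom T η.1 (tensHom T η.2.1 η.2.2) ▷ B ≫ (c.nat u g.1 g.2.1 g.2.2).hom =
      (c.nat u f.1 f.2.1 f.2.2).hom ≫ B ◁ tensHom T η.2.1 (tensHom T η.1 η.2.2) := by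
      rw [Cells.nat_hom, Cells.nat_hom, ← comp_whiskerRight_assoc, triple_inv_naturality,
        Category.assoc, Category.assoc, ← MonoidalCategory.whiskerLeft_comp, ← triple_naturality,
        MonoidalCategory.whiskerLeft_comp, comp_whiskerRight_assoc, reassoc_of% c.naturality]
    exact h
  naturality_id _ := by
    have h : (c.nat u (𝟙_ E) (𝟙_ E) (𝟙_ E)).hom ≫ B ◁
        (tensHom T (𝟙 _) (tensHom T (𝟙 _) (𝟙 _)) ≫ (tensUnit₃ T).hom) =
        (tensUnit₃ T).hom ▷ B ≫ (λ_ _).hom ≫ (ρ_ _).inv := by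
      rw [Cells.nat_hom, hc, tensUnit₃_eq u, triple_eq_unit₃]
      simp [← MonoidalCategory.whiskerLeft_comp]
    exact h
  naturality_comp f g := by
    have h : (c.nat u (f.1 ⊗ g.1) (f.2.1 ⊗ g.2.1) (f.2.2 ⊗ g.2.2)).hom ≫ B ◁
      (tensHom T (𝟙 _) (tensHom T (𝟙 _) (𝟙 _)) ≫
        (tensMul₃ T f.2.1 g.2.1 f.1 g.1 f.2.2 g.2.2).inv) =
      (tensMul₃ T f.1 g.1 f.2.1 g.2.1 f.2.2 g.2.2).inv ▷ B ≫ (α_ _ _ _).hom ≫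
        tens T f.1 (tens T f.2.1 f.2.2) ◁ (c.nat u g.1 g.2.1 g.2.2).hom ≫ (α_ _ _ _).inv ≫
          (c.nat u f.1 f.2.1 f.2.2).hom ▷ tens T g.2.1 (tens T g.1 g.2.2) ≫ (α_ _ _ _).hom := by
      rw [tensHom_id, tensHom_id, Category.id_comp]
      exact comp_conj (triple u _ _ _) (triple u _ _ _) (triple u _ _ _)
        (triple u _ _ _) (triple u _ _ _) (triple u _ _ _)
        (triple_tensMul₃_inv u hu _ _ _ _ _ _).symm (triple_tensMul₃_inv u hu _ _ _ _ _ _).symm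
        (c.comp _ _ _ _ _ _)
    exact h

lemma cellsOfStrongTrans_strongTrans (hc) (X Y Z : E) :
    ((cellsOfStrongTrans (c.strongTrans u hu hc) u hu).σ X Y Z).hom = (c.σ X Y Z).hom := by
  have h : (triple u X Y Z).hom ▷ B ≫ (c.nat u X Y Z).hom ≫ B ◁ (triple u Y X Z).inv =
      (c.σ X Y Z).hom := by
    rw [Cells.nat_hom]
    simp
  exact h

/-- The remaining fields of a strong transformation are propositions, so it suffices to compare the
cells, and conjugation by `triple` loses nothing. -/
lemma Cells.strongTrans_eq (c : Cells (bObj β)) (hc)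
    (h : ∀ X Y Z, (c.σ X Y Z).hom = ((cellsOfStrongTrans β u hu).σ X Y Z).hom) :
    c.strongTrans u hu hc = β := by
  have h1 : ∀ X Y Z, c.nat u X Y Z = bNatIso β X Y Z := by
    intro X Y Z
    ext
    rw [Cells.nat_hom, h, cellsOfStrongTrans_hom]
    simp
  obtain ⟨a, n, _, _, _⟩ := β
  unfold Cells.strongTrans
  congr 1
  funext _ _ f
  exact h1 f.1 f.2.1 f.2.2

end

end StrongTrans

end TransformationCells

/-! ### The hexagon of the bicategory translated into `E`. -/

section HexagonCells

variable {E : Type u} [Category.{v} E] [MonoidalCategory E]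

lemma paste_intertwine {W₁ W₂ W₃ P Q W₁' W₂' W₃' P' Q' : E} {a₁ : W₁ ⟶ W₁'} {a₂ : W₂ ⟶ W₂'}
    {a₃ : W₃ ⟶ W₃'} {p : P ⟶ P'} {q : Q ⟶ Q'} {σ : W₁ ⊗ P ⟶ P ⊗ W₂} {τ : W₂ ⊗ Q ⟶ Q ⊗ W₃}
    {σ' : W₁' ⊗ P' ⟶ P' ⊗ W₂'} {τ' : W₂' ⊗ Q' ⟶ Q' ⊗ W₃'}
    (h : (a₁ ⊗ₘ p) ≫ σ' = σ ≫ (p ⊗ₘ a₂)) (h' : (a₂ ⊗ₘ q) ≫ τ' = τ ≫ (q ⊗ₘ a₃)) :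
    (a₁ ⊗ₘ (p ⊗ₘ q)) ≫ paste σ' τ' = paste σ τ ≫ ((p ⊗ₘ q) ⊗ₘ a₃) := by
  simp only [paste, Category.assoc]
  rw [associator_inv_naturality_assoc, ← tensorHom_id, tensorHom_comp_tensorHom_assoc, h,
    Category.comp_id, ← id_tensorHom]
  rw [← associator_inv_naturality, ← id_tensorHom, tensorHom_comp_tensorHom_assoc, Category.id_comp, ← h',
    ← tensorHom_id]
  have e1 : ((σ ≫ (p ⊗ₘ a₂)) ⊗ₘ q) = (σ ⊗ₘ 𝟙 Q) ≫ ((p ⊗ₘ a₂) ⊗ₘ q) := by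
    rw [tensorHom_comp_tensorHom, Category.id_comp]
  have e2 : (p ⊗ₘ (a₂ ⊗ₘ q) ≫ τ') = (p ⊗ₘ (a₂ ⊗ₘ q)) ≫ (𝟙 P' ⊗ₘ τ') := by
    rw [tensorHom_comp_tensorHom, Category.comp_id]
  rw [e1, e2, Category.assoc, associator_naturality_assoc]
  simp only [Category.assoc]

section

variable {T : TensorProduct (MonoidalSingleObj E)} (u : UnitIdent T)

/-- The isomorphism between fourfold tensor products in `E` and in the bicategory. -/
def quadruple (X Y Z W : E) : X ⊗ (Y ⊗ (Z ⊗ W)) ≅ tens T X (tens T Y (tens T Z W)) :=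
  whiskerLeftIso X (triple u Y Z W) ≪≫ pair u X (tens T Y (tens T Z W))

lemma quadruple_hom (X Y Z W : E) : (quadruple u X Y Z W).hom =
    X ◁ (triple u Y Z W).hom ≫ (pair u X (tens T Y (tens T Z W))).hom := rfl

lemma quadruple_hom' (X Y Z W : E) : (quadruple u X Y Z W).hom =
    (𝟙 X ⊗ₘ (𝟙 Y ⊗ₘ (pair u Z W).hom)) ≫ (triple u X Y (tens T Z W)).hom := by
  simp [quadruple_hom, triple_hom]

variable (T) in
/-- The tensor product of an object with a square, in the bicategory. -/
def tensSq (X : E) {l r p p' : E} (s : l ⊗ p' ⟶ p ⊗ r) :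
    tens T X l ⊗ tens T (𝟙_ E) p' ⟶ tens T (𝟙_ E) p ⊗ tens T X r :=
  (tensMul T X l (𝟙_ E) p').hom ≫ tensHom T ((ρ_ X).hom ≫ (λ_ X).inv) s ≫
    (tensMul T (𝟙_ E) p X r).inv

variable [BraidedCategory E]

/-- Of the two exchanges of inner factors, the first involves a unit and is trivial; the second
moves `X` past `P`. This is how the braiding, rather than `t`, enters the hexagon. -/
lemma tensSq_intertwine (hu : ∀ X Y : E, β_ X Y = (swapIso u X Y).symm) (X : E) {l r P : E}
    (s : l ⊗ P ⟶ P ⊗ r) :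
    ((pair u X l).hom ⊗ₘ (u.lIso P).inv) ≫ tensSq T X s =
      tensorLeftSq X s ≫ ((u.lIso P).inv ⊗ₘ (pair u X r).hom) := by
  have e : (u.lIso P).inv = (λ_ P).inv ≫ (pair u (𝟙_ E) P).hom := by
    rw [Iso.eq_inv_comp, ← pair_lIso u, Category.assoc, Iso.hom_inv_id, Category.comp_id]
  have e1 : ((pair u X l).hom ⊗ₘ (u.lIso P).inv) =
      (𝟙 _ ⊗ₘ (λ_ P).inv) ≫ ((pair u X l).hom ⊗ₘ (pair u (𝟙_ E) P).hom) := by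
    rw [e, tensorHom_comp_tensorHom, Category.id_comp]
  have e2 : ((u.lIso P).inv ⊗ₘ (pair u X r).hom) =
      ((λ_ P).inv ⊗ₘ 𝟙 _) ≫ ((pair u (𝟙_ E) P).hom ⊗ₘ (pair u X r).hom) := by
    rw [e, tensorHom_comp_tensorHom, Category.id_comp]
  have h1 := pair_tensMul u hu X l (𝟙_ E) P
  have h2 := pair_naturality u ((ρ_ X).hom ≫ (λ_ X).inv) s
  have h3 := pair_tensMul_inv u hu (𝟙_ E) P X r
  rw [e1, e2, tensSq, Category.assoc, reassoc_of% h1, ← reassoc_of% h2, h3]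
  simp only [← Category.assoc]
  congr 1
  simp only [tensorμ, tensorδ, tensorLeftSq, braiding_inv_tensorUnit_left]
  monoidal

lemma tensorLeftSq_intertwine (X : E) {l r l' r' P : E} {s : l ⊗ P ⟶ P ⊗ r} {s' : l' ⊗ P ⟶ P ⊗ r'}
    {a : l ⟶ l'} {a' : r ⟶ r'} (h : a ▷ P ≫ s' = s ≫ P ◁ a') :
    (X ◁ a) ▷ P ≫ tensorLeftSq X s' = tensorLeftSq X s ≫ P ◁ X ◁ a' := by
  have h1 := congrArg (X ◁ ·) h
  simp only [MonoidalCategory.whiskerLeft_comp] at h1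
  simp only [tensorLeftSq, Category.assoc, whisker_assoc, Iso.inv_hom_id_assoc]
  rw [reassoc_of% h1, associator_inv_naturality_right_assoc, whisker_exchange_assoc]
  simp

end

section Hexagon

variable {T : TensorProduct (MonoidalSingleObj E)} (β : Pseudofunctor.StrongTrans (tensor3 T) (tensor3Swap T))

/-- The pseudo-naturality cell of the upper path of the hexagon, in `E`. -/
def hexSrcCell (X Y Z W : E) :
    tens T X (tens T Y (tens T Z W)) ⊗ (bObj β ⊗ (tens T (𝟙_ E) (bObj β) ⊗ bObj β)) ⟶
      (bObj β ⊗ (tens T (𝟙_ E) (bObj β) ⊗ bObj β)) ⊗ tens T Z (tens T Y (tens T X W)) :=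
  paste (bNatIso β X Y (tens T Z W)).hom
    (paste (tensSq T Y (bNatIso β X Z W).hom) (bNatIso β Y Z (tens T X W)).hom)

/-- The pseudo-naturality cell of the lower path of the hexagon, in `E`. -/
def hexTgtCell (X Y Z W : E) :
    tens T X (tens T Y (tens T Z W)) ⊗ (tens T (𝟙_ E) (bObj β) ⊗ (bObj β ⊗ tens T (𝟙_ E) (bObj β))) ⟶
      (tens T (𝟙_ E) (bObj β) ⊗ (bObj β ⊗ tens T (𝟙_ E) (bObj β))) ⊗
        tens T Z (tens T Y (tens T X W)) :=
  paste (tensSq T X (bNatIso β Y Z W).hom)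
    (paste (bNatIso β X Z (tens T Y W)).hom (tensSq T Z (bNatIso β X Y W).hom))

variable (u : UnitIdent T)

/-- The cell filling the hexagon which is given by an automorphism of `B ⊗ (B ⊗ B)`. -/
def hexCell (S : bObj β ⊗ (bObj β ⊗ bObj β) ≅ bObj β ⊗ (bObj β ⊗ bObj β)) :
    bObj β ⊗ (tens T (𝟙_ E) (bObj β) ⊗ bObj β) ≅
      tens T (𝟙_ E) (bObj β) ⊗ (bObj β ⊗ tens T (𝟙_ E) (bObj β)) :=
  (Iso.refl _ ⊗ᵢ (u.lIso _ ⊗ᵢ Iso.refl _)) ≪≫ S ≪≫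
    ((u.lIso _).symm ⊗ᵢ (Iso.refl _ ⊗ᵢ (u.lIso _).symm))

lemma hexCell_hom (S : bObj β ⊗ (bObj β ⊗ bObj β) ≅ bObj β ⊗ (bObj β ⊗ bObj β)) :
    (hexCell β u S).hom = (𝟙 _ ⊗ₘ ((u.lIso _).hom ⊗ₘ 𝟙 _)) ≫ S.hom ≫
      ((u.lIso _).inv ⊗ₘ (𝟙 _ ⊗ₘ (u.lIso _).inv)) := rfl

/-- There is only one object, so `γ` is a single cell, and it can be recovered from `S`. -/
lemma hexCell_S (b : WeakBStructure T) : hexCell b.β u (b.S u) =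
    b.γ (.star E) (.star E) (.star E) (.star E) := by
  let γ : bObj b.β ⊗ (tens T (𝟙_ E) (bObj b.β) ⊗ bObj b.β) ≅
      tens T (𝟙_ E) (bObj b.β) ⊗ (bObj b.β ⊗ tens T (𝟙_ E) (bObj b.β)) :=
    b.γ (.star E) (.star E) (.star E) (.star E)
  have hS : (b.S u).hom = bObj b.β ◁ ((u.lIso (bObj b.β)).inv ▷ bObj b.β) ≫ γ.hom ≫
      ((u.lIso _).hom ⊗ₘ _ ◁ (u.lIso _).hom) := rfl
  have h : hexCell b.β u (b.S u) = γ := by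
    ext
    rw [hexCell_hom, hS]
    simp
  exact h

variable [BraidedCategory E] (hu : ∀ X Y : E, β_ X Y = (swapIso u X Y).symm)

lemma bNatIso_triple (X Y Z : E) :
    ((triple u X Y Z).hom ⊗ₘ 𝟙 _) ≫ (bNatIso β X Y Z).hom =
      ((cellsOfStrongTrans β u hu).σ X Y Z).hom ≫ (𝟙 _ ⊗ₘ (triple u Y X Z).hom) := by
  rw [cellsOfStrongTrans_hom]
  simp

lemma bNatIso_quadruple (X Y Z W : E) :
    ((quadruple u X Y Z W).hom ⊗ₘ 𝟙 _) ≫ (bNatIso β X Y (tens T Z W)).hom =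
      ((cellsOfStrongTrans β u hu).σ X Y (Z ⊗ W)).hom ≫ (𝟙 _ ⊗ₘ (quadruple u Y X Z W).hom) := by
  have h1 := bNatIso_triple β u hu X Y (tens T Z W)
  have h2 := (cellsOfStrongTrans β u hu).naturality (𝟙 X) (𝟙 Y) (pair u Z W).hom
  rw [tensorHom_id, id_tensorHom] at h1
  rw [quadruple_hom', quadruple_hom', tensorHom_id _ (bObj β), id_tensorHom (bObj β), comp_whiskerRight, Category.assoc,
    h1, reassoc_of% h2, MonoidalCategory.whiskerLeft_comp]

lemma tensSq_quadruple (X Y Z W : E) :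
    ((quadruple u X Y Z W).hom ⊗ₘ (u.lIso _).inv) ≫ tensSq T X (bNatIso β Y Z W).hom =
      tensorLeftSq X ((cellsOfStrongTrans β u hu).σ Y Z W).hom ≫
        ((u.lIso _).inv ⊗ₘ (quadruple u X Z Y W).hom) := by
  have h1 := bNatIso_triple β u hu Y Z W
  have h2 := tensSq_intertwine u hu X (bNatIso β Y Z W).hom
  rw [tensorHom_id, id_tensorHom] at h1
  have h3 := tensorLeftSq_intertwine X h1
  have e1 : ((quadruple u X Y Z W).hom ⊗ₘ (u.lIso (bObj β)).inv) = (X ◁ (triple u Y Z W).hom) ▷ _ ≫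
      ((pair u X _).hom ⊗ₘ (u.lIso (bObj β)).inv) := by
    rw [quadruple_hom, ← tensorHom_id, tensorHom_comp_tensorHom, Category.id_comp]
  have e2 : ((u.lIso (bObj β)).inv ⊗ₘ (quadruple u X Z Y W).hom) = _ ◁ (X ◁ (triple u Z Y W).hom) ≫
      ((u.lIso (bObj β)).inv ⊗ₘ (pair u X _).hom) := by
    rw [quadruple_hom, ← id_tensorHom, ← id_tensorHom, tensorHom_comp_tensorHom, Category.id_comp]
  rw [e1, e2, Category.assoc, h2, reassoc_of% h3]

lemma hexSrcCell_quadruple (X Y Z W : E) :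
    ((quadruple u X Y Z W).hom ⊗ₘ (𝟙 _ ⊗ₘ ((u.lIso _).inv ⊗ₘ 𝟙 _))) ≫ hexSrcCell β X Y Z W =
      (cellsOfStrongTrans β u hu).hexSrc X Y Z W ≫
        ((𝟙 _ ⊗ₘ ((u.lIso _).inv ⊗ₘ 𝟙 _)) ⊗ₘ (quadruple u Z Y X W).hom) :=
  paste_intertwine (bNatIso_quadruple β u hu X Y Z W)
    (paste_intertwine (tensSq_quadruple β u hu Y X Z W) (bNatIso_quadruple β u hu Y Z X W))

lemma hexTgtCell_quadruple (X Y Z W : E) :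
    ((quadruple u X Y Z W).hom ⊗ₘ ((u.lIso _).inv ⊗ₘ (𝟙 _ ⊗ₘ (u.lIso _).inv))) ≫
        hexTgtCell β X Y Z W =
      (cellsOfStrongTrans β u hu).hexTgt X Y Z W ≫
        (((u.lIso _).inv ⊗ₘ (𝟙 _ ⊗ₘ (u.lIso _).inv)) ⊗ₘ (quadruple u Z Y X W).hom) :=
  paste_intertwine (tensSq_quadruple β u hu X Y Z W)
    (paste_intertwine (bNatIso_quadruple β u hu X Z Y W) (tensSq_quadruple β u hu Z X Y W))

/-- The two equations are conjugate under `quadruple` and the identification of `1 ⊗ β` with `B`,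
all of which are invertible. -/
lemma hexCell_natural_iff (S : bObj β ⊗ (bObj β ⊗ bObj β) ≅ bObj β ⊗ (bObj β ⊗ bObj β)) :
    (∀ X Y Z W : E, tens T X (tens T Y (tens T Z W)) ◁ (hexCell β u S).hom ≫ hexTgtCell β X Y Z W =
      hexSrcCell β X Y Z W ≫ (hexCell β u S).hom ▷ tens T Z (tens T Y (tens T X W))) ↔
    (cellsOfStrongTrans β u hu).HexNatural S.hom := by
  refine forall_congr' fun X => forall_congr' fun Y => forall_congr' fun Z => forall_congr' fun W => ?_
  rw [← cancel_epi ((quadruple u X Y Z W).hom ⊗ₘ (𝟙 (bObj β) ⊗ₘ ((u.lIso (bObj β)).inv ⊗ₘ 𝟙 (bObj β)))),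
    ← cancel_mono (((u.lIso (bObj β)).inv ⊗ₘ (𝟙 (bObj β) ⊗ₘ (u.lIso (bObj β)).inv)) ⊗ₘ
      (quadruple u Z Y X W).hom), reassoc_of% (hexSrcCell_quadruple β u hu X Y Z W)]
  have h1 : ∀ {Q : E} (f : bObj β ⊗ (bObj β ⊗ bObj β) ⟶ Q),
      (𝟙 (bObj β) ⊗ₘ ((u.lIso (bObj β)).inv ⊗ₘ 𝟙 (bObj β))) ≫
        (𝟙 (bObj β) ⊗ₘ ((u.lIso (bObj β)).hom ⊗ₘ 𝟙 (bObj β))) ≫ f = f := by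
    intro Q f
    simp
  have e1 : ((quadruple u X Y Z W).hom ⊗ₘ (𝟙 (bObj β) ⊗ₘ ((u.lIso (bObj β)).inv ⊗ₘ 𝟙 (bObj β)))) ≫
      tens T X (tens T Y (tens T Z W)) ◁ (hexCell β u S).hom =
      _ ◁ S.hom ≫ ((quadruple u X Y Z W).hom ⊗ₘ
        ((u.lIso (bObj β)).inv ⊗ₘ (𝟙 (bObj β) ⊗ₘ (u.lIso (bObj β)).inv))) := by
    rw [← id_tensorHom, ← id_tensorHom, tensorHom_comp_tensorHom, tensorHom_comp_tensorHom,
      hexCell_hom, h1, Category.comp_id, Category.id_comp]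
  have e2 : ((𝟙 (bObj β) ⊗ₘ ((u.lIso (bObj β)).inv ⊗ₘ 𝟙 (bObj β))) ⊗ₘ (quadruple u Z Y X W).hom) ≫
      (hexCell β u S).hom ▷ tens T Z (tens T Y (tens T X W)) =
      S.hom ▷ _ ≫ (((u.lIso (bObj β)).inv ⊗ₘ (𝟙 (bObj β) ⊗ₘ (u.lIso (bObj β)).inv)) ⊗ₘ
        (quadruple u Z Y X W).hom) := by
    rw [← tensorHom_id, ← tensorHom_id, tensorHom_comp_tensorHom, tensorHom_comp_tensorHom,
      hexCell_hom, h1, Category.comp_id, Category.id_comp]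
  rw [reassoc_of% e1, hexTgtCell_quadruple β u hu, e2]
  simp only [Category.assoc]

lemma WeakBStructure.hexNatural (b : WeakBStructure T) :
    (cellsOfStrongTrans b.β u hu).HexNatural (b.S u).hom := by
  rw [← hexCell_natural_iff, hexCell_S]
  intro X Y Z W
  exact b.γ_naturality (X := .star E) (Y := .star E) (Z := .star E) (W := .star E) (X' := .star E)
    (Y' := .star E) (Z' := .star E) (W' := .star E) X Y Z W

end Hexagon

end HexagonCells

/-! ### The two pastings of the permutohedron translated into `E`. -/

section PermutohedronCells

variable {E : Type u} [Category.{v} E] [MonoidalCategory E]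

section Squares

/-- Commuting squares carry the identifications of `1 ⊗ β` and `1 ⊗ (1 ⊗ β)` with `B` through a
pasting, one cell at a time. -/
lemma commSq_whiskerLeft {X X' P Q P' Q' : E} {a : X ⟶ X'} {f : P ⟶ Q} {f' : P' ⟶ Q'} {x : P ⟶ P'}
    {y : Q ⟶ Q'} (h : CommSq f x y f') : CommSq (X ◁ f) (a ⊗ₘ x) (a ⊗ₘ y) (X' ◁ f') := by
  constructor
  rw [← id_tensorHom, ← id_tensorHom, tensorHom_comp_tensorHom, tensorHom_comp_tensorHom, h.w,
    Category.comp_id, Category.id_comp]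

lemma commSq_whiskerRight {X X' P Q P' Q' : E} {a : X ⟶ X'} {f : P ⟶ Q} {f' : P' ⟶ Q'} {x : P ⟶ P'}
    {y : Q ⟶ Q'} (h : CommSq f x y f') : CommSq (f ▷ X) (x ⊗ₘ a) (y ⊗ₘ a) (f' ▷ X') := by
  constructor
  rw [← tensorHom_id, ← tensorHom_id, tensorHom_comp_tensorHom, tensorHom_comp_tensorHom, h.w,
    Category.comp_id, Category.id_comp]

/-- A morphism acting on the first two factors. -/
def actFirst2 {p q p' q' : E} (η : p ⊗ q ⟶ p' ⊗ q') (s : E) : p ⊗ (q ⊗ s) ⟶ p' ⊗ (q' ⊗ s) :=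
  (α_ p q s).inv ≫ η ▷ s ≫ (α_ p' q' s).hom

/-- A morphism acting on the first three factors. -/
def actFirst3 {p q r p' q' r' : E} (η : p ⊗ (q ⊗ r) ⟶ p' ⊗ (q' ⊗ r')) (s : E) :
    p ⊗ (q ⊗ (r ⊗ s)) ⟶ p' ⊗ (q' ⊗ (r' ⊗ s)) :=
  p ◁ (α_ q r s).inv ≫ (α_ p (q ⊗ r) s).inv ≫ η ▷ s ≫
    (α_ p' (q' ⊗ r') s).hom ≫ p' ◁ (α_ q' r' s).hom

variable {B : E} {p q p' q' s : E} {a : p ⟶ B} {b : q ⟶ B} {a' : p' ⟶ B} {b' : q' ⟶ B}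

lemma commSq_actFirst2 {P : E} {η : p ⊗ q ⟶ p' ⊗ q'} {τ : B ⊗ B ⟶ B ⊗ B} {d : s ⟶ P}
    (h : CommSq η (a ⊗ₘ b) (a' ⊗ₘ b') τ) :
    CommSq (actFirst2 η s) (a ⊗ₘ (b ⊗ₘ d)) (a' ⊗ₘ (b' ⊗ₘ d)) (first2 τ P) :=
  (CommSq.mk (associator_inv_naturality a b d).symm).horiz_comp
    ((commSq_whiskerRight h).horiz_comp ⟨(associator_naturality a' b' d).symm⟩)

lemma commSq_actFirst3 {P r r' : E} {c : r ⟶ B} {c' : r' ⟶ B} {η : p ⊗ (q ⊗ r) ⟶ p' ⊗ (q' ⊗ r')}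
    {Z : B ⊗ (B ⊗ B) ⟶ B ⊗ (B ⊗ B)} {d : s ⟶ P}
    (h : CommSq η (a ⊗ₘ (b ⊗ₘ c)) (a' ⊗ₘ (b' ⊗ₘ c')) Z) :
    CommSq (actFirst3 η s) (a ⊗ₘ (b ⊗ₘ (c ⊗ₘ d))) (a' ⊗ₘ (b' ⊗ₘ (c' ⊗ₘ d))) (first3 Z P) :=
  (commSq_whiskerLeft ⟨(associator_inv_naturality b c d).symm⟩).horiz_comp
    ((CommSq.mk (associator_inv_naturality a (b ⊗ₘ c) d).symm).horiz_comp
      ((commSq_whiskerRight h).horiz_comp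
        ((CommSq.mk (associator_naturality a' (b' ⊗ₘ c') d).symm).horiz_comp
          (commSq_whiskerLeft ⟨(associator_naturality b' c' d).symm⟩))))

end Squares

section LeftTensor

variable (T : TensorProduct (MonoidalSingleObj E))

/-- The composition constraint of `1 ⊗ -`. -/
def leftMul (X Y : E) : tens T (𝟙_ E) X ⊗ tens T (𝟙_ E) Y ≅ tens T (𝟙_ E) (X ⊗ Y) :=
  tensMul T (𝟙_ E) X (𝟙_ E) Y ≪≫ tensIso (ρ_ _) (Iso.refl _)

/-- The action of `1 ⊗ -` on morphisms between threefold tensor products. -/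
def leftPath {p q r p' q' r' : E} (η : p ⊗ (q ⊗ r) ⟶ p' ⊗ (q' ⊗ r')) :
    tens T (𝟙_ E) p ⊗ (tens T (𝟙_ E) q ⊗ tens T (𝟙_ E) r) ⟶
      tens T (𝟙_ E) p' ⊗ (tens T (𝟙_ E) q' ⊗ tens T (𝟙_ E) r') :=
  _ ◁ (leftMul T q r).hom ≫ (leftMul T p (q ⊗ r)).hom ≫ tensHom T (𝟙 _) η ≫
    (leftMul T p' (q' ⊗ r')).inv ≫ _ ◁ (leftMul T q' r').inv

variable {T} (u : UnitIdent T)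

lemma leftMul_lIso (X Y : E) :
    (leftMul T X Y).hom ≫ (u.lIso (X ⊗ Y)).hom = ((u.lIso X).hom ⊗ₘ (u.lIso Y).hom) := by
  rw [← lIso_tensor, leftMul, unitors_equal]
  simp

lemma leftMul_inv_lIso (X Y : E) :
    (leftMul T X Y).inv ≫ ((u.lIso X).hom ⊗ₘ (u.lIso Y).hom) = (u.lIso (X ⊗ Y)).hom := by
  rw [Iso.inv_comp_eq, leftMul_lIso]

/-- `1 ⊗ -` is identified with the identity compatibly with composition, so `1 ⊗ γ` acts as `γ`
itself. -/
lemma commSq_leftPath {p q r p' q' r' : E} (η : p ⊗ (q ⊗ r) ⟶ p' ⊗ (q' ⊗ r')) :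
    CommSq (leftPath T η) ((u.lIso p).hom ⊗ₘ ((u.lIso q).hom ⊗ₘ (u.lIso r).hom))
      ((u.lIso p').hom ⊗ₘ ((u.lIso q').hom ⊗ₘ (u.lIso r').hom)) η := by
  constructor
  simp only [leftPath, Category.assoc]
  rw [← id_tensorHom, ← id_tensorHom, tensorHom_comp_tensorHom, leftMul_inv_lIso, Category.id_comp,
    leftMul_inv_lIso, lIso_naturality, reassoc_of% (leftMul_lIso u), tensorHom_comp_tensorHom_assoc,
    leftMul_lIso, Category.id_comp]

end LeftTensor

section Permutohedron

variable {T : TensorProduct (MonoidalSingleObj E)} (β : Pseudofunctor.StrongTrans (tensor3 T) (tensor3Swap T))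

/-- The 1-morphism `1 ⊗ β`. -/
abbrev bObj₁ : E := tens T (𝟙_ E) (bObj β)

/-- The 1-morphism `1 ⊗ (1 ⊗ β)`. -/
abbrev bObj₂ : E := tens T (𝟙_ E) (bObj₁ β)

/-- The cell of `β` at `(1, 1, β)`. -/
def bSq : bObj₂ β ⊗ bObj β ≅ bObj β ⊗ bObj₂ β := bNatIso β (𝟙_ E) (𝟙_ E) (bObj β)

variable (G : bObj β ⊗ (bObj₁ β ⊗ bObj β) ⟶ bObj₁ β ⊗ (bObj β ⊗ bObj₁ β))

/-- The first pasting on the boundary of the permutohedron, in `E`. -/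
def pasting1Cell : bObj β ⊗ (bObj₁ β ⊗ (bObj₂ β ⊗ (bObj β ⊗ (bObj₁ β ⊗ bObj β)))) ⟶
    bObj₂ β ⊗ (bObj₁ β ⊗ (bObj₂ β ⊗ (bObj β ⊗ (bObj₁ β ⊗ bObj₂ β)))) :=
  bObj β ◁ bObj₁ β ◁ bObj₂ β ◁ G ≫
    bObj β ◁ actFirst3 (leftPath T G) (bObj β ⊗ bObj₁ β) ≫
    actFirst2 (bSq β).inv (bObj₁ β ⊗ (bObj₂ β ⊗ (bObj β ⊗ bObj₁ β))) ≫
    bObj₂ β ◁ bObj β ◁ bObj₁ β ◁ actFirst2 (bSq β).hom (bObj₁ β) ≫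
    bObj₂ β ◁ actFirst3 G (bObj₂ β ⊗ bObj₁ β) ≫
    bObj₂ β ◁ bObj₁ β ◁ bObj β ◁ leftPath T G ≫
    bObj₂ β ◁ bObj₁ β ◁ actFirst2 (bSq β).inv (bObj₁ β ⊗ bObj₂ β)

/-- The second pasting on the boundary of the permutohedron, in `E`. -/
def pasting2Cell : bObj β ⊗ (bObj₁ β ⊗ (bObj₂ β ⊗ (bObj β ⊗ (bObj₁ β ⊗ bObj β)))) ⟶
    bObj₂ β ⊗ (bObj₁ β ⊗ (bObj₂ β ⊗ (bObj β ⊗ (bObj₁ β ⊗ bObj₂ β)))) :=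
  bObj β ◁ bObj₁ β ◁ actFirst2 (bSq β).hom (bObj₁ β ⊗ bObj β) ≫
    actFirst3 G (bObj₂ β ⊗ (bObj₁ β ⊗ bObj β)) ≫
    bObj₁ β ◁ bObj β ◁ actFirst3 (leftPath T G) (bObj β) ≫
    bObj₁ β ◁ actFirst2 (bSq β).inv (bObj₁ β ⊗ (bObj₂ β ⊗ bObj β)) ≫
    bObj₁ β ◁ bObj₂ β ◁ bObj β ◁ bObj₁ β ◁ (bSq β).hom ≫
    bObj₁ β ◁ bObj₂ β ◁ actFirst3 G (bObj₂ β) ≫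
    actFirst3 (leftPath T G) (bObj β ⊗ (bObj₁ β ⊗ bObj₂ β))

variable (u : UnitIdent T)

/-- The inverse of the cell corresponds to `t`, because `t` has source `B ⊗ X` while the
pseudo-naturality cell ends there. -/
lemma commSq_bSq_inv : CommSq (bSq β).inv (𝟙 (bObj β) ⊗ₘ (u.iso3 (bObj β)).hom)
    ((u.iso3 (bObj β)).hom ⊗ₘ 𝟙 (bObj β)) (halfBraiding3 u β (bObj β)).hom := by
  constructor
  simp [halfBraiding3, bSq, bNatIso]

lemma commSq_bSq_hom : CommSq (bSq β).hom ((u.iso3 (bObj β)).hom ⊗ₘ 𝟙 (bObj β))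
    (𝟙 (bObj β) ⊗ₘ (u.iso3 (bObj β)).hom) (halfBraiding3 u β (bObj β)).inv := by
  constructor
  simp [halfBraiding3, bSq, bNatIso]

variable (S : bObj β ⊗ (bObj β ⊗ bObj β) ≅ bObj β ⊗ (bObj β ⊗ bObj β))

lemma commSq_hexCell : CommSq (hexCell β u S).hom (𝟙 _ ⊗ₘ ((u.lIso (bObj β)).hom ⊗ₘ 𝟙 _))
    ((u.lIso (bObj β)).hom ⊗ₘ (𝟙 _ ⊗ₘ (u.lIso (bObj β)).hom)) S.hom := by
  constructor
  rw [hexCell_hom]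
  simp

lemma commSq_leftPath_hexCell : CommSq (leftPath T (hexCell β u S).hom)
    ((u.lIso (bObj β)).hom ⊗ₘ ((u.iso3 (bObj β)).hom ⊗ₘ (u.lIso (bObj β)).hom))
    ((u.iso3 (bObj β)).hom ⊗ₘ ((u.lIso (bObj β)).hom ⊗ₘ (u.iso3 (bObj β)).hom)) S.hom := by
  have h := (commSq_leftPath u (hexCell β u S).hom).vert_comp (commSq_hexCell β u S)
  simpa only [UnitIdent.iso3, Iso.trans_hom, tensorHom_comp_tensorHom, Category.comp_id] using h

lemma commSq_pasting1Cell : CommSq (pasting1Cell β (hexCell β u S).hom)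
    (𝟙 _ ⊗ₘ ((u.lIso (bObj β)).hom ⊗ₘ ((u.iso3 (bObj β)).hom ⊗ₘ (𝟙 _ ⊗ₘ
      ((u.lIso (bObj β)).hom ⊗ₘ 𝟙 _)))))
    ((u.iso3 (bObj β)).hom ⊗ₘ ((u.lIso (bObj β)).hom ⊗ₘ ((u.iso3 (bObj β)).hom ⊗ₘ (𝟙 _ ⊗ₘ
      ((u.lIso (bObj β)).hom ⊗ₘ (u.iso3 (bObj β)).hom)))))
    (Z456 S.hom ≫ bObj β ◁ first3 S.hom (bObj β ⊗ bObj β) ≫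
      t1 (halfBraiding3 u β (bObj β)).hom ≫ t4 (halfBraiding3 u β (bObj β)).inv ≫
        bObj β ◁ first3 S.hom (bObj β ⊗ bObj β) ≫ Z456 S.hom ≫
          t3 (halfBraiding3 u β (bObj β)).hom) :=
  have hG := commSq_hexCell β u S
  have hP := commSq_leftPath_hexCell β u S
  have hi := commSq_bSq_inv β u
  have hh := commSq_bSq_hom β u
  (commSq_whiskerLeft (commSq_whiskerLeft (commSq_whiskerLeft hG))).horiz_comp <|
    (commSq_whiskerLeft (commSq_actFirst3 hP)).horiz_comp <|
    (commSq_actFirst2 hi).horiz_comp <|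
    (commSq_whiskerLeft (commSq_whiskerLeft (commSq_whiskerLeft (commSq_actFirst2 hh)))).horiz_comp <|
    (commSq_whiskerLeft (commSq_actFirst3 hG)).horiz_comp <|
    (commSq_whiskerLeft (commSq_whiskerLeft (commSq_whiskerLeft hP))).horiz_comp <|
    (commSq_whiskerLeft (commSq_whiskerLeft (commSq_actFirst2 hi)))

lemma commSq_pasting2Cell : CommSq (pasting2Cell β (hexCell β u S).hom)
    (𝟙 _ ⊗ₘ ((u.lIso (bObj β)).hom ⊗ₘ ((u.iso3 (bObj β)).hom ⊗ₘ (𝟙 _ ⊗ₘ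
      ((u.lIso (bObj β)).hom ⊗ₘ 𝟙 _)))))
    ((u.iso3 (bObj β)).hom ⊗ₘ ((u.lIso (bObj β)).hom ⊗ₘ ((u.iso3 (bObj β)).hom ⊗ₘ (𝟙 _ ⊗ₘ
      ((u.lIso (bObj β)).hom ⊗ₘ (u.iso3 (bObj β)).hom)))))
    (t3 (halfBraiding3 u β (bObj β)).inv ≫ first3 S.hom _ ≫ bObj β ◁ bObj β ◁ first3 S.hom (bObj β) ≫
      t2 (halfBraiding3 u β (bObj β)).hom ≫ t5 (halfBraiding3 u β (bObj β)).inv ≫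
        bObj β ◁ bObj β ◁ first3 S.hom (bObj β) ≫ first3 S.hom _) :=
  have hG := commSq_hexCell β u S
  have hP := commSq_leftPath_hexCell β u S
  have hi := commSq_bSq_inv β u
  have hh := commSq_bSq_hom β u
  (commSq_whiskerLeft (commSq_whiskerLeft (commSq_actFirst2 hh))).horiz_comp <|
    (commSq_actFirst3 hG).horiz_comp <|
    (commSq_whiskerLeft (commSq_whiskerLeft (commSq_actFirst3 hP))).horiz_comp <|
    (commSq_whiskerLeft (commSq_actFirst2 hi)).horiz_comp <|
    (commSq_whiskerLeft (commSq_whiskerLeft (commSq_whiskerLeft (commSq_whiskerLeft hh)))).horiz_comp <|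
    (commSq_whiskerLeft (commSq_whiskerLeft (commSq_actFirst3 hG))).horiz_comp <|
    (commSq_actFirst3 hP)

/-- Both pastings are intertwined with their counterparts on the sixth power of `B` by the same
isomorphisms at source and target. -/
lemma pasting_eq_iff : pasting1Cell β (hexCell β u S).hom = pasting2Cell β (hexCell β u S).hom ↔
    Z456 S.hom ≫ bObj β ◁ first3 S.hom (bObj β ⊗ bObj β) ≫
      t1 (halfBraiding3 u β (bObj β)).hom ≫ t4 (halfBraiding3 u β (bObj β)).inv ≫
        bObj β ◁ first3 S.hom (bObj β ⊗ bObj β) ≫ Z456 S.hom ≫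
          t3 (halfBraiding3 u β (bObj β)).hom =
    t3 (halfBraiding3 u β (bObj β)).inv ≫ first3 S.hom _ ≫ bObj β ◁ bObj β ◁ first3 S.hom (bObj β) ≫
      t2 (halfBraiding3 u β (bObj β)).hom ≫ t5 (halfBraiding3 u β (bObj β)).inv ≫
        bObj β ◁ bObj β ◁ first3 S.hom (bObj β) ≫ first3 S.hom _ := by
  have h1 := commSq_pasting1Cell β u S
  have h2 := commSq_pasting2Cell β u S
  rw [← cancel_mono ((u.iso3 (bObj β)).hom ⊗ₘ ((u.lIso (bObj β)).hom ⊗ₘ ((u.iso3 (bObj β)).hom ⊗ₘ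
    (𝟙 (bObj β) ⊗ₘ ((u.lIso (bObj β)).hom ⊗ₘ (u.iso3 (bObj β)).hom))))), h1.w, h2.w, cancel_epi]

end Permutohedron

end PermutohedronCells

/-! ### Construction and uniqueness of the structure with given data. -/

section Bijection

variable {E : Type u} [Category.{v} E] [MonoidalCategory E]
  {T : TensorProduct (MonoidalSingleObj E)} (u : UnitIdent T)

lemma hexCell_injective (β : Pseudofunctor.StrongTrans (tensor3 T) (tensor3Swap T)) :
    Function.Injective (hexCell β u) := by
  intro S S' h
  ext
  have h1 := congrArg Iso.hom h
  rwa [hexCell_hom, hexCell_hom, cancel_epi, cancel_mono] at h1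

/-- `S` is an automorphism of a power of `bObj b.β`, so its type varies with `β`; hence the
heterogeneous equality. -/
lemma WeakBStructure.ext_of_S {b b' : WeakBStructure T} (hβ : b.β = b'.β)
    (hS : HEq (b.S u) (b'.S u)) : b = b' := by
  have h1 := hexCell_S u b
  have h2 := hexCell_S u b'
  obtain ⟨β, γ, _, _⟩ := b
  obtain ⟨β', γ', _, _⟩ := b'
  obtain rfl : β = β' := hβ
  have h3 : γ = γ' := by
    funext X Y Z W
    rw [eq_of_heq hS] at h1
    exact h1.symm.trans h2
  subst h3
  rfl

lemma WeakBStructure.zData_S (b : WeakBStructure T) : (b.S u).hom =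
    (b.zData u).Z.hom ≫ (reversal (halfBraiding3 u b.β (bObj b.β))).hom := by
  simp [zData]

lemma hom_whiskerRight_eq_inv_iff {X Y : E} (e : X ≅ Y) (e' : Y ≅ X) (P : E) :
    e.hom ▷ P = e'.inv ▷ P ↔ e.inv ▷ P = e'.hom ▷ P := by
  constructor
  · intro h
    exact congrArg Iso.inv (Iso.ext h : whiskerRightIso e P = whiskerRightIso e'.symm P)
  · intro h
    exact congrArg Iso.hom (Iso.ext_inv h : whiskerRightIso e P = whiskerRightIso e'.symm P)

lemma inv_whiskerRight_eq_id_iff {B : E} (t : HalfBraiding B) {X : E} (e : X ≅ X) :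
    e.inv ▷ B = 𝟙 _ ↔ B ◁ e.hom = 𝟙 _ := by
  constructor
  · intro h
    have h1 : B ◁ e.inv = 𝟙 _ := by
      rw [whiskerLeft_eq_of_whiskerRight_eq t (h.trans (id_whiskerRight X B).symm),
        MonoidalCategory.whiskerLeft_id]
    simpa [h1] using whiskerLeft_hom_inv B e
  · intro h
    have h1 : e.hom ▷ B = 𝟙 _ := by
      rw [whiskerRight_eq_of_whiskerLeft_eq t (h.trans (MonoidalCategory.whiskerLeft_id B X).symm),
        id_whiskerRight]
    simpa [h1] using inv_hom_whiskerRight e B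

variable [BraidedCategory E] (hu : ∀ X Y : E, β_ X Y = (swapIso u X Y).symm)

section

variable (β : Pseudofunctor.StrongTrans (tensor3 T) (tensor3Swap T)) (X : E)

lemma halfBraiding1_inv : (halfBraiding1 u β X).inv = (unit₁ X).inv ▷ _ ≫
    ((cellsOfStrongTrans β u hu).σ X (𝟙_ E) (𝟙_ E)).hom ≫ _ ◁ (unit₂ X).hom := by
  rw [cellsOfStrongTrans_hom, triple_eq_unit₁, triple_eq_unit₂]
  simp [halfBraiding1, bNatIso]

lemma halfBraiding2_inv : (halfBraiding2 u β X).inv = (unit₂ X).inv ▷ _ ≫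
    ((cellsOfStrongTrans β u hu).σ (𝟙_ E) X (𝟙_ E)).hom ≫ _ ◁ (unit₁ X).hom := by
  rw [cellsOfStrongTrans_hom, triple_eq_unit₁, triple_eq_unit₂]
  simp [halfBraiding2, bNatIso]

lemma halfBraiding3_inv : (halfBraiding3 u β X).inv = (unit₃ X).inv ▷ _ ≫
    ((cellsOfStrongTrans β u hu).σ (𝟙_ E) (𝟙_ E) X).hom ≫ _ ◁ (unit₃ X).hom := by
  rw [cellsOfStrongTrans_hom, triple_eq_unit₃]
  simp [halfBraiding3, bNatIso]

end

/-- The braiding is inverse to the interchange, so both conditions are inverted; in the first one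
the half-braiding also moves `B` to the other side. -/
lemma compatible_iff (hu : ∀ X Y : E, β_ X Y = (swapIso u X Y).symm) (d : ZData E)
    (t : HalfBraiding d.B) (ht : t.β = d.t) :
    d.Compatible u ↔
      (∀ X Y : E, d.B ◁ ((β_ X Y).hom ≫ (β_ Y X).hom) = 𝟙 _) ∧ AgreesWithBraiding t := by
  have hs : ∀ X Y : E, swapIso u X Y = (β_ X Y).symm := fun X Y => by rw [hu, Iso.symm_symm_eq]
  refine and_congr ?_ (forall_congr' fun X => ?_)
  · rw [forall_comm]
    refine forall_congr' fun Y => forall_congr' fun X => ?_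
    rw [hs, hs]
    exact inv_whiskerRight_eq_id_iff t (β_ Y X ≪≫ β_ X Y)
  · rw [hs, ← ht]
    exact hom_whiskerRight_eq_inv_iff (t.β X) (β_ X d.B) _

/-- The conditions on the data extracted from a weak b-bicategory structure. -/
def ZData.IsAdmissible (d : ZData E) : Prop :=
  d.IsHalfBraiding ∧ d.IsSymmetric ∧ d.Compatible u ∧ d.Tetrahedron

lemma WeakBStructure.isAdmissible_zData (hu : ∀ X Y : E, β_ X Y = (swapIso u X Y).symm) (b : WeakBStructure T) (h : b.HasOneHalfBraiding u)
    (hs : (b.zData u).IsSymmetric) : (b.zData u).IsAdmissible u := by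
  have hg := cellsOfStrongTrans_isGeneratedBy b.β u hu h.1 h.2
  refine ⟨⟨hg.halfBraiding, rfl⟩, hs, ?_, ?_⟩
  · rw [compatible_iff u hu _ hg.halfBraiding rfl]
    exact ⟨hg.whiskerLeft_double_braiding, (b.hexNatural u hu).agreesWithBraiding hg.eq_stdCell⟩
  · have h1 : pasting1Cell b.β (hexCell b.β u (b.S u)).hom =
        pasting2Cell b.β (hexCell b.β u (b.S u)).hom := by
      rw [hexCell_S]
      exact b.coherence (.star E) (.star E) (.star E) (.star E) (.star E)
    rw [pasting_eq_iff] at h1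
    exact (permutohedron_iff_tetrahedron (t := hg.halfBraiding) hs (b.zData u).Z.hom (b.S u).hom
      (b.zData_S u)).1 h1

section Construction

variable {B : E} (t : HalfBraiding B) (Z : B ⊗ (B ⊗ B) ≅ B ⊗ (B ⊗ B))
  (ht : (t.β B).hom ≫ (t.β B).hom = 𝟙 _)
  (h₁ : ∀ X Y : E, B ◁ ((β_ X Y).hom ≫ (β_ Y X).hom) = 𝟙 _)
  (h₂ : AgreesWithBraiding t) (h₃ : TetrahedronEq (t.β B).hom Z.hom)

/-- The strong transformation given by a half-braiding which absorbs double braidings. -/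
def stdTrans : Pseudofunctor.StrongTrans (tensor3 T) (tensor3Swap T) :=
  (Cells.std t h₁).strongTrans u hu (by
    have h := Cells.stdCell_unit₃ t (𝟙_ E)
    rw [HalfBraiding_unit_inv, Category.assoc] at h
    exact h)

lemma cellsOfStrongTrans_stdTrans (X Y Z : E) :
    ((cellsOfStrongTrans (stdTrans u hu t h₁) u hu).σ X Y Z).hom = (stdCell t X Y Z).hom :=
  cellsOfStrongTrans_strongTrans u hu (Cells.std t h₁) _ X Y Z

lemma halfBraiding1_stdTrans (X : E) : halfBraiding1 u (stdTrans u hu t h₁) X = t.β X := by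
  have h : (halfBraiding1 u (stdTrans u hu t h₁) X).inv = (t.β X).inv := by
    rw [halfBraiding1_inv u hu, cellsOfStrongTrans_stdTrans, Cells.stdCell_unit₁]
    have h' : (unit₁ X).inv ▷ B ≫ ((unit₁ X).hom ▷ B ≫ (t.β X).inv ≫ B ◁ (unit₂ X).inv) ≫
      B ◁ (unit₂ X).hom = (t.β X).inv := by simp
    exact h'
  exact Iso.ext_inv h

lemma halfBraiding2_stdTrans (X : E) : halfBraiding2 u (stdTrans u hu t h₁) X = t.β X := by
  have h : (halfBraiding2 u (stdTrans u hu t h₁) X).inv = (t.β X).inv := by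
    rw [halfBraiding2_inv u hu, cellsOfStrongTrans_stdTrans, Cells.stdCell_unit₂]
    have h' : (unit₂ X).inv ▷ B ≫ ((unit₂ X).hom ▷ B ≫ (t.β X).inv ≫ B ◁ (unit₁ X).inv) ≫
      B ◁ (unit₁ X).hom = (t.β X).inv := by simp
    exact h'
  exact Iso.ext_inv h

lemma halfBraiding3_stdTrans (X : E) : halfBraiding3 u (stdTrans u hu t h₁) X = t.β X := by
  have h : (halfBraiding3 u (stdTrans u hu t h₁) X).inv = (t.β X).inv := by
    rw [halfBraiding3_inv u hu, cellsOfStrongTrans_stdTrans, Cells.stdCell_unit₃]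
    have h' : (unit₃ X).inv ▷ B ≫ ((unit₃ X).hom ▷ B ≫ (t.β X).inv ≫ B ◁ (unit₃ X).inv) ≫
      B ◁ (unit₃ X).hom = (t.β X).inv := by simp
    exact h'
  exact Iso.ext_inv h

open WeakBStructure in
/-- The weak b-bicategory structure given by a half-braiding and a solution of the tetrahedron
equation. -/
def weakBOfTetrahedron : WeakBStructure T where
  β := stdTrans u hu t h₁
  γ _ _ _ _ := hexCell (stdTrans u hu t h₁) u (Z ≪≫ reversal (t.β B))
  γ_naturality {X X' Y Y' Z' Z'' W W'} f g h k :=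
    (hexCell_natural_iff (stdTrans u hu t h₁) u hu (Z ≪≫ reversal (t.β B))).2
      (h₂.hexNatural _ (cellsOfStrongTrans_stdTrans u hu t h₁) _) f g h k
  coherence _ _ _ _ _ := by
    have h := (permutohedron_iff_tetrahedron ht Z.hom (Z ≪≫ reversal (t.β B)).hom rfl).2 h₃
    refine (pasting_eq_iff (stdTrans u hu t h₁) u (Z ≪≫ reversal (t.β B))).2 ?_
    rw [halfBraiding3_stdTrans]
    exact h

open WeakBStructure in
lemma weakBOfTetrahedron_S : (weakBOfTetrahedron u hu t Z ht h₁ h₂ h₃).S u = Z ≪≫ reversal (t.β B) :=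
  hexCell_injective u (stdTrans u hu t h₁) (hexCell_S u (weakBOfTetrahedron u hu t Z ht h₁ h₂ h₃))

lemma zData_weakBOfTetrahedron :
    (weakBOfTetrahedron u hu t Z ht h₁ h₂ h₃).zData u = ⟨B, t.β, Z⟩ := by
  have h1 : halfBraiding3 u (stdTrans u hu t h₁) = t.β := funext (halfBraiding3_stdTrans u hu t h₁)
  -- Stated for variable `τ` and `S` so that the equations can be substituted although the type of
  -- `Z` depends on `B`.
  have h2 : ∀ (τ : ∀ X, B ⊗ X ≅ X ⊗ B) (S : B ⊗ (B ⊗ B) ≅ B ⊗ (B ⊗ B)), τ = t.β →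
      S = Z ≪≫ WeakBStructure.reversal (t.β B) →
        (⟨B, τ, S ≪≫ (WeakBStructure.reversal (τ B)).symm⟩ : ZData E) = ⟨B, t.β, Z⟩ := by
    rintro _ _ rfl rfl
    simp
  exact h2 _ _ h1 (weakBOfTetrahedron_S u hu t Z ht h₁ h₂ h₃)

end Construction

/-- `β` is recovered from `t` because all cells are standard, and `γ` from `Z` through `S`. With `d`
a variable, two structures with equal data are compared to one construction, which gives
injectivity. -/
lemma eq_weakBOfTetrahedron (b : WeakBStructure T) (h : b.HasOneHalfBraiding u) (d : ZData E)
    (hd : b.zData u = d) (t : HalfBraiding d.B) (htd : t.β = d.t) (ht) (h₁) (h₂) (h₃) :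
    b = weakBOfTetrahedron u hu t d.Z ht h₁ h₂ h₃ := by
  subst hd
  have hg := cellsOfStrongTrans_isGeneratedBy b.β u hu h.1 h.2
  have h4 : stdTrans u hu t h₁ = b.β := by
    unfold stdTrans
    refine Cells.strongTrans_eq b.β u hu (Cells.std t h₁) _ fun X Y Z => ?_
    rw [hg.eq_stdCell]
    have e : hg.halfBraiding.β = t.β := htd.symm
    simp only [Cells.std, stdCell, e]
  refine WeakBStructure.ext_of_S u h4.symm ?_
  rw [weakBOfTetrahedron_S, htd]
  refine heq_of_eq ?_
  ext
  exact b.zData_S u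

theorem bijOn_zData (hu : ∀ X Y : E, β_ X Y = (swapIso u X Y).symm) :
    Set.BijOn (WeakBStructure.zData u)
      {b : WeakBStructure T | b.HasOneHalfBraiding u ∧ (b.zData u).IsSymmetric}
      {d : ZData E | d.IsAdmissible u} := by
  refine ⟨fun b hb => b.isAdmissible_zData u hu hb.1 hb.2, ?_, ?_⟩
  · rintro b hb b' hb' h
    obtain ⟨⟨t, htd⟩, hs, hc, hz⟩ := b'.isAdmissible_zData u hu hb'.1 hb'.2
    have hs' : (t.β _).hom ≫ (t.β _).hom = 𝟙 _ := by rw [htd]; exact hs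
    have hz' : TetrahedronEq (t.β _).hom (b'.zData u).Z.hom := by rw [htd]; exact hz
    obtain ⟨h₁, h₂⟩ := (compatible_iff u hu _ t htd).1 hc
    rw [eq_weakBOfTetrahedron u hu b hb.1 _ h t htd hs' h₁ h₂ hz']
    exact (eq_weakBOfTetrahedron u hu b' hb'.1 _ rfl t htd hs' h₁ h₂ hz').symm
  · rintro ⟨B, τ, Z⟩ hd
    obtain ⟨t, rfl⟩ : ∃ t : HalfBraiding B, t.β = τ := hd.1
    obtain ⟨-, hs, hc, hz⟩ := hd
    obtain ⟨h₁, h₂⟩ := (compatible_iff u hu _ t rfl).1 hc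
    have h := zData_weakBOfTetrahedron u hu t Z hs h₁ h₂ hz
    refine ⟨weakBOfTetrahedron u hu t Z hs h₁ h₂ hz, ⟨⟨?_, ?_⟩, ?_⟩, h⟩
    · funext X
      exact (halfBraiding1_stdTrans u hu t h₁ X).trans (halfBraiding3_stdTrans u hu t h₁ X).symm
    · funext X
      exact (halfBraiding2_stdTrans u hu t h₁ X).trans (halfBraiding3_stdTrans u hu t h₁ X).symm
    · rw [h]
      exact hs

theorem bijOn_zData_of_symmetric (hu : ∀ X Y : E, β_ X Y = (swapIso u X Y).symm)
    (hsym : ∀ X Y : E, (swapIso u X Y).hom ≫ (swapIso u Y X).hom = 𝟙 (Y ⊗ X)) :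
    Set.BijOn
      (fun b : WeakBStructure T =>
        (⟨(b.zData u).B, (b.zData u).Z⟩ : Σ B : E, (B ⊗ (B ⊗ B) ≅ B ⊗ (B ⊗ B))))
      {b : WeakBStructure T | b.HasOneHalfBraiding u ∧
        ∀ X : E, (b.zData u).t X = swapIso u X (b.zData u).B}
      {p : Σ B : E, (B ⊗ (B ⊗ B) ≅ B ⊗ (B ⊗ B)) |
        TetrahedronEq (swapIso u p.1 p.1).hom p.2.hom} := by
  have hbij := bijOn_zData u hu
  have hsymm : ∀ d : ZData E, (∀ X : E, d.t X = swapIso u X d.B) → d.IsSymmetric := by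
    intro d hd
    rw [ZData.IsSymmetric, hd, hsym]
  -- Under this condition `t` is a function of `B`, so the pair `(B, Z)` retains all the data and
  -- the first bijection restricts.
  have heq : ∀ d : ZData E, (∀ X : E, d.t X = swapIso u X d.B) →
      d = ⟨d.B, fun X => swapIso u X d.B, d.Z⟩ := by
    rintro ⟨B, t, Z⟩ hd
    obtain rfl : t = fun X => swapIso u X B := funext hd
    rfl
  refine ⟨fun b hb => ?_, fun b hb b' hb' h => ?_, fun p hp => ?_⟩
  · have h := (hbij.1 ⟨hb.1, hsymm _ hb.2⟩).2.2.2
    rw [ZData.Tetrahedron, hb.2] at h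
    exact h
  · apply hbij.2.1 ⟨hb.1, hsymm _ hb.2⟩ ⟨hb'.1, hsymm _ hb'.2⟩
    rw [heq _ hb.2, heq _ hb'.2]
    exact congrArg (fun p : Σ B : E, (B ⊗ (B ⊗ B) ≅ B ⊗ (B ⊗ B)) =>
      (⟨p.1, fun X => swapIso u X p.1, p.2⟩ : ZData E)) h
  · have hd : (⟨p.1, fun X => swapIso u X p.1, p.2⟩ : ZData E).IsAdmissible u := by
      -- The interchange is itself the half-braiding coming from the braiding; symmetry makes both
      -- remaining conditions on it trivial.
      refine ⟨⟨braidingHB p.1, ?_⟩, hsym _ _, ⟨fun X Y => ?_, fun X => rfl⟩, hp⟩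
      · funext X
        change (β_ X p.1).symm = swapIso u X p.1
        rw [hu, Iso.symm_symm_eq]
      · rw [hsym, id_whiskerRight]
    obtain ⟨b, hb, h⟩ := hbij.2.2 hd
    refine ⟨b, ⟨hb.1, ?_⟩, ?_⟩
    · rw [h]
      exact fun _ => rfl
    · exact congrArg (fun d : ZData E => (⟨d.B, d.Z⟩ : Σ B : E, (B ⊗ (B ⊗ B) ≅ B ⊗ (B ⊗ B)))) h

end Bijection

end BBicat

open MonoidalCategory in
theorem theorem4p1 {E : Type*} [Category* E] [MonoidalCategory E]
    (T : BBicat.TensorProduct (MonoidalSingleObj E)) (u : BBicat.UnitIdent T) :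
    Set.BijOn (BBicat.WeakBStructure.zData u)
        {b : BBicat.WeakBStructure T | b.HasOneHalfBraiding u ∧ (b.zData u).IsSymmetric}
        {d : BBicat.ZData E |
          d.IsHalfBraiding ∧ d.IsSymmetric ∧ d.Compatible u ∧ d.Tetrahedron} ∧
      ((∀ X Y : E, (BBicat.swapIso u X Y).hom ≫ (BBicat.swapIso u Y X).hom = 𝟙 (Y ⊗ X)) →
        Set.BijOn
          (fun b : BBicat.WeakBStructure T =>
            (⟨(b.zData u).B, (b.zData u).Z⟩ : Σ B : E, (B ⊗ (B ⊗ B) ≅ B ⊗ (B ⊗ B))))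
          {b : BBicat.WeakBStructure T | b.HasOneHalfBraiding u ∧
            ∀ X : E, (b.zData u).t X = BBicat.swapIso u X (b.zData u).B}
          {p : Σ B : E, (B ⊗ (B ⊗ B) ≅ B ⊗ (B ⊗ B)) |
            BBicat.TetrahedronEq (BBicat.swapIso u p.1 p.1).hom p.2.hom}) := by
  -- The statement mentions no braiding; with this choice the relation between braiding and
  -- interchange holds by definition.
  let _ : BraidedCategory E := BBicat.braidedOfTens u
  exact ⟨BBicat.bijOn_zData u fun _ _ => rfl, BBicat.bijOn_zData_of_symmetric u fun _ _ => rfl⟩
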